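/- **Setting ($\gamma=3$).** Let $M(\varrho)^2=(1-\varrho^2)/\varrho^2$, $\varrho_{\rm cr}=1/\sqrt2$, $\nu(\varrho)=\int_0^\varrho \frac{\tau^2}{1-\tau^2}\,d\tau$, $\nu_{\rm cr}=\nu(\varrho_{\rm cr})$; let $\varrho(\nu)$, $\nu\in[0,\nu_{\rm cr}]$, be the inverse function, and let $k(\nu)=\int_0^{\varrho(\nu)}\frac{\sqrt{M(\tau)^2-1}}{\tau}\,\frac{d\tau}{M(\tau)^2}$ be the characteristic speed. For $\nu\in(0,\nu_{\rm cr})$ let $G_{-2}(\nu,\cdot)$, $G_{-1}(\nu,\cdot)$, $G_0(\nu,\cdot)$ be the compactly supported distributions on $\mathbb R$ whose Fourier transforms ($\hat u(\xi)=\langle u,e^{-i\xi\cdot}\rangle$) are, respectively, $$\tfrac12 k^{-3}\big(\xi k\sin(\xi k)+\cos(\xi k)\big),\qquad k^{-1}\cos(\xi k),\qquad 2\xi^{-1}\sin(\xi k),\qquad k=k(\nu).$$ Define $\beta_0=2\,k^{-1}(k')^{-1/2}$ and $$\beta_1(\nu)=\tfrac14k^{-2}(k')^{-1/2}\int_0^\nu\beta_0''\,k\,(k')^{-1/2}d\tau,\qquad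 \beta_2(\nu)=-\tfrac14k^{-3}(k')^{-1/2}\int_0^\nu\ell_1\,(k')^{-1/2}d\tau,$$ $$\ell_1=\beta_1''k^2+6\beta_1'k'k+6\beta_1k'^2+3\beta_1k''k,\qquad \ell_2=-k^2\big(\beta_2''k^2+6\beta_2'k'k+6\beta_2k'^2+3\beta_2k''k\big).$$ For $\xi\in\mathbb R$ let $\hat h(\cdot,\xi)\in C^2([0,\nu_{\rm cr}))$ be the solution of $$\hat h_{\nu\nu}+k'(\nu)^2\xi^2\hat h=\ell_2(\nu)\,\frac{2\sin(\xi k(\nu))}{\xi k(\nu)}\ \text{ in }(0,\nu_{\rm cr}),\qquad \hat h|_{\nu=0}=\hat h_\nu|_{\nu=0}=0,$$ let $h(\nu,s)=\frac1{2\pi}\int_{\mathbb R}\hat h(\nu,\xi)e^{i\xi s}\,d\xi$, and define the *singular kernel* by $$H^{\mathbf s}(\nu,\cdot)=\beta_0k^3\,G_{-2}(\nu,\cdot)+\beta_1k^3\,G_{-1}(\nu,\cdot)+\beta_2k^3\,G_0(\nu,\cdot)+h(\nu,\cdot),\qquad \nu\in(0,\nu_{\rm cr}).$$ At $\nu=0$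 the expressions $H^{\mathbf s}$ and $\varrho H^{\mathbf s}_\nu$ denote the traces, i.e. the weak limits as $\nu\to0^+$. Convolution $*$ and $\partial_s$ act on the variable $s$, in the sense of distributions. **Proposition.** 1. (The kernel is well defined.) For every $\xi\in\mathbb R$ the function $\hat h(\cdot,\xi)$ exists and is unique. For every $\nu\in(0,\nu_{\rm cr})$ the function $\hat h(\nu,\cdot)$ is integrable and $h(\nu,s)=0$ for $|s|>k(\nu)$. For every $\psi\in C^\infty(\mathbb R)$ the function $\nu\mapsto\langle H^{\mathbf s}(\nu,\cdot),\psi\rangle$ is differentiable on $(0,\nu_{\rm cr})$. 2. (Estimates.) Let $0<\nu_*<\nu_{\rm cr}$ and $\varphi\in C^\infty(\mathbb R)$. For every $S>0$ there is $C>0$ such that, for all $\nu\in[0,\nu_*]$, all $s\in[-S,S]$ and $j=0,1,2$, $$\big|\partial_s^j\big(\varrho(\nu)H^{\mathbf s}_\nu(\nu,\cdot)+H^{\mathbf s}_{ss}(\nu,\cdot)\big)*\varphi(s)\big|\le C\varrho(\nu),$$ $$\big|\varrho(\nu)\,\partial_s^jH^{\mathbf s}_\nu(\nu,\cdot)*\varphi(s)\big|+\big|\partial_s^jH^{\mathbf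 s}_s(\nu,\cdot)*\varphi(s)\big|\le C.$$ If moreover $\varphi$ and all its derivatives are bounded on $\mathbb R$ (for example if $\varphi\in C_c^\infty(\mathbb R)$), then there is $C>0$ for which these estimates hold for all $\nu\in[0,\nu_*]$, all $s\in\mathbb R$ and $j=0,1,2$. 3. (Initial conditions.) $H^{\mathbf s}|_{\nu=0}=\delta_0$ and $\varrho H^{\mathbf s}_\nu|_{\nu=0}=-\delta_0''$: for every $\psi\in C^\infty(\mathbb R)$, $\langle H^{\mathbf s}(\nu,\cdot),\psi\rangle\to\psi(0)$ and $\varrho(\nu)\,\partial_\nu\langle H^{\mathbf s}(\nu,\cdot),\psi\rangle\to-\psi''(0)$ as $\nu\to0^+$. -/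

import Mathlib

open Set Filter Topology MeasureTheory
open scoped ContDiff

noncomputable section

namespace Cavitation

/-! ### Density, renormalized density and characteristic speed (adiabatic exponent 3) -/

/-- Square of the Mach number `M = q / c`; here `ϱ = √(1 - q²)` and `c = ϱ`. -/
def machSq (r : ℝ) : ℝ := (1 - r ^ 2) / r ^ 2

/-- Critical (sonic) density: `q_cr = √(1/2)`, hence `ϱ_cr = √(1/2)`. -/
def rhoCr : ℝ := Real.sqrt (1 / 2)

/-- Renormalized density as a function of the density. -/
def nuOf (r : ℝ) : ℝ := ∫ τ in (0 : ℝ)..r, τ ^ 2 / (1 - τ ^ 2)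

/-- Critical value of the renormalized density. -/
def nuCr : ℝ := nuOf rhoCr

/-- The density `ϱ(ν)`, inverse of `nuOf : [0, ϱ_cr] → [0, ν_cr]`. -/
def rho (ν : ℝ) : ℝ := Function.invFunOn nuOf (Icc 0 rhoCr) ν

lemma rhoCr_sq : rhoCr ^ 2 = 1 / 2 := Real.sq_sqrt (by norm_num)

lemma rhoCr_nonneg : 0 ≤ rhoCr := Real.sqrt_nonneg _

/-- `rho` is a right inverse of `nuOf`. -/
lemma rho_spec {ν : ℝ} (hν : ν ∈ Icc 0 nuCr) : rho ν ∈ Icc 0 rhoCr ∧ nuOf (rho ν) = ν := by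
  have hden : ∀ τ ∈ Icc (0 : ℝ) rhoCr, 1 - τ ^ 2 ≠ 0 := by
    intro τ hτ
    have h := pow_le_pow_left₀ hτ.1 hτ.2 2
    rw [rhoCr_sq] at h
    linarith
  have hc : ContinuousOn (fun τ : ℝ => τ ^ 2 / (1 - τ ^ 2)) (Icc 0 rhoCr) :=
    (by fun_prop : ContinuousOn (fun τ : ℝ => τ ^ 2) (Icc 0 rhoCr)).div (by fun_prop) hden
  have hnu : ContinuousOn nuOf (Icc 0 rhoCr) := by
    have h := intervalIntegral.continuousOn_primitive_interval (μ := volume)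
      (a := (0 : ℝ)) (b := rhoCr) (f := fun τ : ℝ => τ ^ 2 / (1 - τ ^ 2))
      (by rw [uIcc_of_le rhoCr_nonneg]; exact hc.integrableOn_Icc)
    rwa [uIcc_of_le rhoCr_nonneg] at h
  have h0 : nuOf 0 = 0 := by simp [nuOf]
  have hmem : ν ∈ nuOf '' Icc 0 rhoCr :=
    intermediate_value_Icc rhoCr_nonneg hnu (by rw [h0]; exact hν)
  exact ⟨Function.invFunOn_mem hmem, Function.invFunOn_eq hmem⟩

/-- Characteristic speed `k(ν)`. -/
def charSpeed (ν : ℝ) : ℝ :=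
  ∫ τ in (0 : ℝ)..rho ν, Real.sqrt (machSq τ - 1) / τ * (1 / machSq τ)

/-! ### Coefficients of the singular kernel -/

/-- `β₀ = d₀ k⁻¹ (k')^(-1/2)`, the constant `d₀ = 2` being the one for which
the kernel equals `δ₀` at `ν = 0`. -/
def beta0 (ν : ℝ) : ℝ := 2 * (charSpeed ν)⁻¹ * (Real.sqrt (deriv charSpeed ν))⁻¹

def beta1 (ν : ℝ) : ℝ :=
  1 / 4 * (charSpeed ν ^ 2)⁻¹ * (Real.sqrt (deriv charSpeed ν))⁻¹ *
    ∫ τ in (0 : ℝ)..ν,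
      iteratedDeriv 2 beta0 τ * charSpeed τ * (Real.sqrt (deriv charSpeed τ))⁻¹

def ell1 (ν : ℝ) : ℝ :=
  iteratedDeriv 2 beta1 ν * charSpeed ν ^ 2
    + 6 * deriv beta1 ν * deriv charSpeed ν * charSpeed ν
    + 6 * beta1 ν * deriv charSpeed ν ^ 2
    + 3 * beta1 ν * iteratedDeriv 2 charSpeed ν * charSpeed ν

def beta2 (ν : ℝ) : ℝ :=
  -(1 / 4) * (charSpeed ν ^ 3)⁻¹ * (Real.sqrt (deriv charSpeed ν))⁻¹ *
    ∫ τ in (0 : ℝ)..ν, ell1 τ * (Real.sqrt (deriv charSpeed τ))⁻¹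

def ell2 (ν : ℝ) : ℝ :=
  -(charSpeed ν ^ 2) *
    (iteratedDeriv 2 beta2 ν * charSpeed ν ^ 2
      + 6 * deriv beta2 ν * deriv charSpeed ν * charSpeed ν
      + 6 * beta2 ν * deriv charSpeed ν ^ 2
      + 3 * beta2 ν * iteratedDeriv 2 charSpeed ν * charSpeed ν)

/-! ### Compactly supported distributions on the line

A compactly supported distribution is given by its pairing with the smooth functions. -/

abbrev Functional := (ℝ → ℝ) → ℝ

/-- Distributional derivative `∂_s`. -/
def distDeriv (T : Functional) : Functional := fun ψ => -T (deriv ψ)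

/-- Convolution `(T * φ)(s) = ⟨T, φ(s - ·)⟩`. -/
def conv (T : Functional) (φ : ℝ → ℝ) (s : ℝ) : ℝ := T (fun t => φ (s - t))

/-- `G₀`, the indicator function of `[-κ, κ]`. -/
def G0 (κ : ℝ) : Functional := fun ψ => ∫ s in (-κ)..κ, ψ s

/-- `G₋₁ = (δ_κ + δ_{-κ}) / (2κ)`, whose Fourier transform is `cos(ξκ) / κ`. -/
def Gneg1 (κ : ℝ) : Functional := fun ψ => (ψ κ + ψ (-κ)) / (2 * κ)

/-- `G₋₂ = (δ_κ + δ_{-κ}) / (4κ³) + (δ_κ' - δ_{-κ}') / (4κ²)`, whose Fourier transform is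
`(ξκ sin(ξκ) + cos(ξκ)) / (2κ³)`. -/
def Gneg2 (κ : ℝ) : Functional := fun ψ =>
  (ψ κ + ψ (-κ)) / (4 * κ ^ 3) - (deriv ψ κ - deriv ψ (-κ)) / (4 * κ ^ 2)

/-! The Fourier transform of a compactly supported distribution `T` at `ξ` is
`⟨T, exp(-iξ·)⟩ = ⟨T, cos(ξ·)⟩ - i ⟨T, sin(ξ·)⟩`. -/

lemma Gneg1_cos (κ ξ : ℝ) :
    Gneg1 κ (fun s => Real.cos (ξ * s)) = Real.cos (ξ * κ) / κ := by
  simp only [Gneg1, mul_neg, Real.cos_neg]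
  ring

lemma Gneg1_sin (κ ξ : ℝ) : Gneg1 κ (fun s => Real.sin (ξ * s)) = 0 := by
  simp [Gneg1]

lemma Gneg2_cos (κ ξ : ℝ) (hκ : κ ≠ 0) :
    Gneg2 κ (fun s => Real.cos (ξ * s)) =
      1 / 2 * (κ ^ 3)⁻¹ * (ξ * κ * Real.sin (ξ * κ) + Real.cos (ξ * κ)) := by
  have h : deriv (fun s => Real.cos (ξ * s)) = fun s => -Real.sin (ξ * s) * ξ := by
    funext s
    have h1 : HasDerivAt (fun s : ℝ => ξ * s) ξ s := by
      simpa using (hasDerivAt_id s).const_mul ξ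
    exact h1.cos.deriv
  simp only [Gneg2, h, mul_neg, Real.cos_neg, Real.sin_neg]
  field_simp
  ring

lemma Gneg2_sin (κ ξ : ℝ) : Gneg2 κ (fun s => Real.sin (ξ * s)) = 0 := by
  have h : deriv (fun s => Real.sin (ξ * s)) = fun s => Real.cos (ξ * s) * ξ := by
    funext s
    have h1 : HasDerivAt (fun s : ℝ => ξ * s) ξ s := by
      simpa using (hasDerivAt_id s).const_mul ξ
    exact h1.sin.deriv
  simp [Gneg2, h]

/-! ### The remainder term -/

/-- `y = ĥ(·, ξ)` is of class `C²` on `[0, ν_cr)` and solves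
`y'' + k'² ξ² y = ℓ₂ f̂₀(ξ k)`, `y(0) = 0`, `y'(0) = 0`, where `f̂₀(z) = 2 sin z / z`. -/
structure IsRemainderTransform (ξ : ℝ) (y : ℝ → ℝ) : Prop where
  contDiffOn : ContDiffOn ℝ 2 y (Ico 0 nuCr)
  value_zero : y 0 = 0
  deriv_zero : HasDerivWithinAt y 0 (Ici 0) 0
  equation : ∀ ν ∈ Ioo 0 nuCr,
    iteratedDeriv 2 y ν + deriv charSpeed ν ^ 2 * ξ ^ 2 * y ν
      = ell2 ν * (2 * Real.sinc (ξ * charSpeed ν))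

open Classical in
/-- The solution `ĥ(·, ξ)` of the Cauchy problem (it exists and is unique on `[0, ν_cr)`,
which is part of what the theorem asserts). -/
def remainderTransform (ξ : ℝ) : ℝ → ℝ :=
  if hex : ∃ y, IsRemainderTransform ξ y then hex.choose else 0

/-- The remainder `h(ν, s) = (2π)⁻¹ ∫ ĥ(ν, ξ) exp(iξs) dξ`. As `ĥ` is real and even in `ξ`,
only the cosine contributes. -/
def remainder (ν s : ℝ) : ℝ :=
  (2 * Real.pi)⁻¹ * ∫ ξ, remainderTransform ξ ν * Real.cos (ξ * s)

/-! ### The singular kernel -/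

/-- The singular kernel `H = b₀ G₋₂ + b₁ G₋₁ + b₂ G₀ + h` with `b_j = β_j k³`,
for `0 < ν < ν_cr`. -/
def kernelInterior (ν : ℝ) : Functional := fun ψ =>
  beta0 ν * charSpeed ν ^ 3 * Gneg2 (charSpeed ν) ψ
    + beta1 ν * charSpeed ν ^ 3 * Gneg1 (charSpeed ν) ψ
    + beta2 ν * charSpeed ν ^ 3 * G0 (charSpeed ν) ψ
    + ∫ s, remainder ν s * ψ s

/-- `ϱ H_ν` for `0 < ν < ν_cr`. -/
def rhoKernelNuInterior (ν : ℝ) : Functional := fun ψ =>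
  rho ν * deriv (fun μ => kernelInterior μ ψ) ν

/-- Extension to `ν = 0` of a family of distributions by its (weak) trace. -/
def withTrace (T : ℝ → Functional) (ν : ℝ) : Functional := fun ψ =>
  if ν = 0 then limUnder (𝓝[>] (0 : ℝ)) (fun μ => T μ ψ) else T ν ψ

/-- The singular kernel on `[0, ν_cr)`. -/
def singKernel : ℝ → Functional := withTrace kernelInterior

/-- `ϱ H_ν` on `[0, ν_cr)`. -/
def rhoSingKernelNu : ℝ → Functional := withTrace rhoKernelNuInterior

/-- The two estimates at `(ν, s)`, with constant `C`, for `j = 0, 1, 2`: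
`|∂_s^j (ϱ H_ν + H_ss) * φ (s)| ≤ C ϱ` and
`|ϱ ∂_s^j H_ν * φ (s)| + |∂_s^j H_s * φ (s)| ≤ C`. -/
def KernelEstimates (φ : ℝ → ℝ) (C ν s : ℝ) : Prop :=
  ∀ j : ℕ, j ≤ 2 →
    |conv (distDeriv^[j]
        (fun ψ => rhoSingKernelNu ν ψ + distDeriv (distDeriv (singKernel ν)) ψ)) φ s|
      ≤ C * rho ν ∧
    |conv (distDeriv^[j] (rhoSingKernelNu ν)) φ s|
      + |conv (distDeriv^[j] (distDeriv (singKernel ν))) φ s| ≤ C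

end Cavitation

end

open Cavitation

/-! The point $\nu=0$ is singular: $\nu\sim\varrho^3/3$, so $\varrho(\nu)$ is not differentiable
there and $k'\sim\varrho^{-2}$ blows up. For $\gamma=3$, however, everything becomes regular in
$\sigma=\varrho^2$. Since $d\nu=\varrho^2(1-\varrho^2)^{-1}d\varrho$, differentiation and
integration in $\nu$ preserve the form (power of $\varrho$) × (smooth function of $\sigma<1/2$);
integration acts on the smooth factor through the averages `avg`. Hence $k/\varrho$, $\varrho^2k'$,
$\beta_0,\beta_1,\beta_2$ and $\ell_2$ are smooth functions of $\sigma$. For $\beta_2$ and $\ell_2$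
this needs a cancellation: $6k'^2+3k''k$ is of order $\varrho^{-2}$ instead of $\varrho^{-4}$
(`speedQuad_eq`).

The potential $k'^2\xi^2\sim\varrho^{-4}\xi^2$ is not integrable at $0$. The Cauchy problem for
$\hat h$ is therefore solved by a power series in $-\xi^2$, whose coefficients gain enough powers of
$\varrho$ at each double integration to absorb $\varrho^{-4}$. The sum is entire in the frequency
$z$. As $k$ is concave, the energy $|y'|^2+|z|^2k'^2|y|^2$ grows at most at the rate
$2|\mathrm{Im}\,z|\,k'$, up to the source (`energy_estimate`). This yields uniqueness, the bounds
$\hat h=O(\varrho e^{|\mathrm{Im} z|k}|z|^{-2})$ and $\hat h_\nu=O(e^{|\mathrm{Im} z|k}|z|^{-1})$,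
and, by moving the contour into the upper half plane, the support property $|s|\le k$
(`integral_remSol_mul_exp`). Paired with a test function, $h$ is $O(\varrho)$ and differentiable in
$\nu$ with bounded derivative (`remainder_pairing`).

The other three terms of the kernel are explicit in values of $\psi$ and its derivatives at $\pm k$
and in $\int_{-k}^k\psi$. In $\varrho H_\nu+H_{ss}$ every term without a factor $k=O(\varrho)$
multiplies $\psi(\pm k)$ or $\psi''(\pm k)$, with a coefficient that vanishes at $\sigma=0$
(`exists_cancellation`); this is what the choice of $\beta_1$ achieves. Hence the sum is
$O(\varrho)$. The trace of $H$ follows from $\beta_0(0)=2$, and that of $\varrho H_\nu$ from the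
$O(\varrho)$ estimate. -/

noncomputable section

namespace Cavitation

/-! ### Averages of smooth functions of `σ = ϱ²` -/

/-- The weighted average `∫₀¹ t^p F(t² σ) dt`. -/
def avg (p : ℕ) (F : ℝ → ℝ) (σ : ℝ) : ℝ := ∫ t in (0 : ℝ)..1, t ^ p * F (t ^ 2 * σ)

lemma sq_mul_lt_half {t σ : ℝ} (ht : t ∈ Icc (0 : ℝ) 1) (hσ : σ < 1 / 2) :
    t ^ 2 * σ < 1 / 2 := by
  have h1 : t ^ 2 ≤ 1 := by nlinarith [ht.1, ht.2]
  rcases le_total σ 0 with h | h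
  · nlinarith [sq_nonneg t]
  · nlinarith [sq_nonneg t]

lemma continuousOn_avg_integrand (p : ℕ) {F : ℝ → ℝ} (hF : ContinuousOn F (Iio (1 / 2)))
    {σ : ℝ} (hσ : σ < 1 / 2) :
    ContinuousOn (fun t : ℝ => t ^ p * F (t ^ 2 * σ)) (Icc 0 1) := by
  refine (by fun_prop : ContinuousOn (fun t : ℝ => t ^ p) (Icc 0 1)).mul ?_
  exact hF.comp (by fun_prop) (fun t ht => sq_mul_lt_half ht hσ)

lemma intervalIntegrable_avg_integrand (p : ℕ) {F : ℝ → ℝ} (hF : ContinuousOn F (Iio (1 / 2)))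
    {σ : ℝ} (hσ : σ < 1 / 2) :
    IntervalIntegrable (fun t : ℝ => t ^ p * F (t ^ 2 * σ)) volume 0 1 := by
  apply ContinuousOn.intervalIntegrable
  rw [uIcc_of_le zero_le_one]
  exact continuousOn_avg_integrand p hF hσ

lemma hasDerivAt_avg (p : ℕ) {F : ℝ → ℝ} (hF : ContDiffOn ℝ ∞ F (Iio (1 / 2)))
    {σ : ℝ} (hσ : σ < 1 / 2) :
    HasDerivAt (avg p F) (avg (p + 2) (deriv F) σ) σ := by
  obtain ⟨hd, hF'⟩ := (contDiffOn_infty_iff_deriv_of_isOpen isOpen_Iio).1 hF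
  -- The midpoint keeps $x$ away from the sonic value $1/2$. The compact interval below also
  -- contains $0$, because $t^2x$ runs from $0$ to $x$.
  set b := (σ + 1 / 2) / 2 with hb
  have hJ : Icc (min (σ - 1) 0) (max b 0) ⊆ Iio (1 / 2 : ℝ) := by
    intro x hx
    refine lt_of_le_of_lt hx.2 (max_lt ?_ (by norm_num))
    rw [hb]; linarith
  obtain ⟨C, hC⟩ := isCompact_Icc.exists_bound_of_continuousOn (hF'.continuousOn.mono hJ)
  have hs : Ioo (σ - 1) b ∈ 𝓝 σ := Ioo_mem_nhds (by linarith) (by rw [hb]; linarith)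
  have hmem : ∀ t ∈ Icc (0 : ℝ) 1, ∀ x ∈ Ioo (σ - 1) b,
      t ^ 2 * x ∈ Icc (min (σ - 1) 0) (max b 0) := by
    intro t ht x hx
    have h0 := sq_nonneg t
    have h1 : t ^ 2 ≤ 1 := by nlinarith [ht.1, ht.2]
    rcases le_total x 0 with h | h
    · exact ⟨(min_le_left _ _).trans (by nlinarith [hx.1]), le_trans (by nlinarith) (le_max_right _ _)⟩
    · exact ⟨(min_le_right _ _).trans (by positivity), le_trans (by nlinarith [hx.2]) (le_max_left _ _)⟩
  have hI : ∀ t ∈ uIoc (0 : ℝ) 1, t ∈ Icc (0 : ℝ) 1 := by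
    intro t ht
    rw [uIoc_of_le zero_le_one] at ht
    exact ⟨ht.1.le, ht.2⟩
  refine (intervalIntegral.hasDerivAt_integral_of_dominated_loc_of_deriv_le
    (F := fun x t => t ^ p * F (t ^ 2 * x)) (F' := fun x t => t ^ (p + 2) * deriv F (t ^ 2 * x))
    (bound := fun _ => C) hs ?_ (intervalIntegrable_avg_integrand p hF.continuousOn hσ) ?_ ?_
    (by simp) ?_).2
  · filter_upwards [Iio_mem_nhds hσ] with x hx
    exact (intervalIntegrable_avg_integrand p hF.continuousOn hx).def'.aestronglyMeasurable
  · exact (intervalIntegrable_avg_integrand (p + 2)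
      hF'.continuousOn hσ).def'.aestronglyMeasurable
  · refine Eventually.of_forall fun t ht x hx => ?_
    have := hC _ (hmem t (hI t ht) x hx)
    rw [norm_mul, norm_pow, Real.norm_of_nonneg (hI t ht).1]
    have hp : t ^ (p + 2) ≤ 1 := pow_le_one₀ (hI t ht).1 (hI t ht).2
    calc t ^ (p + 2) * ‖deriv F (t ^ 2 * x)‖ ≤ 1 * ‖deriv F (t ^ 2 * x)‖ := by gcongr
      _ ≤ C := by linarith
  · refine Eventually.of_forall fun t ht x hx => ?_
    have hx' : t ^ 2 * x ∈ Iio (1 / 2 : ℝ) := hJ (hmem t (hI t ht) x hx)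
    have h1 := ((hd _ hx').differentiableAt (isOpen_Iio.mem_nhds hx')).hasDerivAt
    have h2 : HasDerivAt (fun x : ℝ => t ^ 2 * x) (t ^ 2) x := by
      simpa using (hasDerivAt_id x).const_mul (t ^ 2)
    refine ((h1.comp x h2).const_mul (t ^ p)).congr_deriv ?_
    ring

/-- Each derivative is again an average, of `deriv F` with the weight raised by two, so the
induction runs over all `p` and `F` at once. -/
lemma contDiffOn_avg (p : ℕ) {F : ℝ → ℝ} (hF : ContDiffOn ℝ ∞ F (Iio (1 / 2))) :
    ContDiffOn ℝ ∞ (avg p F) (Iio (1 / 2)) := by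
  rw [contDiffOn_infty]
  intro n
  induction n generalizing p F with
  | zero =>
    rw [Nat.cast_zero, contDiffOn_zero]
    exact fun σ hσ => (hasDerivAt_avg p hF hσ).continuousAt.continuousWithinAt
  | succ n ih =>
    rw [Nat.cast_succ, contDiffOn_succ_iff_deriv_of_isOpen isOpen_Iio]
    refine ⟨fun σ hσ => (hasDerivAt_avg p hF hσ).differentiableAt.differentiableWithinAt,
      by simp, ?_⟩
    exact (ih (p + 2) ((contDiffOn_infty_iff_deriv_of_isOpen isOpen_Iio).1 hF).2).congr
      fun σ hσ => (hasDerivAt_avg p hF hσ).deriv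

/-- Integrate $\frac{d}{dt}\big(t^{p+1}F(t^2\sigma)\big)$ over $[0,1]$. In the variable
$\varrho=\sqrt\sigma$ the identity says that $\varrho^{p+1}\,\mathrm{avg}_pF(\varrho^2)$ is a
primitive of $\varrho^pF(\varrho^2)$. -/
lemma avg_identity (p : ℕ) {F : ℝ → ℝ} (hF : ContDiffOn ℝ ∞ F (Iio (1 / 2)))
    {σ : ℝ} (hσ : σ < 1 / 2) :
    ((p : ℝ) + 1) * avg p F σ + 2 * σ * deriv (avg p F) σ = F σ := by
  obtain ⟨hd, hF'⟩ := (contDiffOn_infty_iff_deriv_of_isOpen isOpen_Iio).1 hF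
  rw [(hasDerivAt_avg p hF hσ).deriv]
  have i1 := intervalIntegrable_avg_integrand p hF.continuousOn hσ
  have i2 := intervalIntegrable_avg_integrand (p + 2) hF'.continuousOn hσ
  have key : ∫ t in (0 : ℝ)..1, (((p : ℝ) + 1) * (t ^ p * F (t ^ 2 * σ)) +
      2 * σ * (t ^ (p + 2) * deriv F (t ^ 2 * σ))) =
      (1 : ℝ) ^ (p + 1) * F (1 ^ 2 * σ) - (0 : ℝ) ^ (p + 1) * F (0 ^ 2 * σ) := by
    refine intervalIntegral.integral_eq_sub_of_hasDerivAt
      (f := fun t : ℝ => t ^ (p + 1) * F (t ^ 2 * σ)) ?_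
      ((i1.const_mul _).add (i2.const_mul _))
    intro t ht
    rw [uIcc_of_le zero_le_one] at ht
    have hx' : t ^ 2 * σ ∈ Iio (1 / 2 : ℝ) := sq_mul_lt_half ht hσ
    have h1 := ((hd _ hx').differentiableAt (isOpen_Iio.mem_nhds hx')).hasDerivAt
    have h2 : HasDerivAt (fun t : ℝ => t ^ 2 * σ) (2 * t * σ) t := by
      simpa using (hasDerivAt_pow 2 t).mul_const σ
    refine ((hasDerivAt_pow (p + 1) t).mul (h1.comp t h2)).congr_deriv ?_
    simp only [Nat.add_sub_cancel, Nat.cast_add, Nat.cast_one, Function.comp]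
    ring
  rw [intervalIntegral.integral_add (i1.const_mul _) (i2.const_mul _),
    intervalIntegral.integral_const_mul, intervalIntegral.integral_const_mul] at key
  simpa [avg] using key

/-- The gain $1/(p+1)$ is the source of the factorial decay of the power series coefficients. -/
lemma abs_avg_le (p : ℕ) {F : ℝ → ℝ} {σ B : ℝ} (hσ0 : 0 ≤ σ)
    (hB : ∀ x ∈ Icc 0 σ, |F x| ≤ B) : |avg p F σ| ≤ B / (p + 1) := by
  have h : ‖avg p F σ‖ ≤ ∫ t in (0 : ℝ)..1, t ^ p * B := by
    refine intervalIntegral.norm_integral_le_of_norm_le zero_le_one ?_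
      (Continuous.intervalIntegrable (by fun_prop) _ _)
    refine Eventually.of_forall fun t ht => ?_
    have h1 : t ^ 2 ≤ 1 := by nlinarith [ht.1, ht.2]
    rw [norm_mul, norm_pow, Real.norm_of_nonneg ht.1.le]
    exact mul_le_mul_of_nonneg_left (hB _ ⟨by positivity, by nlinarith⟩) (pow_nonneg ht.1.le _)
  rw [intervalIntegral.integral_mul_const, integral_pow] at h
  rw [← Real.norm_eq_abs]
  refine h.trans (le_of_eq ?_)
  simp
  ring

lemma avg_at_zero (p : ℕ) (F : ℝ → ℝ) : avg p F 0 = F 0 / (p + 1) := by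
  simp only [avg, mul_zero]
  rw [intervalIntegral.integral_mul_const, integral_pow]
  simp
  ring

/-- Hadamard's lemma. -/
lemma eq_add_mul_avg_deriv {F : ℝ → ℝ} (hF : ContDiffOn ℝ ∞ F (Iio (1 / 2)))
    {σ : ℝ} (hσ : σ < 1 / 2) : F σ = F 0 + σ * (2 * avg 1 (deriv F) σ) := by
  obtain ⟨hd, hF'⟩ := (contDiffOn_infty_iff_deriv_of_isOpen isOpen_Iio).1 hF
  have i2 := intervalIntegrable_avg_integrand 1 hF'.continuousOn hσ
  have key : ∫ t in (0 : ℝ)..1, 2 * σ * (t ^ 1 * deriv F (t ^ 2 * σ)) =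
      F (1 ^ 2 * σ) - F (0 ^ 2 * σ) := by
    refine intervalIntegral.integral_eq_sub_of_hasDerivAt
      (f := fun t : ℝ => F (t ^ 2 * σ)) ?_ (i2.const_mul _)
    intro t ht
    rw [uIcc_of_le zero_le_one] at ht
    have hx' : t ^ 2 * σ ∈ Iio (1 / 2 : ℝ) := sq_mul_lt_half ht hσ
    have h1 := ((hd _ hx').differentiableAt (isOpen_Iio.mem_nhds hx')).hasDerivAt
    have h2 : HasDerivAt (fun t : ℝ => t ^ 2 * σ) (2 * t * σ) t := by
      simpa using (hasDerivAt_pow 2 t).mul_const σ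
    refine (h1.comp t h2).congr_deriv ?_
    ring
  rw [intervalIntegral.integral_const_mul] at key
  simp only [avg]
  simp at key ⊢
  linarith

/-! ### The density as a function of `ν` -/

lemma rhoCr_pos : 0 < rhoCr := Real.sqrt_pos.2 (by norm_num)

lemma sq_lt_half_of_mem {r : ℝ} (hr : r ∈ Ico 0 rhoCr) : r ^ 2 < 1 / 2 := by
  rw [← rhoCr_sq]
  exact pow_lt_pow_left₀ hr.2 hr.1 two_ne_zero

lemma sq_le_half_of_mem {r : ℝ} (hr : r ∈ Icc 0 rhoCr) : r ^ 2 ≤ 1 / 2 := by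
  rw [← rhoCr_sq]
  exact pow_le_pow_left₀ hr.1 hr.2 2

lemma continuousOn_nuOf_integrand :
    ContinuousOn (fun τ : ℝ => τ ^ 2 / (1 - τ ^ 2)) {τ | τ ^ 2 < 1} :=
  ContinuousOn.div (by fun_prop) (by fun_prop) fun τ hτ => by
    have : τ ^ 2 < 1 := hτ
    linarith

lemma intervalIntegrable_nuOf_integrand {a b : ℝ} (ha : a ∈ Icc 0 rhoCr) (hb : b ∈ Icc 0 rhoCr) :
    IntervalIntegrable (fun τ : ℝ => τ ^ 2 / (1 - τ ^ 2)) volume a b := by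
  apply ContinuousOn.intervalIntegrable
  refine continuousOn_nuOf_integrand.mono fun τ hτ => ?_
  have := sq_le_half_of_mem (ordConnected_Icc.uIcc_subset ha hb hτ)
  show τ ^ 2 < 1
  linarith

lemma hasDerivAt_nuOf {r : ℝ} (hr : r ∈ Icc 0 rhoCr) :
    HasDerivAt nuOf (r ^ 2 / (1 - r ^ 2)) r := by
  have h1 : r ^ 2 < 1 := by linarith [sq_le_half_of_mem hr]
  have hopen : IsOpen {τ : ℝ | τ ^ 2 < 1} := isOpen_lt (by fun_prop) continuous_const
  refine intervalIntegral.integral_hasDerivAt_right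
    (intervalIntegrable_nuOf_integrand ⟨le_rfl, rhoCr_nonneg⟩ hr) ?_ ?_
  · exact continuousOn_nuOf_integrand.stronglyMeasurableAtFilter hopen r h1
  · exact continuousOn_nuOf_integrand.continuousAt (hopen.mem_nhds h1)

lemma continuousOn_nuOf : ContinuousOn nuOf (Icc 0 rhoCr) :=
  fun _ hr => (hasDerivAt_nuOf hr).continuousAt.continuousWithinAt

lemma strictMonoOn_nuOf : StrictMonoOn nuOf (Icc 0 rhoCr) := by
  refine strictMonoOn_of_deriv_pos (convex_Icc _ _) continuousOn_nuOf fun r hr => ?_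
  rw [interior_Icc] at hr
  have hr' := Ioo_subset_Icc_self hr
  rw [(hasDerivAt_nuOf hr').deriv]
  have := sq_le_half_of_mem hr'
  have := hr.1
  apply div_pos (by positivity)
  linarith

lemma nuOf_zero : nuOf 0 = 0 := by simp [nuOf]

lemma nuCr_pos : 0 < nuCr := by
  rw [← nuOf_zero]
  exact strictMonoOn_nuOf ⟨le_rfl, rhoCr_nonneg⟩ ⟨rhoCr_nonneg, le_rfl⟩ rhoCr_pos

lemma strictMonoOn_rho : StrictMonoOn rho (Icc 0 nuCr) := by
  intro a ha b hb hab
  by_contra! h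
  have := strictMonoOn_nuOf.monotoneOn (rho_spec hb).1 (rho_spec ha).1 h
  rw [(rho_spec ha).2, (rho_spec hb).2] at this
  linarith

lemma nuOf_mem {r : ℝ} (hr : r ∈ Icc 0 rhoCr) : nuOf r ∈ Icc 0 nuCr := by
  constructor
  · rw [← nuOf_zero]
    exact strictMonoOn_nuOf.monotoneOn ⟨le_rfl, rhoCr_nonneg⟩ hr hr.1
  · exact strictMonoOn_nuOf.monotoneOn hr ⟨rhoCr_nonneg, le_rfl⟩ hr.2

lemma rho_nuOf {r : ℝ} (hr : r ∈ Icc 0 rhoCr) : rho (nuOf r) = r :=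
  strictMonoOn_nuOf.injOn (rho_spec (nuOf_mem hr)).1 hr (rho_spec (nuOf_mem hr)).2

lemma rho_zero : rho 0 = 0 := by
  conv_lhs => rw [← nuOf_zero]
  exact rho_nuOf ⟨le_rfl, rhoCr_nonneg⟩

lemma rho_nuCr : rho nuCr = rhoCr := rho_nuOf ⟨rhoCr_nonneg, le_rfl⟩

lemma rho_mem {ν : ℝ} (hν : ν ∈ Ico 0 nuCr) : rho ν ∈ Ico 0 rhoCr := by
  refine ⟨(rho_spec ⟨hν.1, hν.2.le⟩).1.1, ?_⟩
  rw [← rho_nuCr]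
  exact strictMonoOn_rho ⟨hν.1, hν.2.le⟩ ⟨nuCr_pos.le, le_rfl⟩ hν.2

lemma rho_nonneg {ν : ℝ} (hν : ν ∈ Ico 0 nuCr) : 0 ≤ rho ν := (rho_mem hν).1

lemma rho_pos {ν : ℝ} (hν : ν ∈ Ioo 0 nuCr) : 0 < rho ν := by
  rw [← rho_zero]
  exact strictMonoOn_rho ⟨le_rfl, nuCr_pos.le⟩ (Ioo_subset_Icc_self hν) hν.1

lemma rho_sq_lt {ν : ℝ} (hν : ν ∈ Ico 0 nuCr) : rho ν ^ 2 < 1 / 2 := sq_lt_half_of_mem (rho_mem hν)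

lemma rho_le_one {ν : ℝ} (hν : ν ∈ Ico 0 nuCr) : rho ν ≤ 1 := by
  nlinarith [rho_sq_lt hν, rho_nonneg hν]

lemma surjOn_rho : SurjOn rho (Icc 0 nuCr) (Icc 0 rhoCr) :=
  fun r hr => ⟨nuOf r, nuOf_mem hr, rho_nuOf hr⟩

lemma continuousAt_rho {ν : ℝ} (hν : ν ∈ Ioo 0 nuCr) : ContinuousAt rho ν := by
  refine strictMonoOn_rho.continuousAt_of_image_mem_nhds (Icc_mem_nhds hν.1 hν.2) ?_
  exact mem_of_superset (Icc_mem_nhds (rho_pos hν) (rho_mem (Ioo_subset_Ico_self hν)).2) surjOn_rho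

lemma continuousWithinAt_rho_zero : ContinuousWithinAt rho (Ici 0) 0 := by
  refine strictMonoOn_rho.continuousWithinAt_right_of_image_mem_nhdsWithin
    (Icc_mem_nhdsGE nuCr_pos) ?_
  rw [rho_zero]
  exact mem_of_superset (Icc_mem_nhdsGE rhoCr_pos) surjOn_rho

lemma continuousOn_rho : ContinuousOn rho (Ico 0 nuCr) := by
  intro ν hν
  rcases hν.1.eq_or_lt with h | h
  · subst h
    exact continuousWithinAt_rho_zero.mono Ico_subset_Ici_self
  · exact (continuousAt_rho ⟨h, hν.2⟩).continuousWithinAt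

lemma hasDerivAt_rho {ν : ℝ} (hν : ν ∈ Ioo 0 nuCr) :
    HasDerivAt rho ((1 - rho ν ^ 2) / rho ν ^ 2) ν := by
  have hν' := Ioo_subset_Icc_self hν
  have h1 := hasDerivAt_nuOf (rho_spec hν').1
  have hp := rho_pos hν
  have hq := rho_sq_lt (Ioo_subset_Ico_self hν)
  have h2 := h1.of_local_left_inverse (continuousAt_rho hν)
    (div_ne_zero (by positivity) (by linarith)) (by
      filter_upwards [Ioo_mem_nhds hν.1 hν.2] with x hx
      exact (rho_spec (Ioo_subset_Icc_self hx)).2)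
  rwa [inv_div] at h2

/-- Differentiation rule for functions of the form `ϱ^m F(ϱ²)`. -/
lemma hasDerivAt_rho_zpow_mul {ν : ℝ} (hν : ν ∈ Ioo 0 nuCr) (m : ℤ) {F : ℝ → ℝ} {F' : ℝ}
    (hF : HasDerivAt F F' (rho ν ^ 2)) :
    HasDerivAt (fun μ => rho μ ^ m * F (rho μ ^ 2))
      (rho ν ^ (m - 3) * ((1 - rho ν ^ 2) * (m * F (rho ν ^ 2) + 2 * rho ν ^ 2 * F'))) ν := by
  have hp := (rho_pos hν).ne'
  have h := hasDerivAt_rho hν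
  have h1 := (hasDerivAt_zpow m (rho ν) (Or.inl hp)).comp ν h
  have h2 : HasDerivAt (fun μ => F (rho μ ^ 2)) _ ν := hF.comp ν (h.pow 2)
  refine (h1.mul h2).congr_deriv ?_
  rw [zpow_sub₀ hp, zpow_sub₀ hp]
  simp only [Function.comp]
  field_simp
  norm_cast
  ring

lemma hasDerivAt_of_contDiffOn {F : ℝ → ℝ} (hF : ContDiffOn ℝ ∞ F (Iio (1 / 2)))
    {σ : ℝ} (hσ : σ < 1 / 2) : HasDerivAt F (deriv F σ) σ :=
  ((hF.differentiableOn (by simp)) σ hσ).differentiableAt (isOpen_Iio.mem_nhds hσ) |>.hasDerivAt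

lemma contDiffOn_deriv_of_contDiffOn {F : ℝ → ℝ} (hF : ContDiffOn ℝ ∞ F (Iio (1 / 2))) :
    ContDiffOn ℝ ∞ (deriv F) (Iio (1 / 2)) :=
  ((contDiffOn_infty_iff_deriv_of_isOpen isOpen_Iio).1 hF).2

lemma continuousOn_comp_rho_sq {F : ℝ → ℝ} (hF : ContinuousOn F (Iio (1 / 2))) :
    ContinuousOn (fun ν => F (rho ν ^ 2)) (Ico 0 nuCr) :=
  hF.comp (continuousOn_rho.pow 2) fun _ hν => rho_sq_lt hν

/-- The integrand is $\varrho'$, unbounded at $0$; it is integrable because it is nonnegative and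
its primitive $\varrho$ is continuous up to $0$. -/
lemma intervalIntegrable_rho_zpow {ν : ℝ} (hν : ν ∈ Ico 0 nuCr) :
    IntervalIntegrable (fun τ => (1 - rho τ ^ 2) / rho τ ^ 2) volume 0 ν := by
  refine (intervalIntegrable_iff_integrableOn_Ioc_of_le hν.1).2 ?_
  refine intervalIntegral.integrableOn_deriv_of_nonneg (g := rho)
    (continuousOn_rho.mono fun x hx => ⟨hx.1, hx.2.trans_lt hν.2⟩)
    (fun x hx => hasDerivAt_rho ⟨hx.1, hx.2.trans hν.2⟩) fun x hx => ?_
  have := rho_sq_lt ⟨hx.1.le, hx.2.trans hν.2⟩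
  exact div_nonneg (by linarith) (sq_nonneg _)

lemma hasDerivAt_rho_zpow_mul_avg {ν : ℝ} (hν : ν ∈ Ioo 0 nuCr) (p : ℕ) {F : ℝ → ℝ}
    (hF : ContDiffOn ℝ ∞ F (Iio (1 / 2))) :
    HasDerivAt (fun μ => rho μ ^ (p + 1) * avg p F (rho μ ^ 2))
      (rho ν ^ ((p : ℤ) - 2) * ((1 - rho ν ^ 2) * F (rho ν ^ 2))) ν := by
  have hσ := rho_sq_lt (Ioo_subset_Ico_self hν)
  have h := hasDerivAt_rho_zpow_mul hν (p + 1)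
    (hasDerivAt_of_contDiffOn (contDiffOn_avg p hF) hσ)
  have e := avg_identity p hF hσ
  push_cast at h
  rw [e, show (p : ℤ) + 1 - 3 = p - 2 by ring] at h
  exact_mod_cast h

/-- Integration rule for functions of the form `ϱ^(p-2) F(ϱ²)`. -/
lemma integral_rho_zpow_mul {ν : ℝ} (hν : ν ∈ Ico 0 nuCr) (p : ℕ) {F : ℝ → ℝ}
    (hF : ContDiffOn ℝ ∞ F (Iio (1 / 2))) :
    ∫ τ in (0 : ℝ)..ν, rho τ ^ ((p : ℤ) - 2) * ((1 - rho τ ^ 2) * F (rho τ ^ 2)) =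
      rho ν ^ (p + 1) * avg p F (rho ν ^ 2) := by
  have hsub : Icc 0 ν ⊆ Ico 0 nuCr := fun x hx => ⟨hx.1, hx.2.trans_lt hν.2⟩
  have hint : IntervalIntegrable
      (fun τ => rho τ ^ ((p : ℤ) - 2) * ((1 - rho τ ^ 2) * F (rho τ ^ 2))) volume 0 ν := by
    -- The integrand is $\varrho'$ times the continuous function $\varrho^pF(\varrho^2)$.
    have h1 := (intervalIntegrable_rho_zpow hν).mul_continuousOn
      (g := fun τ => rho τ ^ p * F (rho τ ^ 2)) (by
        rw [uIcc_of_le hν.1]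
        exact ((continuousOn_rho.pow p).mul (continuousOn_comp_rho_sq hF.continuousOn)).mono hsub)
    refine h1.congr fun τ hτ => ?_
    rw [uIoc_of_le hν.1] at hτ
    have hp := (rho_pos ⟨hτ.1, hτ.2.trans_lt hν.2⟩).ne'
    rw [zpow_sub₀ hp]
    simp only [zpow_natCast]
    norm_cast
    ring
  rw [intervalIntegral.integral_eq_sub_of_hasDerivAt_of_le hν.1 (f := fun μ =>
    rho μ ^ (p + 1) * avg p F (rho μ ^ 2)) _ _ hint]
  · simp [rho_zero]
  · exact ((continuousOn_rho.pow (p + 1)).mul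
      (continuousOn_comp_rho_sq (contDiffOn_avg p hF).continuousOn)).mono hsub
  · exact fun x hx => hasDerivAt_rho_zpow_mul_avg ⟨hx.1, hx.2.trans hν.2⟩ p hF

/-! ### The coefficients as smooth functions of `σ = ϱ²` -/

/-- `ϱ² k'` as a function of `σ`. -/
def sonic (σ : ℝ) : ℝ := Real.sqrt (1 - 2 * σ)

/-- `ϱ (k')^(1/2)` as a function of `σ`. -/
def sonicRoot (σ : ℝ) : ℝ := Real.sqrt (sonic σ)

/-- `k / ϱ` as a function of `σ`. -/
def speedRatio : ℝ → ℝ := avg 0 (fun σ => sonic σ / (1 - σ))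

/-- `ϱ b_ν` for `b = B(ϱ²)`. -/
def nuDeriv (B : ℝ → ℝ) (σ : ℝ) : ℝ := 2 * (1 - σ) * deriv B σ

/-- `ϱ⁴ b_νν` for `b = B(ϱ²)`. -/
def nuDeriv2 (B : ℝ → ℝ) (σ : ℝ) : ℝ :=
  (1 - σ) * (2 * σ * deriv (nuDeriv B) σ - nuDeriv B σ)

/-- `ϱ⁵ k_νν` as a function of `σ`. -/
def speedDeriv2 (σ : ℝ) : ℝ := (1 - σ) * (-2 * sonic σ + 2 * σ * deriv sonic σ)

/-- `ϱ⁴ (6 k'² + 3 k'' k)` as a function of `σ`. -/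
def speedQuad (σ : ℝ) : ℝ := 6 * sonic σ ^ 2 + 3 * speedDeriv2 σ * speedRatio σ

/-- `ϱ² (b'' k² + 6 b' k' k + 6 b k'² + 3 b k'' k)` for `b = B(ϱ²)`. -/
def transportOp (B : ℝ → ℝ) (σ : ℝ) : ℝ :=
  nuDeriv2 B σ * speedRatio σ ^ 2 + 6 * nuDeriv B σ * sonic σ * speedRatio σ
    + B σ * (2 * avg 1 (deriv speedQuad) σ)

def coeff0 (σ : ℝ) : ℝ := 2 / (speedRatio σ * sonicRoot σ)

/-- The integrand $\beta_0''k(k')^{-1/2}$ has order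
$\varrho^{-4}\cdot\varrho\cdot\varrho=\varrho^{-2}$, which selects $p=0$ in `integral_rho_zpow_mul`;
the division by $1-x$ undoes the weight $1-\varrho^2$ of that rule. -/
def coeff1 (σ : ℝ) : ℝ :=
  avg 0 (fun x => nuDeriv2 coeff0 x * speedRatio x / (sonicRoot x * (1 - x))) σ
    / (4 * speedRatio σ ^ 2 * sonicRoot σ)

/-- Here $\ell_1(k')^{-1/2}$ has order $\varrho^{-2}\cdot\varrho=\varrho^{-1}$, hence $p=1$. The
resulting $\varrho^2$ compensates the order $\varrho^{-2}$ of $k^{-3}(k')^{-1/2}$. -/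
def coeff2 (σ : ℝ) : ℝ :=
  -(avg 1 (fun x => transportOp coeff1 x / (sonicRoot x * (1 - x))) σ)
    / (4 * speedRatio σ ^ 3 * sonicRoot σ)

def source (σ : ℝ) : ℝ := -speedRatio σ ^ 2 * transportOp coeff2 σ

lemma sonic_pos {σ : ℝ} (hσ : σ < 1 / 2) : 0 < sonic σ := Real.sqrt_pos.2 (by linarith)

lemma sonic_sq {σ : ℝ} (hσ : σ < 1 / 2) : sonic σ ^ 2 = 1 - 2 * σ :=
  Real.sq_sqrt (by linarith)

lemma sonicRoot_pos {σ : ℝ} (hσ : σ < 1 / 2) : 0 < sonicRoot σ := Real.sqrt_pos.2 (sonic_pos hσ)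

lemma sonic_zero : sonic 0 = 1 := by simp [sonic]

lemma sonicRoot_zero : sonicRoot 0 = 1 := by simp [sonicRoot, sonic_zero]

lemma contDiffOn_sonic : ContDiffOn ℝ ∞ sonic (Iio (1 / 2)) := by
  refine ContDiffOn.sqrt (by fun_prop) fun σ hσ => ?_
  have : σ < 1 / 2 := hσ
  linarith

lemma contDiffOn_sonicRoot : ContDiffOn ℝ ∞ sonicRoot (Iio (1 / 2)) :=
  ContDiffOn.sqrt contDiffOn_sonic fun _ hσ => (sonic_pos hσ).ne'

lemma contDiffOn_div_one_sub {F : ℝ → ℝ} (hF : ContDiffOn ℝ ∞ F (Iio (1 / 2))) :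
    ContDiffOn ℝ ∞ (fun σ => F σ / (1 - σ)) (Iio (1 / 2)) :=
  hF.div (by fun_prop) fun σ hσ => by
    have : σ < 1 / 2 := hσ
    linarith

lemma contDiffOn_speedRatio : ContDiffOn ℝ ∞ speedRatio (Iio (1 / 2)) :=
  contDiffOn_avg 0 (contDiffOn_div_one_sub contDiffOn_sonic)

lemma speedRatio_pos {σ : ℝ} (hσ : σ < 1 / 2) : 0 < speedRatio σ := by
  refine intervalIntegral.intervalIntegral_pos_of_pos_on
    (intervalIntegrable_avg_integrand 0 (contDiffOn_div_one_sub contDiffOn_sonic).continuousOn hσ)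
    (fun t ht => ?_) zero_lt_one
  have h := sq_mul_lt_half (Ioo_subset_Icc_self ht) hσ
  simp only [pow_zero, one_mul]
  exact div_pos (sonic_pos h) (by linarith)

lemma speedRatio_zero : speedRatio 0 = 1 := by
  rw [speedRatio, avg_at_zero]
  simp [sonic_zero]

lemma contDiffOn_nuDeriv {B : ℝ → ℝ} (hB : ContDiffOn ℝ ∞ B (Iio (1 / 2))) :
    ContDiffOn ℝ ∞ (nuDeriv B) (Iio (1 / 2)) :=
  ContDiffOn.mul (by fun_prop) (contDiffOn_deriv_of_contDiffOn hB)

lemma contDiffOn_nuDeriv2 {B : ℝ → ℝ} (hB : ContDiffOn ℝ ∞ B (Iio (1 / 2))) :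
    ContDiffOn ℝ ∞ (nuDeriv2 B) (Iio (1 / 2)) :=
  ContDiffOn.mul (by fun_prop) ((ContDiffOn.mul (by fun_prop)
    (contDiffOn_deriv_of_contDiffOn (contDiffOn_nuDeriv hB))).sub (contDiffOn_nuDeriv hB))

lemma contDiffOn_speedDeriv2 : ContDiffOn ℝ ∞ speedDeriv2 (Iio (1 / 2)) :=
  ContDiffOn.mul (by fun_prop) ((contDiffOn_const.mul contDiffOn_sonic).add
    (ContDiffOn.mul (by fun_prop) (contDiffOn_deriv_of_contDiffOn contDiffOn_sonic)))

lemma contDiffOn_speedQuad : ContDiffOn ℝ ∞ speedQuad (Iio (1 / 2)) :=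
  (contDiffOn_const.mul (contDiffOn_sonic.pow 2)).add
    ((contDiffOn_const.mul contDiffOn_speedDeriv2).mul contDiffOn_speedRatio)

lemma contDiffOn_transportOp {B : ℝ → ℝ} (hB : ContDiffOn ℝ ∞ B (Iio (1 / 2))) :
    ContDiffOn ℝ ∞ (transportOp B) (Iio (1 / 2)) :=
  (((contDiffOn_nuDeriv2 hB).mul (contDiffOn_speedRatio.pow 2)).add
    (((contDiffOn_const.mul (contDiffOn_nuDeriv hB)).mul contDiffOn_sonic).mul
      contDiffOn_speedRatio)).add
    (hB.mul (contDiffOn_const.mul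
      (contDiffOn_avg 1 (contDiffOn_deriv_of_contDiffOn contDiffOn_speedQuad))))

lemma contDiffOn_coeff0 : ContDiffOn ℝ ∞ coeff0 (Iio (1 / 2)) :=
  contDiffOn_const.div (contDiffOn_speedRatio.mul contDiffOn_sonicRoot) fun _ hσ =>
    mul_ne_zero (speedRatio_pos hσ).ne' (sonicRoot_pos hσ).ne'

lemma contDiffOn_div_sonicRoot {F : ℝ → ℝ} (hF : ContDiffOn ℝ ∞ F (Iio (1 / 2))) :
    ContDiffOn ℝ ∞ (fun σ => F σ / (sonicRoot σ * (1 - σ))) (Iio (1 / 2)) :=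
  hF.div (contDiffOn_sonicRoot.mul (by fun_prop)) fun σ hσ => by
    have : σ < 1 / 2 := hσ
    exact mul_ne_zero (sonicRoot_pos hσ).ne' (by linarith)

lemma contDiffOn_coeff1 : ContDiffOn ℝ ∞ coeff1 (Iio (1 / 2)) :=
  (contDiffOn_avg 0 (contDiffOn_div_sonicRoot ((contDiffOn_nuDeriv2 contDiffOn_coeff0).mul
    contDiffOn_speedRatio))).div ((contDiffOn_const.mul (contDiffOn_speedRatio.pow 2)).mul
      contDiffOn_sonicRoot) fun _ hσ => by
    have := speedRatio_pos hσ
    have := sonicRoot_pos hσ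
    positivity

lemma contDiffOn_coeff2 : ContDiffOn ℝ ∞ coeff2 (Iio (1 / 2)) :=
  (contDiffOn_avg 1 (contDiffOn_div_sonicRoot (contDiffOn_transportOp contDiffOn_coeff1))).neg.div
    ((contDiffOn_const.mul (contDiffOn_speedRatio.pow 3)).mul
      contDiffOn_sonicRoot) fun _ hσ => by
    have := speedRatio_pos hσ
    have := sonicRoot_pos hσ
    positivity

lemma contDiffOn_source : ContDiffOn ℝ ∞ source (Iio (1 / 2)) :=
  (contDiffOn_speedRatio.pow 2).neg.mul (contDiffOn_transportOp contDiffOn_coeff2)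

/-- Near $\nu=0$ one has $k\sim\varrho$, $k'\sim\varrho^{-2}$, $k''\sim-2\varrho^{-5}$, so the
leading parts $6-6$ of $6k'^2+3k''k$ cancel. Hadamard's lemma then extracts a factor $\sigma$,
without which $\ell_1$ would be of order $\varrho^{-4}$. -/
lemma speedQuad_eq {σ : ℝ} (hσ : σ < 1 / 2) :
    speedQuad σ = σ * (2 * avg 1 (deriv speedQuad) σ) := by
  have h := eq_add_mul_avg_deriv contDiffOn_speedQuad hσ
  have h0 : speedQuad 0 = 0 := by
    simp [speedQuad, speedDeriv2, sonic_zero, speedRatio_zero]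
    norm_num
  linarith

/-! ### Characteristic speed -/

lemma charSpeed_eq {ν : ℝ} (hν : ν ∈ Ico 0 nuCr) :
    charSpeed ν = rho ν * speedRatio (rho ν ^ 2) := by
  have h1 : charSpeed ν = ∫ τ in (0 : ℝ)..rho ν, sonic (τ ^ 2) / (1 - τ ^ 2) := by
    -- The integrands agree only for $\tau>0$: at $\tau=0$ the conventions for division by zero give
    -- $0$ on the left, while the right side is $1$.
    refine intervalIntegral.integral_congr_ae (Eventually.of_forall fun τ hτ => ?_)
    rw [uIoc_of_le (rho_nonneg hν)] at hτ
    have hp := hτ.1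
    have hq := sq_lt_half_of_mem ⟨hp.le, hτ.2.trans_lt (rho_mem hν).2⟩
    have hs : Real.sqrt (machSq τ - 1) = sonic (τ ^ 2) / τ := by
      have : machSq τ - 1 = (1 - 2 * τ ^ 2) / τ ^ 2 := by
        unfold machSq
        field_simp
        ring
      rw [this, Real.sqrt_div' _ (sq_nonneg τ), Real.sqrt_sq hp.le, sonic]
    have : (1 : ℝ) - τ ^ 2 ≠ 0 := by linarith
    rw [hs]
    unfold machSq
    field_simp
  rw [h1, speedRatio, avg]
  -- The substitution $\tau=\varrho t$ turns the integral into $\varrho$ times an average with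
  -- $p=0$.
  have h2 := intervalIntegral.mul_integral_comp_mul_left (a := 0) (b := 1)
    (f := fun τ => sonic (τ ^ 2) / (1 - τ ^ 2)) (c := rho ν)
  rw [mul_zero, mul_one] at h2
  rw [← h2]
  simp only [pow_zero, one_mul, mul_pow, mul_comm]

lemma hasDerivAt_charSpeed {ν : ℝ} (hν : ν ∈ Ioo 0 nuCr) :
    HasDerivAt charSpeed (sonic (rho ν ^ 2) / rho ν ^ 2) ν := by
  have h := hasDerivAt_rho_zpow_mul_avg hν 0 (contDiffOn_div_one_sub contDiffOn_sonic)
  have hσ := rho_sq_lt (Ioo_subset_Ico_self hν)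
  have hp := (rho_pos hν).ne'
  have h1 : (1 : ℝ) - rho ν ^ 2 ≠ 0 := by linarith
  refine (h.congr_of_eventuallyEq ?_).congr_deriv ?_
  · filter_upwards [Ioo_mem_nhds hν.1 hν.2] with x hx
    rw [charSpeed_eq (Ioo_subset_Ico_self hx), zero_add, pow_one, speedRatio]
  · rw [Nat.cast_zero, zero_sub, zpow_neg]
    norm_cast
    field_simp

lemma deriv_charSpeed {ν : ℝ} (hν : ν ∈ Ioo 0 nuCr) :
    deriv charSpeed ν = sonic (rho ν ^ 2) / rho ν ^ 2 := (hasDerivAt_charSpeed hν).deriv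

lemma sqrt_deriv_charSpeed {ν : ℝ} (hν : ν ∈ Ioo 0 nuCr) :
    Real.sqrt (deriv charSpeed ν) = sonicRoot (rho ν ^ 2) / rho ν := by
  have hσ := rho_sq_lt (Ioo_subset_Ico_self hν)
  rw [deriv_charSpeed hν, Real.sqrt_div (sonic_pos hσ).le, Real.sqrt_sq (rho_pos hν).le, sonicRoot]

lemma hasDerivAt_deriv_charSpeed {ν : ℝ} (hν : ν ∈ Ioo 0 nuCr) :
    HasDerivAt (deriv charSpeed) (speedDeriv2 (rho ν ^ 2) / rho ν ^ 5) ν := by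
  have hσ := rho_sq_lt (Ioo_subset_Ico_self hν)
  have hp := (rho_pos hν).ne'
  have h := hasDerivAt_rho_zpow_mul hν (-2) (hasDerivAt_of_contDiffOn contDiffOn_sonic hσ)
  refine (h.congr_of_eventuallyEq ?_).congr_deriv ?_
  · filter_upwards [Ioo_mem_nhds hν.1 hν.2] with x hx
    rw [deriv_charSpeed hx, zpow_neg]
    norm_cast
    field_simp
  · rw [speedDeriv2, show (-2 : ℤ) - 3 = -5 by norm_num, zpow_neg]
    norm_cast
    push_cast
    field_simp

lemma iteratedDeriv_two_charSpeed {ν : ℝ} (hν : ν ∈ Ioo 0 nuCr) :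
    iteratedDeriv 2 charSpeed ν = speedDeriv2 (rho ν ^ 2) / rho ν ^ 5 := by
  rw [iteratedDeriv_succ, iteratedDeriv_one]
  exact (hasDerivAt_deriv_charSpeed hν).deriv

/-! ### Derivatives of functions of `ϱ²` -/

lemma hasDerivAt_of_eq_comp {b B : ℝ → ℝ} (hB : ContDiffOn ℝ ∞ B (Iio (1 / 2)))
    (hb : ∀ ν ∈ Ioo 0 nuCr, b ν = B (rho ν ^ 2)) {ν : ℝ} (hν : ν ∈ Ioo 0 nuCr) :
    HasDerivAt b (nuDeriv B (rho ν ^ 2) / rho ν) ν := by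
  have hσ := rho_sq_lt (Ioo_subset_Ico_self hν)
  have hp := (rho_pos hν).ne'
  have h := hasDerivAt_rho_zpow_mul hν 0 (hasDerivAt_of_contDiffOn hB hσ)
  refine (h.congr_of_eventuallyEq ?_).congr_deriv ?_
  · filter_upwards [Ioo_mem_nhds hν.1 hν.2] with x hx
    rw [hb x hx, zpow_zero, one_mul]
  · rw [nuDeriv, zero_sub, zpow_neg]
    norm_cast
    field_simp
    ring

lemma iteratedDeriv_two_of_eq_comp {b B : ℝ → ℝ} (hB : ContDiffOn ℝ ∞ B (Iio (1 / 2)))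
    (hb : ∀ ν ∈ Ioo 0 nuCr, b ν = B (rho ν ^ 2)) {ν : ℝ} (hν : ν ∈ Ioo 0 nuCr) :
    iteratedDeriv 2 b ν = nuDeriv2 B (rho ν ^ 2) / rho ν ^ 4 := by
  have hσ := rho_sq_lt (Ioo_subset_Ico_self hν)
  have hp := (rho_pos hν).ne'
  have h := hasDerivAt_rho_zpow_mul hν (-1)
    (hasDerivAt_of_contDiffOn (contDiffOn_nuDeriv hB) hσ)
  rw [iteratedDeriv_succ, iteratedDeriv_one]
  refine ((h.congr_of_eventuallyEq ?_).congr_deriv ?_).deriv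
  · filter_upwards [Ioo_mem_nhds hν.1 hν.2] with x hx
    rw [(hasDerivAt_of_eq_comp hB hb hx).deriv, zpow_neg_one]
    ring
  · rw [nuDeriv2, show (-1 : ℤ) - 3 = -4 by norm_num, zpow_neg]
    norm_cast
    push_cast
    field_simp
    ring

/-- All four terms are of order $\varrho^{-2}$, except that the two containing $b$ undifferentiated
reach this order only together, through `speedQuad_eq`. -/
lemma transport_eq {b B : ℝ → ℝ} (hB : ContDiffOn ℝ ∞ B (Iio (1 / 2)))
    (hb : ∀ ν ∈ Ioo 0 nuCr, b ν = B (rho ν ^ 2)) {ν : ℝ} (hν : ν ∈ Ioo 0 nuCr) :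
    iteratedDeriv 2 b ν * charSpeed ν ^ 2 + 6 * deriv b ν * deriv charSpeed ν * charSpeed ν
      + 6 * b ν * deriv charSpeed ν ^ 2 + 3 * b ν * iteratedDeriv 2 charSpeed ν * charSpeed ν
      = transportOp B (rho ν ^ 2) / rho ν ^ 2 := by
  have hσ := rho_sq_lt (Ioo_subset_Ico_self hν)
  have hp := (rho_pos hν).ne'
  rw [iteratedDeriv_two_of_eq_comp hB hb hν, (hasDerivAt_of_eq_comp hB hb hν).deriv, hb ν hν,
    charSpeed_eq (Ioo_subset_Ico_self hν), deriv_charSpeed hν, iteratedDeriv_two_charSpeed hν]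
  have hq := speedQuad_eq hσ
  rw [transportOp]
  generalize 2 * avg 1 (deriv speedQuad) (rho ν ^ 2) = E at hq ⊢
  rw [speedQuad] at hq
  field_simp
  linear_combination B (rho ν ^ 2) * hq

/-! ### Identification of the coefficients -/

lemma beta0_eq {ν : ℝ} (hν : ν ∈ Ioo 0 nuCr) : beta0 ν = coeff0 (rho ν ^ 2) := by
  have hσ := rho_sq_lt (Ioo_subset_Ico_self hν)
  have hp := (rho_pos hν).ne'
  have h1 := (speedRatio_pos hσ).ne'
  have h2 := (sonicRoot_pos hσ).ne'
  rw [beta0, coeff0, charSpeed_eq (Ioo_subset_Ico_self hν), sqrt_deriv_charSpeed hν]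
  field_simp

lemma beta1_eq {ν : ℝ} (hν : ν ∈ Ioo 0 nuCr) : beta1 ν = coeff1 (rho ν ^ 2) := by
  have hσ := rho_sq_lt (Ioo_subset_Ico_self hν)
  have hp := (rho_pos hν).ne'
  have h1 := (speedRatio_pos hσ).ne'
  have h2 := (sonicRoot_pos hσ).ne'
  have hint := integral_rho_zpow_mul (Ioo_subset_Ico_self hν) 0 (contDiffOn_div_sonicRoot
    ((contDiffOn_nuDeriv2 contDiffOn_coeff0).mul contDiffOn_speedRatio))
  have : ∫ τ in (0 : ℝ)..ν,
      iteratedDeriv 2 beta0 τ * charSpeed τ * (Real.sqrt (deriv charSpeed τ))⁻¹ = rho ν ^ (0 + 1) * avg 0 (fun x =>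
        nuDeriv2 coeff0 x * speedRatio x / (sonicRoot x * (1 - x))) (rho ν ^ 2) := by
    refine Eq.trans (intervalIntegral.integral_congr_ae (Eventually.of_forall fun τ hτ => ?_)) hint
    rw [uIoc_of_le hν.1.le] at hτ
    have hτ' : τ ∈ Ioo 0 nuCr := ⟨hτ.1, hτ.2.trans_lt hν.2⟩
    have hσ := rho_sq_lt (Ioo_subset_Ico_self hτ')
    have hp := (rho_pos hτ').ne'
    have h2 := (sonicRoot_pos hσ).ne'
    have h3 : (1 : ℝ) - rho τ ^ 2 ≠ 0 := by linarith
    rw [iteratedDeriv_two_of_eq_comp contDiffOn_coeff0 (fun _ h => beta0_eq h) hτ',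
      charSpeed_eq (Ioo_subset_Ico_self hτ'), sqrt_deriv_charSpeed hτ', Nat.cast_zero, zero_sub,
      zpow_neg]
    norm_cast
    field_simp
  rw [beta1, this, coeff1, charSpeed_eq (Ioo_subset_Ico_self hν), sqrt_deriv_charSpeed hν]
  generalize avg 0 _ (rho ν ^ 2) = A
  field_simp
  ring

lemma ell1_eq {ν : ℝ} (hν : ν ∈ Ioo 0 nuCr) :
    ell1 ν = transportOp coeff1 (rho ν ^ 2) / rho ν ^ 2 :=
  transport_eq contDiffOn_coeff1 (fun _ h => beta1_eq h) hν

lemma beta2_eq {ν : ℝ} (hν : ν ∈ Ioo 0 nuCr) : beta2 ν = coeff2 (rho ν ^ 2) := by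
  have hσ := rho_sq_lt (Ioo_subset_Ico_self hν)
  have hp := (rho_pos hν).ne'
  have h1 := (speedRatio_pos hσ).ne'
  have h2 := (sonicRoot_pos hσ).ne'
  have hint := integral_rho_zpow_mul (Ioo_subset_Ico_self hν) 1 (contDiffOn_div_sonicRoot
    (contDiffOn_transportOp contDiffOn_coeff1))
  have : ∫ τ in (0 : ℝ)..ν, ell1 τ * (Real.sqrt (deriv charSpeed τ))⁻¹ =
      rho ν ^ (1 + 1) * avg 1 (fun x =>
        transportOp coeff1 x / (sonicRoot x * (1 - x))) (rho ν ^ 2) := by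
    refine Eq.trans (intervalIntegral.integral_congr_ae (Eventually.of_forall fun τ hτ => ?_)) hint
    rw [uIoc_of_le hν.1.le] at hτ
    have hτ' : τ ∈ Ioo 0 nuCr := ⟨hτ.1, hτ.2.trans_lt hν.2⟩
    have hσ := rho_sq_lt (Ioo_subset_Ico_self hτ')
    have hp := (rho_pos hτ').ne'
    have h2 := (sonicRoot_pos hσ).ne'
    have h3 : (1 : ℝ) - rho τ ^ 2 ≠ 0 := by linarith
    rw [ell1_eq hτ', sqrt_deriv_charSpeed hτ', Nat.cast_one, show (1 : ℤ) - 2 = -1 by norm_num,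
      zpow_neg_one]
    field_simp
  rw [beta2, this, coeff2, charSpeed_eq (Ioo_subset_Ico_self hν), sqrt_deriv_charSpeed hν]
  generalize avg 1 _ (rho ν ^ 2) = A
  field_simp

lemma ell2_eq {ν : ℝ} (hν : ν ∈ Ioo 0 nuCr) : ell2 ν = source (rho ν ^ 2) := by
  have hp := (rho_pos hν).ne'
  rw [ell2, transport_eq contDiffOn_coeff2 (fun _ h => beta2_eq h) hν, source,
    charSpeed_eq (Ioo_subset_Ico_self hν)]
  field_simp

/-- At $\sigma=0$ the operator $\varrho^4\partial_\nu^2$ reduces to $-\varrho\partial_\nu$. This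
value makes the coefficient of $\psi$ cancel in $\varrho H_\nu+H_{ss}$ at $\nu=0$. -/
lemma coeff1_zero : coeff1 0 = -nuDeriv coeff0 0 / 4 := by
  rw [coeff1, avg_at_zero]
  simp [nuDeriv2, speedRatio_zero, sonicRoot_zero]

lemma coeff0_zero : coeff0 0 = 2 := by simp [coeff0, speedRatio_zero, sonicRoot_zero]

/-! ### Energy estimate -/

/-- Concavity of $k$ gives the term of the energy derivative that comes from $(k'^2)'$ the
favourable sign. -/
lemma speedDeriv2_nonpos {σ : ℝ} (h0 : 0 ≤ σ) (hσ : σ < 1 / 2) : speedDeriv2 σ ≤ 0 := by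
  have h1 : HasDerivAt (fun x : ℝ => 1 - 2 * x) (-2) σ := by
    simpa using ((hasDerivAt_id σ).const_mul 2).const_sub 1
  have h2 := h1.sqrt (by linarith)
  have h3 : deriv sonic σ = -2 / (2 * sonic σ) := h2.deriv
  have hs := sonic_pos hσ
  have h4 : 0 ≤ 2 * σ * (2 / (2 * sonic σ)) := by positivity
  rw [speedDeriv2, h3]
  refine mul_nonpos_of_nonneg_of_nonpos (by linarith) ?_
  rw [neg_div, mul_neg]
  linarith

/-- The derivative of $\varrho^3-\nu$ is $3(1-\varrho^2)-1$, positive because $\varrho^2<1/2$. -/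
lemma nu_le_rho_cube {ν : ℝ} (hν : ν ∈ Ico 0 nuCr) : ν ≤ rho ν ^ 3 := by
  have hsub : Icc 0 ν ⊆ Ico 0 nuCr := fun x hx => ⟨hx.1, hx.2.trans_lt hν.2⟩
  have hmono : MonotoneOn (fun μ => rho μ ^ 3 - μ) (Icc 0 ν) := by
    refine monotoneOn_of_hasDerivWithinAt_nonneg (f' := fun μ => 3 * (1 - rho μ ^ 2) - 1)
      (convex_Icc _ _) (((continuousOn_rho.pow 3).sub continuousOn_id).mono hsub) ?_ ?_
    · intro μ hμ
      rw [interior_Icc] at hμ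
      have hμ' : μ ∈ Ioo 0 nuCr := ⟨hμ.1, hμ.2.trans hν.2⟩
      have hp := (rho_pos hμ').ne'
      refine ((((hasDerivAt_rho hμ').pow 3).sub (hasDerivAt_id μ)).congr_deriv ?_).hasDerivWithinAt
      field_simp
      norm_num
      ring
    · intro μ hμ
      rw [interior_Icc] at hμ
      have := rho_sq_lt (hsub (Ioo_subset_Icc_self hμ))
      linarith
  have := hmono ⟨le_rfl, hν.1⟩ ⟨hν.1, le_rfl⟩ hν.1
  simp only [rho_zero] at this
  linarith

lemma sonic_le_one {σ : ℝ} (h0 : 0 ≤ σ) : sonic σ ≤ 1 := by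
  exact Real.sqrt_le_iff.2 ⟨zero_le_one, by linarith⟩

lemma tendsto_rho_zero : Tendsto rho (𝓝[>] 0) (𝓝 0) := by
  have := continuousWithinAt_rho_zero.mono Ioi_subset_Ici_self
  rwa [ContinuousWithinAt, rho_zero] at this

/-- The energy contains $k'|y|$ with $k'\sim\varrho^{-2}$, so $y\to0$ alone does not make it vanish
at $\nu=0$. Since $y'\to0$ too, eventually $|y|\le\nu\le\varrho^3$, and $k'|y|\le\varrho$. -/
lemma tendsto_speed_mul_norm {y y₁ : ℝ → ℂ}
    (hy : ∀ ν ∈ Ioo 0 nuCr, HasDerivAt y (y₁ ν) ν)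
    (h0 : Tendsto y (𝓝[>] 0) (𝓝 0)) (h1 : Tendsto y₁ (𝓝[>] 0) (𝓝 0)) :
    Tendsto (fun ν => sonic (rho ν ^ 2) / rho ν ^ 2 * ‖y ν‖) (𝓝[>] 0) (𝓝 0) := by
  have hev : ∀ᶠ ν in 𝓝[>] (0 : ℝ), ‖y₁ ν‖ ≤ 1 := by
    have := h1.norm
    rw [norm_zero] at this
    exact this.eventually (Iic_mem_nhds zero_lt_one)
  obtain ⟨δ, hδ, hsub⟩ := mem_nhdsGT_iff_exists_Ioo_subset.1 hev
  have hδ' : (0 : ℝ) < δ := hδ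
  have hle : ∀ ν ∈ Ioo 0 (min δ nuCr), ‖y ν‖ ≤ ν := by
    intro ν hν
    have hν1 : ν < δ := hν.2.trans_le (min_le_left _ _)
    have hν2 : ν < nuCr := hν.2.trans_le (min_le_right _ _)
    have hb : ∀ μ ∈ Ioo 0 ν, ‖y ν - y μ‖ ≤ ν := by
      intro μ hμ
      have := Convex.norm_image_sub_le_of_norm_hasDerivWithin_le (C := 1) (f := y) (f' := y₁)
        (s := Icc μ ν)
        (fun x hx => (hy x ⟨hμ.1.trans_le hx.1, hx.2.trans_lt hν2⟩).hasDerivWithinAt)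
        (fun x hx => hsub ⟨hμ.1.trans_le hx.1, hx.2.trans_lt hν1⟩) (convex_Icc _ _)
        ⟨le_rfl, hμ.2.le⟩ ⟨hμ.2.le, le_rfl⟩
      rw [one_mul, Real.norm_of_nonneg (by linarith [hμ.2])] at this
      linarith [hμ.1]
    have hlim : Tendsto (fun μ => ‖y ν - y μ‖) (𝓝[>] 0) (𝓝 ‖y ν - 0‖) :=
      (tendsto_const_nhds.sub h0).norm
    rw [sub_zero] at hlim
    refine le_of_tendsto hlim ?_
    filter_upwards [Ioo_mem_nhdsGT hν.1] with μ hμ using hb μ hμ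
  refine squeeze_zero' ?_ ?_ tendsto_rho_zero
  · filter_upwards with ν
    exact mul_nonneg (div_nonneg (Real.sqrt_nonneg _) (sq_nonneg _)) (norm_nonneg _)
  · filter_upwards [Ioo_mem_nhdsGT (lt_min hδ' nuCr_pos)] with ν hν
    have hν2 : ν < nuCr := hν.2.trans_le (min_le_right _ _)
    have hp := rho_pos ⟨hν.1, hν2⟩
    have h3 := (hle ν hν).trans (nu_le_rho_cube ⟨hν.1.le, hν2⟩)
    calc sonic (rho ν ^ 2) / rho ν ^ 2 * ‖y ν‖ ≤ 1 / rho ν ^ 2 * rho ν ^ 3 := by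
          gcongr
          exact sonic_le_one (sq_nonneg _)
      _ = rho ν := by field_simp

/-- Factor $|z|^2-z^2=z(\bar z-z)$. It measures how far the energy is from being conserved at a
non-real frequency. -/
lemma norm_normSq_sub_sq (z : ℂ) :
    ‖((‖z‖ ^ 2 : ℝ) : ℂ) - z ^ 2‖ = 2 * |z.im| * ‖z‖ := by
  have h : ((‖z‖ ^ 2 : ℝ) : ℂ) - z ^ 2 = z * ((starRingEnd ℂ) z - z) := by
    rw [mul_sub, Complex.mul_conj, Complex.normSq_eq_norm_sq]
    ring
  have h2 : (starRingEnd ℂ) z - z = ((-2 * z.im : ℝ) : ℂ) * Complex.I := by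
    apply Complex.ext <;> simp
    ring
  rw [h, norm_mul, h2, norm_mul, Complex.norm_I, Complex.norm_real, Real.norm_eq_abs, abs_mul]
  norm_num
  ring

/-- The left side is the derivative of $|Y_1|^2+|z|^2c^2|Y|^2$. For real $z$ the two mixed terms
cancel; in general they leave $(|z|^2-z^2)c^2\langle Y_1,Y\rangle$, of size at most
$2a|z|c^2|Y||Y_1|$. The inequality $2|Y_1|\,|z|c|Y|\le|Y_1|^2+|z|^2c^2|Y|^2$ absorbs this into the
energy, and the term with $c'\le0$ is dropped. -/
lemma energy_deriv_bound {z Y Y₁ f : ℂ} {c c' a : ℝ} (ha : a = |z.im|) (hc : 0 ≤ c) (hc' : c' ≤ 0) :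
    2 * inner ℝ Y₁ (f - (c : ℂ) ^ 2 * z ^ 2 * Y)
      + ‖z‖ ^ 2 * (2 * c * c' * ‖Y‖ ^ 2 + c ^ 2 * (2 * inner ℝ Y Y₁))
      ≤ 2 * a * c * (‖Y₁‖ ^ 2 + ‖z‖ ^ 2 * c ^ 2 * ‖Y‖ ^ 2) + 2 * ‖Y₁‖ * ‖f‖ := by
  have h1 : inner ℝ Y₁ (f - (c : ℂ) ^ 2 * z ^ 2 * Y) + ‖z‖ ^ 2 * c ^ 2 * inner ℝ Y Y₁
      = inner ℝ Y₁ f + inner ℝ Y₁ ((c ^ 2 : ℝ) • ((((‖z‖ ^ 2 : ℝ) : ℂ) - z ^ 2) * Y)) := by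
    rw [real_inner_comm Y₁ Y, ← inner_add_right]
    have : ‖z‖ ^ 2 * c ^ 2 * inner ℝ Y₁ Y = inner ℝ Y₁ ((‖z‖ ^ 2 * c ^ 2 : ℝ) • Y) := by
      rw [inner_smul_right]
    rw [this, ← inner_add_right]
    congr 1
    simp only [Complex.real_smul]
    push_cast
    ring
  have h2 : inner ℝ Y₁ f ≤ ‖Y₁‖ * ‖f‖ := real_inner_le_norm _ _
  have h3 : inner ℝ Y₁ ((c ^ 2 : ℝ) • ((((‖z‖ ^ 2 : ℝ) : ℂ) - z ^ 2) * Y))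
      ≤ ‖Y₁‖ * (c ^ 2 * (2 * a * ‖z‖ * ‖Y‖)) := by
    refine (real_inner_le_norm _ _).trans ?_
    rw [norm_smul, norm_mul, norm_normSq_sub_sq, Real.norm_of_nonneg (sq_nonneg c), ha]
  have ha0 : 0 ≤ a := ha ▸ abs_nonneg _
  have h4 : 0 ≤ a * c * (‖Y₁‖ - ‖z‖ * c * ‖Y‖) ^ 2 := by positivity
  have h5 : ‖z‖ ^ 2 * (c * c' * ‖Y‖ ^ 2) ≤ 0 := by
    have : c * c' ≤ 0 := mul_nonpos_of_nonneg_of_nonpos hc hc'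
    have h6 := mul_nonneg (sq_nonneg ‖z‖) (sq_nonneg ‖Y‖)
    nlinarith
  nlinarith

/-- With $c=k'$ and $a=|\mathrm{Im}\,z|$, the factor $e^{-2ak}$ removes the growth of the energy,
and $\Phi=e^{-2ak}\cdot$energy satisfies $\Phi'\le2\sqrt\Phi\,g'$. Formally $(\sqrt\Phi)'\le g'$,
and both $\Phi$ and $g$ tend to $0$ at $\nu=0$. -/
theorem energy_estimate {z : ℂ} {νs : ℝ} (hνs : νs ≤ nuCr) {y y₁ f : ℝ → ℂ} {g g' : ℝ → ℝ}
    (hy : ∀ ν ∈ Ioo 0 nuCr, HasDerivAt y (y₁ ν) ν)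
    (hy₁ : ∀ ν ∈ Ioo 0 nuCr, HasDerivAt y₁
      (f ν - ((sonic (rho ν ^ 2) / rho ν ^ 2 : ℝ) : ℂ) ^ 2 * z ^ 2 * y ν) ν)
    (h0 : Tendsto y (𝓝[>] 0) (𝓝 0)) (h1 : Tendsto y₁ (𝓝[>] 0) (𝓝 0))
    (hg : ∀ ν ∈ Ioo 0 nuCr, HasDerivAt g (g' ν) ν) (hg0 : Tendsto g (𝓝[>] 0) (𝓝 0))
    (hf : ∀ ν ∈ Ioo 0 νs, ‖f ν‖ ≤ Real.exp (|z.im| * charSpeed ν) * g' ν) :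
    ∀ ν ∈ Ioo 0 νs, ‖y₁ ν‖ ≤ Real.exp (|z.im| * charSpeed ν) * g ν ∧
      ‖z‖ * (sonic (rho ν ^ 2) / rho ν ^ 2) * ‖y ν‖ ≤ Real.exp (|z.im| * charSpeed ν) * g ν := by
  obtain ⟨a, ha⟩ : ∃ a, a = |z.im| := ⟨_, rfl⟩
  rw [← ha] at hf ⊢
  set c : ℝ → ℝ := fun ν => sonic (rho ν ^ 2) / rho ν ^ 2 with hcdef
  set En : ℝ → ℝ := fun ν => ‖y₁ ν‖ ^ 2 + ‖z‖ ^ 2 * (c ν ^ 2 * ‖y ν‖ ^ 2) with hEn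
  set Φ : ℝ → ℝ := fun ν => Real.exp (-2 * a * charSpeed ν) * En ν with hΦ
  have hEn0 : ∀ ν, 0 ≤ En ν := fun ν => by positivity
  have hΦ0 : ∀ ν, 0 ≤ Φ ν := fun ν => mul_nonneg (Real.exp_pos _).le (hEn0 ν)
  have hcpos : ∀ ν ∈ Ioo 0 nuCr, 0 ≤ c ν := fun ν hν =>
    div_nonneg (Real.sqrt_nonneg _) (sq_nonneg _)
  have hcd : ∀ ν ∈ Ioo 0 nuCr, HasDerivAt c (speedDeriv2 (rho ν ^ 2) / rho ν ^ 5) ν := by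
    intro ν hν
    refine (hasDerivAt_deriv_charSpeed hν).congr_of_eventuallyEq ?_
    filter_upwards [Ioo_mem_nhds hν.1 hν.2] with x hx using (deriv_charSpeed hx).symm
  have hsq : ∀ ν ∈ Ioo 0 νs, Real.exp (-a * charSpeed ν) * ‖y₁ ν‖ ≤ Real.sqrt (Φ ν) ∧
      Real.exp (-a * charSpeed ν) * (‖z‖ * c ν * ‖y ν‖) ≤ Real.sqrt (Φ ν) := by
    intro ν hν
    have he : Real.exp (-2 * a * charSpeed ν) = Real.exp (-a * charSpeed ν) ^ 2 := by
      rw [← Real.exp_nat_mul]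
      congr 1
      push_cast
      ring
    constructor <;> apply Real.le_sqrt_of_sq_le <;> simp only [hΦ, hEn] <;> rw [he, mul_pow] <;>
      apply mul_le_mul_of_nonneg_left _ (sq_nonneg _)
    · have : 0 ≤ ‖z‖ ^ 2 * (c ν ^ 2 * ‖y ν‖ ^ 2) := by positivity
      linarith
    · have : 0 ≤ ‖y₁ ν‖ ^ 2 := by positivity
      nlinarith
  have hΦd : ∀ ν ∈ Ioo 0 νs, ∃ d, HasDerivAt Φ d ν ∧ d ≤ 2 * Real.sqrt (Φ ν) * g' ν := by
    intro ν hν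
    have hν' : ν ∈ Ioo 0 nuCr := ⟨hν.1, hν.2.trans_le hνs⟩
    have d1 := (hy₁ ν hν').norm_sq
    have d2 := (hy ν hν').norm_sq
    have d3 := (((hcd ν hν').pow 2).mul d2).const_mul (‖z‖ ^ 2)
    have d4 := ((hasDerivAt_charSpeed hν').const_mul (-2 * a)).exp
    have d5 := d4.mul (d1.add d3)
    refine ⟨_, d5, ?_⟩
    have hk2 : speedDeriv2 (rho ν ^ 2) / rho ν ^ 5 ≤ 0 :=
      div_nonpos_of_nonpos_of_nonneg
        (speedDeriv2_nonpos (sq_nonneg _) (rho_sq_lt (Ioo_subset_Ico_self hν')))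
        (pow_nonneg (rho_pos hν').le _)
    have hb := energy_deriv_bound (Y := y ν) (Y₁ := y₁ ν) (f := f ν) ha (hcpos ν hν') hk2
    have he : Real.exp (-2 * a * charSpeed ν) * Real.exp (a * charSpeed ν) =
        Real.exp (-a * charSpeed ν) := by
      rw [← Real.exp_add]
      congr 1
      ring
    have hg'0 : 0 ≤ g' ν := by
      have := (norm_nonneg _).trans (hf ν hν)
      exact nonneg_of_mul_nonneg_right this (Real.exp_pos _)
    have hX := Real.exp_pos (-2 * a * charSpeed ν)
    calc _ ≤ Real.exp (-2 * a * charSpeed ν) * (2 * ‖y₁ ν‖ * ‖f ν‖) := by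
          simp only [Pi.add_apply, Pi.mul_apply, Pi.pow_apply]
          have := mul_le_mul_of_nonneg_left hb hX.le
          simp only [hcdef] at this ⊢
          norm_num at this ⊢
          linarith
      _ ≤ Real.exp (-2 * a * charSpeed ν) *
          (2 * ‖y₁ ν‖ * (Real.exp (a * charSpeed ν) * g' ν)) := by
          gcongr
          exact hf ν hν
      _ = 2 * (Real.exp (-a * charSpeed ν) * ‖y₁ ν‖) * g' ν := by
          rw [← he]
          ring
      _ ≤ 2 * Real.sqrt (Φ ν) * g' ν := by
          gcongr
          exact (hsq ν hν).1
  have hΦlim : Tendsto Φ (𝓝[>] 0) (𝓝 0) := by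
    have t1 : Tendsto (fun ν => ‖y₁ ν‖ ^ 2) (𝓝[>] 0) (𝓝 0) := by
      simpa using h1.norm.pow 2
    have t2 : Tendsto (fun ν => ‖z‖ ^ 2 * (c ν ^ 2 * ‖y ν‖ ^ 2)) (𝓝[>] 0) (𝓝 0) := by
      have := ((tendsto_speed_mul_norm hy h0 h1).pow 2).const_mul (‖z‖ ^ 2)
      simpa [mul_pow, hcdef] using this
    have t3 : Tendsto En (𝓝[>] 0) (𝓝 0) := by simpa using t1.add t2
    refine squeeze_zero' (Eventually.of_forall hΦ0) ?_ t3
    filter_upwards [Ioo_mem_nhdsGT nuCr_pos] with ν hν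
    have hk : 0 ≤ charSpeed ν := by
      rw [charSpeed_eq (Ioo_subset_Ico_self hν)]
      exact mul_nonneg (rho_pos hν).le (speedRatio_pos (rho_sq_lt (Ioo_subset_Ico_self hν))).le
    have ha0 : 0 ≤ a := ha ▸ abs_nonneg _
    have : Real.exp (-2 * a * charSpeed ν) ≤ 1 := by
      rw [Real.exp_le_one_iff]
      nlinarith [mul_nonneg ha0 hk]
    calc Φ ν ≤ 1 * En ν := mul_le_mul_of_nonneg_right this (hEn0 ν)
      _ = En ν := one_mul _
  have hmain : ∀ ν ∈ Ioo 0 νs, Real.sqrt (Φ ν) ≤ g ν := by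
    intro ν hν
    -- The square root need not be differentiable where $\Phi=0$. For $\varepsilon>0$ the function
    -- $\sqrt{\Phi+\varepsilon^2}-g$ is nonincreasing and tends to $\varepsilon$ at $0$.
    refine le_of_forall_pos_le_add fun ε hε => ?_
    have hpos : ∀ x, 0 < Φ x + ε ^ 2 := fun x => by have := hΦ0 x; positivity
    have hd : ∀ x ∈ Ioo 0 νs, ∃ d, HasDerivAt (fun x => Real.sqrt (Φ x + ε ^ 2) - g x) d x ∧
        d ≤ 0 := by
      intro x hx
      obtain ⟨d, hd, hle⟩ := hΦd x hx
      refine ⟨_, ((hd.add_const (ε ^ 2)).sqrt (hpos x).ne').sub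
        (hg x ⟨hx.1, hx.2.trans_le hνs⟩), ?_⟩
      have hg'0 : 0 ≤ g' x := by
        have := (norm_nonneg _).trans (hf x hx)
        exact nonneg_of_mul_nonneg_right this (Real.exp_pos _)
      have hs : Real.sqrt (Φ x) ≤ Real.sqrt (Φ x + ε ^ 2) :=
        Real.sqrt_le_sqrt (by nlinarith)
      have hs0 : 0 < Real.sqrt (Φ x + ε ^ 2) := Real.sqrt_pos.2 (hpos x)
      rw [sub_nonpos, div_le_iff₀ (by positivity)]
      nlinarith [mul_le_mul_of_nonneg_right hs hg'0]
    have hanti : AntitoneOn (fun x => Real.sqrt (Φ x + ε ^ 2) - g x) (Ioo 0 νs) := by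
      refine antitoneOn_of_deriv_nonpos (convex_Ioo _ _) ?_ ?_ ?_
      · intro x hx
        obtain ⟨d, hd, -⟩ := hd x hx
        exact hd.continuousAt.continuousWithinAt
      · intro x hx
        obtain ⟨d, hd, -⟩ := hd x (interior_subset hx)
        exact hd.differentiableAt.differentiableWithinAt
      · intro x hx
        obtain ⟨d, hd, hle⟩ := hd x (interior_subset hx)
        rwa [hd.deriv]
    have hlim : Tendsto (fun x => Real.sqrt (Φ x + ε ^ 2) - g x) (𝓝[>] 0) (𝓝 ε) := by
      have := ((hΦlim.add_const (ε ^ 2)).sqrt).sub hg0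
      simpa [Real.sqrt_sq hε.le] using this
    have hfin : Real.sqrt (Φ ν + ε ^ 2) - g ν ≤ ε := by
      refine ge_of_tendsto hlim ?_
      filter_upwards [Ioo_mem_nhdsGT hν.1] with μ hμ
      exact hanti ⟨hμ.1, hμ.2.trans hν.2⟩ hν hμ.2.le
    have hs : Real.sqrt (Φ ν) ≤ Real.sqrt (Φ ν + ε ^ 2) := Real.sqrt_le_sqrt (by nlinarith)
    linarith
  intro ν hν
  have he : Real.exp (a * charSpeed ν) * Real.exp (-a * charSpeed ν) = 1 := by
    rw [← Real.exp_add]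
    simp
  have hX := (Real.exp_pos (a * charSpeed ν)).le
  obtain ⟨q1, q2⟩ := hsq ν hν
  have h3 := mul_le_mul_of_nonneg_left (q1.trans (hmain ν hν)) hX
  have h4 := mul_le_mul_of_nonneg_left (q2.trans (hmain ν hν)) hX
  rw [← mul_assoc, he, one_mul] at h3 h4
  exact ⟨h3, h4⟩

/-! ### Power series for the remainder transform -/

/-- One integration in $\nu$ raises the power of $\varrho$ by three: starting from $\varrho^{2m}F$,
the two steps give $\varrho^{2m+3}$ and $\varrho^{2m+6}$. Multiplication by $k'^2\sim\varrho^{-4}$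
then leaves $\varrho^{2(m+1)}$, so the recursion closes with smooth factors. -/
def seriesStep1 (m : ℕ) (F : ℝ → ℝ) : ℝ → ℝ := avg (2 * m + 2) (fun σ => F σ / (1 - σ))

def seriesStep2 (m : ℕ) (F : ℝ → ℝ) : ℝ → ℝ :=
  avg (2 * m + 5) (fun σ => seriesStep1 m F σ / (1 - σ))

/-- The `m`-th coefficient of `ĥ_νν` is `ϱ^(2m)` times this function of `σ`. -/
def seriesSource : ℕ → ℝ → ℝ
  | 0 => fun σ => 2 * source σ
  | m + 1 => fun σ => sonic σ ^ 2 * seriesStep2 m (seriesSource m) σ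
      + 2 * source σ * speedRatio σ ^ (2 * (m + 1)) / (2 * (m + 1) + 1).factorial

/-- Coefficients of `ĥ`, `ĥ_ν`, `ĥ_νν`. -/
def seriesCoeff (m : ℕ) (ν : ℝ) : ℝ :=
  rho ν ^ (2 * m + 6) * seriesStep2 m (seriesSource m) (rho ν ^ 2)

def seriesCoeff1 (m : ℕ) (ν : ℝ) : ℝ :=
  rho ν ^ (2 * m + 3) * seriesStep1 m (seriesSource m) (rho ν ^ 2)

def seriesCoeff2 (m : ℕ) (ν : ℝ) : ℝ := rho ν ^ (2 * m) * seriesSource m (rho ν ^ 2)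

lemma contDiffOn_seriesStep1 (m : ℕ) {F : ℝ → ℝ} (hF : ContDiffOn ℝ ∞ F (Iio (1 / 2))) :
    ContDiffOn ℝ ∞ (seriesStep1 m F) (Iio (1 / 2)) :=
  contDiffOn_avg _ (contDiffOn_div_one_sub hF)

lemma contDiffOn_seriesStep2 (m : ℕ) {F : ℝ → ℝ} (hF : ContDiffOn ℝ ∞ F (Iio (1 / 2))) :
    ContDiffOn ℝ ∞ (seriesStep2 m F) (Iio (1 / 2)) :=
  contDiffOn_avg _ (contDiffOn_div_one_sub (contDiffOn_seriesStep1 m hF))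

lemma contDiffOn_seriesSource (m : ℕ) : ContDiffOn ℝ ∞ (seriesSource m) (Iio (1 / 2)) := by
  induction m with
  | zero => exact contDiffOn_const.mul contDiffOn_source
  | succ m ih =>
    exact ((contDiffOn_sonic.pow 2).mul (contDiffOn_seriesStep2 m ih)).add
      (((contDiffOn_const.mul contDiffOn_source).mul (contDiffOn_speedRatio.pow _)).div_const _)

lemma hasDerivAt_seriesCoeff (m : ℕ) {ν : ℝ} (hν : ν ∈ Ioo 0 nuCr) :
    HasDerivAt (seriesCoeff m) (seriesCoeff1 m ν) ν := by
  have h := hasDerivAt_rho_zpow_mul_avg hν (2 * m + 5)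
    (contDiffOn_div_one_sub (contDiffOn_seriesStep1 m (contDiffOn_seriesSource m)))
  have hσ := rho_sq_lt (Ioo_subset_Ico_self hν)
  have h1 : (1 : ℝ) - rho ν ^ 2 ≠ 0 := by linarith
  refine h.congr_deriv ?_
  rw [seriesCoeff1, mul_div_cancel₀ _ h1,
    show ((2 * m + 5 : ℕ) : ℤ) - 2 = ((2 * m + 3 : ℕ) : ℤ) by push_cast; ring, zpow_natCast]

lemma hasDerivAt_seriesCoeff1 (m : ℕ) {ν : ℝ} (hν : ν ∈ Ioo 0 nuCr) :
    HasDerivAt (seriesCoeff1 m) (seriesCoeff2 m ν) ν := by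
  have h := hasDerivAt_rho_zpow_mul_avg hν (2 * m + 2)
    (contDiffOn_div_one_sub (contDiffOn_seriesSource m))
  have hσ := rho_sq_lt (Ioo_subset_Ico_self hν)
  have h1 : (1 : ℝ) - rho ν ^ 2 ≠ 0 := by linarith
  refine h.congr_deriv ?_
  rw [seriesCoeff2, mul_div_cancel₀ _ h1,
    show ((2 * m + 2 : ℕ) : ℤ) - 2 = ((2 * m : ℕ) : ℤ) by push_cast; ring, zpow_natCast]

lemma continuousOn_seriesCoeff (m : ℕ) : ContinuousOn (seriesCoeff m) (Ico 0 nuCr) :=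
  (continuousOn_rho.pow _).mul (continuousOn_comp_rho_sq
    (contDiffOn_seriesStep2 m (contDiffOn_seriesSource m)).continuousOn)

lemma continuousOn_seriesCoeff1 (m : ℕ) : ContinuousOn (seriesCoeff1 m) (Ico 0 nuCr) :=
  (continuousOn_rho.pow _).mul (continuousOn_comp_rho_sq
    (contDiffOn_seriesStep1 m (contDiffOn_seriesSource m)).continuousOn)

lemma continuousOn_seriesCoeff2 (m : ℕ) : ContinuousOn (seriesCoeff2 m) (Ico 0 nuCr) :=
  (continuousOn_rho.pow _).mul (continuousOn_comp_rho_sq (contDiffOn_seriesSource m).continuousOn)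

/-! ### Factorial bounds for the series coefficients -/

lemma abs_div_one_sub_le {F : ℝ → ℝ} {x B : ℝ} (hx : x < 1 / 2) (hF : |F x| ≤ B) :
    |F x / (1 - x)| ≤ 2 * B := by
  rw [abs_div, abs_of_pos (show (0 : ℝ) < 1 - x by linarith), div_le_iff₀ (by linarith)]
  have := abs_nonneg (F x)
  nlinarith

lemma abs_seriesStep1_le (m : ℕ) {F : ℝ → ℝ} {s B : ℝ} (hs : s < 1 / 2)
    (hF : ∀ x ∈ Icc 0 s, |F x| ≤ B) :
    ∀ x ∈ Icc 0 s, |seriesStep1 m F x| ≤ 2 * B / (2 * m + 3) := by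
  intro x hx
  have := abs_avg_le (2 * m + 2) (F := fun σ => F σ / (1 - σ)) (B := 2 * B) hx.1 fun t ht =>
    abs_div_one_sub_le (by linarith [ht.2, hx.2]) (hF t ⟨ht.1, ht.2.trans hx.2⟩)
  rwa [show ((2 * m + 2 : ℕ) : ℝ) + 1 = 2 * m + 3 by push_cast; ring] at this

lemma abs_seriesStep2_le (m : ℕ) {F : ℝ → ℝ} {s B : ℝ} (hs : s < 1 / 2)
    (hF : ∀ x ∈ Icc 0 s, |F x| ≤ B) :
    ∀ x ∈ Icc 0 s, |seriesStep2 m F x| ≤ 2 * (2 * B / (2 * m + 3)) / (2 * m + 6) := by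
  intro x hx
  have := abs_avg_le (2 * m + 5) (F := fun σ => seriesStep1 m F σ / (1 - σ))
    (B := 2 * (2 * B / (2 * m + 3))) hx.1 fun t ht =>
    abs_div_one_sub_le (by linarith [ht.2, hx.2])
      (abs_seriesStep1_le m hs hF t ⟨ht.1, ht.2.trans hx.2⟩)
  rwa [show ((2 * m + 5 : ℕ) : ℝ) + 1 = 2 * m + 6 by push_cast; ring] at this

/-- Induction on the recursion, with $M$ and $K$ bounding $2\ell_2$ and $(k/\varrho)^2$. Each of its
two summands is at most half of the required bound: in the first, the double integration contributes
$4/((2m+3)(2m+6))\le1/(2(m+1))$; in the second, $(2m+3)!\ge2(m+1)!$. -/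
lemma seriesSource_bound {s : ℝ} (hs : s < 1 / 2) : ∃ M K : ℝ, 0 ≤ M ∧ 1 ≤ K ∧
    ∀ m : ℕ, ∀ x ∈ Icc 0 s, |seriesSource m x| ≤ M * K ^ m / m.factorial := by
  have hsub : Icc 0 s ⊆ Iio (1 / 2 : ℝ) := fun x hx => lt_of_le_of_lt hx.2 hs
  obtain ⟨M, hM⟩ := isCompact_Icc.exists_bound_of_continuousOn
    ((contDiffOn_const.mul contDiffOn_source).continuousOn.mono hsub : ContinuousOn
      (fun x => 2 * source x) (Icc 0 s))
  obtain ⟨K, hK⟩ := isCompact_Icc.exists_bound_of_continuousOn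
    ((contDiffOn_speedRatio.pow 2).continuousOn.mono hsub)
  have hM' : ∀ x ∈ Icc 0 s, |2 * source x| ≤ max M 0 := fun x hx => (hM x hx).trans (le_max_left _ _)
  have hK' : ∀ x ∈ Icc 0 s, |speedRatio x ^ 2| ≤ max K 1 := fun x hx =>
    (hK x hx).trans (le_max_left _ _)
  refine ⟨max M 0, max K 1, le_max_right _ _, le_max_right _ _, fun m => ?_⟩
  have hM0 : 0 ≤ max M 0 := le_max_right _ _
  have hK1 : 1 ≤ max K 1 := le_max_right _ _
  generalize max M 0 = M at *
  generalize max K 1 = K at *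
  induction m with
  | zero =>
    intro x hx
    simpa [seriesSource] using hM' x hx
  | succ m ih =>
    intro x hx
    have hC := abs_seriesStep2_le m hs ih x hx
    have hx2 : x < 1 / 2 := hsub hx
    have hfac : (0 : ℝ) < m.factorial := by exact_mod_cast m.factorial_pos
    have hA : 0 ≤ M * K ^ (m + 1) / (m + 1).factorial := by positivity
    have h1 : |sonic x ^ 2 * seriesStep2 m (seriesSource m) x| ≤
        1 / 2 * (M * K ^ (m + 1) / (m + 1).factorial) := by
      rw [abs_mul, sonic_sq hx2, abs_of_nonneg (by linarith)]
      have h0 : 1 - 2 * x ≤ 1 := by linarith [hx.1]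
      calc (1 - 2 * x) * |seriesStep2 m (seriesSource m) x|
          ≤ 1 * |seriesStep2 m (seriesSource m) x| := by gcongr
        _ ≤ 2 * (2 * (M * K ^ m / m.factorial) / (2 * m + 3)) / (2 * m + 6) := by
          rw [one_mul]; exact hC
        _ = 4 * (m + 1) / ((2 * m + 3) * (2 * m + 6)) * (M * K ^ m / (m + 1).factorial) := by
          rw [Nat.factorial_succ]
          push_cast
          field_simp
          norm_num
          ring
        _ ≤ 1 / 2 * (M * K ^ (m + 1) / (m + 1).factorial) := by
          have hq : 4 * ((m : ℝ) + 1) / ((2 * m + 3) * (2 * m + 6)) ≤ 1 / 2 := by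
            rw [div_le_iff₀ (by positivity)]
            nlinarith [(Nat.cast_nonneg m : (0 : ℝ) ≤ m)]
          have hKm : K ^ m ≤ K ^ (m + 1) := pow_le_pow_right₀ hK1 (Nat.le_succ m)
          refine mul_le_mul hq ?_ (by positivity) (by norm_num)
          gcongr
    have h2 : |2 * source x * speedRatio x ^ (2 * (m + 1)) / (2 * (m + 1) + 1).factorial| ≤
        1 / 2 * (M * K ^ (m + 1) / (m + 1).factorial) := by
      rw [abs_div, abs_mul, pow_mul, abs_pow, Nat.abs_cast]
      have hf : (2 : ℝ) * (m + 1).factorial ≤ (2 * (m + 1) + 1).factorial := by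
        have e1 : (m + 2).factorial ≤ (2 * (m + 1) + 1).factorial :=
          Nat.factorial_le (by omega)
        have e2 : 2 * (m + 1).factorial ≤ (m + 2).factorial := by
          rw [Nat.factorial_succ (m + 1)]
          exact Nat.mul_le_mul_right _ (by omega)
        exact_mod_cast e2.trans e1
      calc |2 * source x| * |speedRatio x ^ 2| ^ (m + 1) / (2 * (m + 1) + 1).factorial
          ≤ M * K ^ (m + 1) / (2 * (m + 1).factorial) := by
            gcongr
            · exact hM' x hx
            · exact hK' x hx
        _ = 1 / 2 * (M * K ^ (m + 1) / (m + 1).factorial) := by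
            field_simp
    simp only [seriesSource]
    refine (abs_add_le _ _).trans ?_
    linarith

lemma seriesCoeff_bounds {νs : ℝ} (hνs : νs ∈ Ico 0 nuCr) : ∃ M K : ℝ, 0 ≤ M ∧ 1 ≤ K ∧
    ∀ m : ℕ, ∀ ν ∈ Icc 0 νs, |seriesCoeff m ν| ≤ M * K ^ m / m.factorial ∧
      |seriesCoeff1 m ν| ≤ M * K ^ m / m.factorial ∧
      |seriesCoeff2 m ν| ≤ M * K ^ m / m.factorial := by
  obtain ⟨M, K, hM, hK, hb⟩ := seriesSource_bound (rho_sq_lt hνs)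
  refine ⟨M, K, hM, hK, fun m ν hν => ?_⟩
  have hν' : ν ∈ Ico 0 nuCr := ⟨hν.1, hν.2.trans_lt hνs.2⟩
  have hr0 := rho_nonneg hν'
  have hr1 := rho_le_one hν'
  have hx : rho ν ^ 2 ∈ Icc 0 (rho νs ^ 2) := ⟨sq_nonneg _, pow_le_pow_left₀ hr0
    (strictMonoOn_rho.monotoneOn (Ico_subset_Icc_self hν') (Ico_subset_Icc_self hνs) hν.2) 2⟩
  have hB0 : 0 ≤ M * K ^ m / m.factorial := by positivity
  have key : ∀ (n : ℕ) (X : ℝ), |X| ≤ M * K ^ m / m.factorial →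
      |rho ν ^ n * X| ≤ M * K ^ m / m.factorial := by
    intro n X hX
    rw [abs_mul, abs_of_nonneg (pow_nonneg hr0 n)]
    calc rho ν ^ n * |X| ≤ 1 * |X| := by gcongr; exact pow_le_one₀ hr0 hr1
      _ ≤ _ := by rwa [one_mul]
  have hm : (0 : ℝ) ≤ m := Nat.cast_nonneg m
  have hstep : 2 * (M * K ^ m / m.factorial) / (2 * m + 3) ≤ M * K ^ m / m.factorial := by
    rw [div_le_iff₀ (by positivity)]
    nlinarith
  refine ⟨key _ _ ?_, key _ _ ?_, key _ _ (hb m _ hx)⟩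
  · refine (abs_seriesStep2_le m (rho_sq_lt hνs) (hb m) _ hx).trans ?_
    rw [div_le_iff₀ (by positivity)]
    nlinarith
  · exact (abs_seriesStep1_le m (rho_sq_lt hνs) (hb m) _ hx).trans hstep

/-- The sum `∑ (-z²)^m c_m(ν)`. -/
def evenSeries (c : ℕ → ℝ → ℝ) (z : ℂ) (ν : ℝ) : ℂ := ∑' m : ℕ, (-z ^ 2) ^ m * (c m ν : ℂ)

/-- Uniformity on $[0,\nu_s]$ serves continuity and differentiation in $\nu$; the decay $K^m/m!$
makes the series converge for every complex $z$, with sum entire in $z$. -/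
def IsEntireMajorized (c : ℕ → ℝ → ℝ) : Prop :=
  ∀ νs ∈ Ico 0 nuCr, ∃ M K : ℝ, 0 ≤ M ∧ 1 ≤ K ∧
    ∀ m : ℕ, ∀ ν ∈ Icc 0 νs, |c m ν| ≤ M * K ^ m / m.factorial

lemma isEntireMajorized_seriesCoeff : IsEntireMajorized seriesCoeff := fun _ h =>
  let ⟨M, K, hM, hK, hb⟩ := seriesCoeff_bounds h
  ⟨M, K, hM, hK, fun m ν hν => (hb m ν hν).1⟩

lemma isEntireMajorized_seriesCoeff1 : IsEntireMajorized seriesCoeff1 := fun _ h =>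
  let ⟨M, K, hM, hK, hb⟩ := seriesCoeff_bounds h
  ⟨M, K, hM, hK, fun m ν hν => (hb m ν hν).2.1⟩

lemma isEntireMajorized_seriesCoeff2 : IsEntireMajorized seriesCoeff2 := fun _ h =>
  let ⟨M, K, hM, hK, hb⟩ := seriesCoeff_bounds h
  ⟨M, K, hM, hK, fun m ν hν => (hb m ν hν).2.2⟩

lemma summable_majorant (M K R : ℝ) :
    Summable (fun m : ℕ => R ^ m * (M * K ^ m / m.factorial)) := by
  have := (Real.summable_pow_div_factorial (R * K)).mul_left M
  refine this.congr fun m => ?_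
  rw [mul_pow]
  ring

lemma norm_evenSeries_term_le {c : ℕ → ℝ → ℝ} {m : ℕ} {ν B R : ℝ} {z : ℂ} (hc : |c m ν| ≤ B)
    (hz : ‖z‖ ^ 2 ≤ R) : ‖(-z ^ 2) ^ m * (c m ν : ℂ)‖ ≤ R ^ m * B := by
  rw [norm_mul, norm_pow, norm_neg, norm_pow, Complex.norm_real, Real.norm_eq_abs]
  have : 0 ≤ R := (sq_nonneg _).trans hz
  gcongr

lemma hasSum_evenSeries {c : ℕ → ℝ → ℝ} (hc : IsEntireMajorized c) (z : ℂ) {ν : ℝ}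
    (hν : ν ∈ Ico 0 nuCr) :
    HasSum (fun m : ℕ => (-z ^ 2) ^ m * (c m ν : ℂ)) (evenSeries c z ν) := by
  obtain ⟨M, K, -, -, hb⟩ := hc ν hν
  exact (Summable.of_norm_bounded (summable_majorant M K (‖z‖ ^ 2)) fun m =>
    norm_evenSeries_term_le (hb m ν ⟨hν.1, le_rfl⟩) le_rfl).hasSum

lemma continuousOn_evenSeries {c : ℕ → ℝ → ℝ} (hc : IsEntireMajorized c)
    (hcont : ∀ m, ContinuousOn (c m) (Ico 0 nuCr)) (z : ℂ) :
    ContinuousOn (evenSeries c z) (Ico 0 nuCr) := by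
  intro ν hν
  obtain ⟨νs, h1, h2⟩ := exists_between hν.2
  obtain ⟨M, K, -, -, hb⟩ := hc νs ⟨hν.1.trans h1.le, h2⟩
  have hsub : Icc 0 νs ⊆ Ico 0 nuCr := fun x hx => ⟨hx.1, hx.2.trans_lt h2⟩
  have h : ContinuousOn (evenSeries c z) (Icc 0 νs) :=
    continuousOn_tsum (fun m => continuousOn_const.mul
      (Complex.continuous_ofReal.comp_continuousOn ((hcont m).mono hsub)))
      (summable_majorant M K (‖z‖ ^ 2))
      fun m x hx => norm_evenSeries_term_le (hb m x hx) le_rfl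
  refine (h ν ⟨hν.1, h1.le⟩).mono_of_mem_nhdsWithin ?_
  rw [mem_nhdsWithin]
  exact ⟨Iio νs, isOpen_Iio, h1, fun x hx => ⟨hx.2.1, hx.1.le⟩⟩

lemma hasDerivAt_evenSeries {c c' : ℕ → ℝ → ℝ} (hc : IsEntireMajorized c)
    (hc' : IsEntireMajorized c')
    (hd : ∀ m, ∀ ν ∈ Ioo 0 nuCr, HasDerivAt (c m) (c' m ν) ν) (z : ℂ) {ν : ℝ}
    (hν : ν ∈ Ioo 0 nuCr) :
    HasDerivAt (evenSeries c z) (evenSeries c' z ν) ν := by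
  obtain ⟨νs, h1, h2⟩ := exists_between hν.2
  obtain ⟨M, K, -, -, hb⟩ := hc' νs ⟨hν.1.le.trans h1.le, h2⟩
  refine hasDerivAt_tsum_of_isPreconnected (summable_majorant M K (‖z‖ ^ 2)) isOpen_Ioo
    isPreconnected_Ioo (t := Ioo 0 νs) (g := fun m x => (-z ^ 2) ^ m * (c m x : ℂ))
    (g' := fun m x => (-z ^ 2) ^ m * (c' m x : ℂ))
    (fun m x hx => ((hd m x ⟨hx.1, hx.2.trans h2⟩).ofReal_comp).const_mul _)
    (fun m x hx => norm_evenSeries_term_le (hb m x ⟨hx.1.le, hx.2.le⟩) le_rfl)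
    (⟨hν.1, h1⟩ : ν ∈ Ioo 0 νs) (hasSum_evenSeries hc z (Ioo_subset_Ico_self hν)).summable
    ⟨hν.1, h1⟩

lemma differentiable_evenSeries {c : ℕ → ℝ → ℝ} (hc : IsEntireMajorized c) {ν : ℝ}
    (hν : ν ∈ Ico 0 nuCr) : Differentiable ℂ (fun z => evenSeries c z ν) := by
  intro z
  obtain ⟨M, K, -, -, hb⟩ := hc ν hν
  have h : DifferentiableOn ℂ (fun z => evenSeries c z ν) (Metric.ball 0 (‖z‖ + 1)) := by
    refine Complex.differentiableOn_tsum_of_summable_norm (summable_majorant M K ((‖z‖ + 1) ^ 2))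
      (fun m => by fun_prop) Metric.isOpen_ball fun m w hw => ?_
    refine norm_evenSeries_term_le (hb m ν ⟨hν.1, le_rfl⟩) ?_
    rw [mem_ball_zero_iff] at hw
    exact pow_le_pow_left₀ (norm_nonneg _) hw.le 2
  refine (h z ?_).differentiableAt (Metric.isOpen_ball.mem_nhds ?_) <;> simp

/-- The solution `ĥ(ν, z)` for complex frequency `z`. -/
def remSol : ℂ → ℝ → ℂ := evenSeries seriesCoeff

def remSol1 : ℂ → ℝ → ℂ := evenSeries seriesCoeff1

def remSol2 : ℂ → ℝ → ℂ := evenSeries seriesCoeff2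

/-- The entire function `sin w / w`. -/
def csinc (w : ℂ) : ℂ := ∑' m : ℕ, (-w ^ 2) ^ m / ((2 * m + 1).factorial : ℂ)

lemma hasSum_csinc (w : ℂ) :
    HasSum (fun m : ℕ => (-w ^ 2) ^ m / ((2 * m + 1).factorial : ℂ)) (csinc w) := by
  refine (Summable.of_norm_bounded (Real.summable_pow_div_factorial (‖w‖ ^ 2)) fun m => ?_).hasSum
  rw [norm_div, norm_pow, norm_neg, norm_pow, Complex.norm_natCast]
  gcongr
  omega

lemma csinc_mul (w : ℂ) : w * csinc w = Complex.sin w := by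
  refine HasSum.unique ((hasSum_csinc w).mul_left w) ?_
  refine (Complex.hasSum_sin w).congr_fun fun m => ?_
  rw [neg_pow]
  ring

lemma csinc_zero : csinc 0 = 1 := by
  refine (hasSum_csinc 0).unique ?_
  convert hasSum_single (α := ℂ) (0 : ℕ) ?_ using 1
  · simp
  · intro m hm
    simp [hm]

lemma csinc_ofReal (x : ℝ) : csinc x = (Real.sinc x : ℂ) := by
  by_cases hx : x = 0
  · subst hx
    simp [csinc_zero]
  · have hx' : (x : ℂ) ≠ 0 := by exact_mod_cast hx
    rw [Real.sinc_of_ne_zero hx]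
    push_cast
    rw [eq_div_iff hx', mul_comm, csinc_mul]

lemma norm_csinc_le {w : ℂ} (hw : w ≠ 0) : ‖csinc w‖ ≤ Real.exp |w.im| / ‖w‖ := by
  have h0 : 0 < ‖w‖ := norm_pos_iff.2 hw
  rw [le_div_iff₀ h0, mul_comm, ← norm_mul, csinc_mul, Complex.sin, norm_div, norm_mul,
    Complex.norm_I, mul_one, Complex.norm_ofNat, div_le_iff₀ two_pos]
  refine (norm_sub_le _ _).trans ?_
  rw [Complex.norm_exp, Complex.norm_exp]
  have h1 : (-w * Complex.I).re ≤ |w.im| := by simpa using le_abs_self w.im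
  have h2 : (w * Complex.I).re ≤ |w.im| := by simpa using neg_le_abs w.im
  have := Real.exp_le_exp.2 h1
  have := Real.exp_le_exp.2 h2
  linarith

/-- The recursion for `seriesSource` is the coefficientwise form of the equation. -/
lemma remSol2_eq (z : ℂ) {ν : ℝ} (hν : ν ∈ Ioo 0 nuCr) :
    remSol2 z ν = ((2 * source (rho ν ^ 2) : ℝ) : ℂ) * csinc (z * charSpeed ν)
      - ((sonic (rho ν ^ 2) / rho ν ^ 2 : ℝ) : ℂ) ^ 2 * z ^ 2 * remSol z ν := by
  have hν' := Ioo_subset_Ico_self hν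
  have hp : (rho ν : ℂ) ≠ 0 := by exact_mod_cast (rho_pos hν).ne'
  have s0 := hasSum_evenSeries isEntireMajorized_seriesCoeff z hν'
  have s2 := hasSum_evenSeries isEntireMajorized_seriesCoeff2 z hν'
  have sc := (hasSum_csinc (z * charSpeed ν)).mul_left ((2 * source (rho ν ^ 2) : ℝ) : ℂ)
  -- Multiplication by $z^2$ shifts the index, so the term $m=0$ of the other two series is split
  -- off before comparison.
  have t2 := (hasSum_nat_add_iff' 1).2 s2
  have tc := (hasSum_nat_add_iff' 1).2 sc
  have t0 := s0.mul_left (((sonic (rho ν ^ 2) / rho ν ^ 2 : ℝ) : ℂ) ^ 2 * z ^ 2)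
  have h := t2.unique ((tc.sub t0).congr_fun ?_)
  · simp only [Finset.sum_range_one, pow_zero, one_mul, seriesCoeff2, seriesSource, mul_zero,
      zero_add, Nat.factorial_one, Nat.cast_one, div_one, mul_one] at h
    rw [remSol2, remSol]
    linear_combination h
  · intro m
    simp only [seriesCoeff2, seriesCoeff, seriesSource]
    rw [charSpeed_eq hν']
    push_cast
    have hf : (((2 * (m + 1) + 1).factorial : ℕ) : ℂ) ≠ 0 := by
      exact_mod_cast (Nat.factorial_pos _).ne'
    field_simp
    ring

/-! ### Existence and uniqueness of the remainder transform -/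

lemma hasDerivAt_remSol (z : ℂ) {ν : ℝ} (hν : ν ∈ Ioo 0 nuCr) :
    HasDerivAt (remSol z) (remSol1 z ν) ν :=
  hasDerivAt_evenSeries isEntireMajorized_seriesCoeff isEntireMajorized_seriesCoeff1
    (fun m _ h => hasDerivAt_seriesCoeff m h) z hν

lemma hasDerivAt_remSol1 (z : ℂ) {ν : ℝ} (hν : ν ∈ Ioo 0 nuCr) :
    HasDerivAt (remSol1 z) (remSol2 z ν) ν :=
  hasDerivAt_evenSeries isEntireMajorized_seriesCoeff1 isEntireMajorized_seriesCoeff2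
    (fun m _ h => hasDerivAt_seriesCoeff1 m h) z hν

lemma continuousOn_remSol (z : ℂ) : ContinuousOn (remSol z) (Ico 0 nuCr) :=
  continuousOn_evenSeries isEntireMajorized_seriesCoeff continuousOn_seriesCoeff z

lemma continuousOn_remSol1 (z : ℂ) : ContinuousOn (remSol1 z) (Ico 0 nuCr) :=
  continuousOn_evenSeries isEntireMajorized_seriesCoeff1 continuousOn_seriesCoeff1 z

lemma continuousOn_remSol2 (z : ℂ) : ContinuousOn (remSol2 z) (Ico 0 nuCr) :=
  continuousOn_evenSeries isEntireMajorized_seriesCoeff2 continuousOn_seriesCoeff2 z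

lemma remSol_zero (z : ℂ) : remSol z 0 = 0 := by
  simp [remSol, evenSeries, seriesCoeff, rho_zero]

lemma remSol1_zero (z : ℂ) : remSol1 z 0 = 0 := by
  simp [remSol1, evenSeries, seriesCoeff1, rho_zero]

lemma nhdsGT_zero_le : 𝓝[>] (0 : ℝ) ≤ 𝓝[Ico 0 nuCr] 0 :=
  nhdsWithin_le_of_mem (mem_of_superset (Ioo_mem_nhdsGT nuCr_pos) Ioo_subset_Ico_self)

lemma tendsto_nhdsGT_of_continuousOn {E : Type*} [TopologicalSpace E] {y : ℝ → E}
    (hy : ContinuousOn y (Ico 0 nuCr)) : Tendsto y (𝓝[>] 0) (𝓝 (y 0)) :=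
  (hy 0 ⟨le_rfl, nuCr_pos⟩).mono_left nhdsGT_zero_le

lemma tendsto_remSol (z : ℂ) : Tendsto (remSol z) (𝓝[>] 0) (𝓝 0) := by
  simpa [remSol_zero] using tendsto_nhdsGT_of_continuousOn (continuousOn_remSol z)

lemma tendsto_remSol1 (z : ℂ) : Tendsto (remSol1 z) (𝓝[>] 0) (𝓝 0) := by
  simpa [remSol1_zero] using tendsto_nhdsGT_of_continuousOn (continuousOn_remSol1 z)

lemma hasDerivAt_remSol1' (z : ℂ) {ν : ℝ} (hν : ν ∈ Ioo 0 nuCr) :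
    HasDerivAt (remSol1 z) (((2 * source (rho ν ^ 2) : ℝ) : ℂ) * csinc (z * charSpeed ν)
      - ((sonic (rho ν ^ 2) / rho ν ^ 2 : ℝ) : ℂ) ^ 2 * z ^ 2 * remSol z ν) ν := by
  rw [← remSol2_eq z hν]
  exact hasDerivAt_remSol1 z hν

lemma evenSeries_ofReal_im (c : ℕ → ℝ → ℝ) (ξ ν : ℝ) : (evenSeries c ξ ν).im = 0 := by
  have : evenSeries c ξ ν = ((∑' m : ℕ, (-ξ ^ 2) ^ m * c m ν : ℝ) : ℂ) := by
    rw [evenSeries, Complex.ofReal_tsum]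
    push_cast
    rfl
  rw [this, Complex.ofReal_im]

lemma HasDerivAt.re_of_complex {y : ℝ → ℂ} {y' : ℂ} {ν : ℝ} (h : HasDerivAt y y' ν) :
    HasDerivAt (fun x => (y x).re) y'.re ν :=
  Complex.reCLM.hasFDerivAt.comp_hasDerivAt ν h

/-- At $\nu=0$, where $\varrho$ is not differentiable, the one-sided derivative is obtained as the
limit of the interior derivatives. -/
lemma hasDerivWithinAt_Ico_of_continuousOn {y y₁ : ℝ → ℝ} (hy : ContinuousOn y (Ico 0 nuCr))
    (hy₁ : ContinuousOn y₁ (Ico 0 nuCr)) (hd : ∀ ν ∈ Ioo 0 nuCr, HasDerivAt y (y₁ ν) ν) :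
    HasDerivWithinAt y (y₁ 0) (Ici 0) 0 ∧
      ∀ ν ∈ Ico 0 nuCr, HasDerivWithinAt y (y₁ ν) (Ico 0 nuCr) ν := by
  have h0 : HasDerivWithinAt y (y₁ 0) (Ici 0) 0 := by
    refine hasDerivWithinAt_Ici_of_tendsto_deriv (s := Ioo 0 nuCr)
      (fun ν hν => (hd ν hν).differentiableAt.differentiableWithinAt)
      ((hy 0 ⟨le_rfl, nuCr_pos⟩).mono Ioo_subset_Ico_self) (Ioo_mem_nhdsGT nuCr_pos) ?_
    refine (tendsto_nhdsGT_of_continuousOn hy₁).congr' ?_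
    filter_upwards [Ioo_mem_nhdsGT nuCr_pos] with ν hν using (hd ν hν).deriv.symm
  refine ⟨h0, fun ν hν => ?_⟩
  rcases hν.1.eq_or_lt with h | h
  · subst h
    exact h0.mono Ico_subset_Ici_self
  · exact (hd ν ⟨h, hν.2⟩).hasDerivWithinAt

lemma uniqueDiffOn_Ico_nuCr : UniqueDiffOn ℝ (Ico 0 nuCr) := uniqueDiffOn_Ico 0 nuCr

lemma isRemainderTransform_remSol (ξ : ℝ) :
    IsRemainderTransform ξ (fun ν => (remSol ξ ν).re) := by
  have c0 : ContinuousOn (fun ν => (remSol ξ ν).re) (Ico 0 nuCr) :=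
    Complex.continuous_re.comp_continuousOn (continuousOn_remSol ξ)
  have c1 : ContinuousOn (fun ν => (remSol1 ξ ν).re) (Ico 0 nuCr) :=
    Complex.continuous_re.comp_continuousOn (continuousOn_remSol1 ξ)
  have c2 : ContinuousOn (fun ν => (remSol2 ξ ν).re) (Ico 0 nuCr) :=
    Complex.continuous_re.comp_continuousOn (continuousOn_remSol2 ξ)
  have d0 : ∀ ν ∈ Ioo 0 nuCr, HasDerivAt (fun ν => (remSol ξ ν).re) (remSol1 ξ ν).re ν :=
    fun ν hν => HasDerivAt.re_of_complex (hasDerivAt_remSol ξ hν)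
  have d1 : ∀ ν ∈ Ioo 0 nuCr, HasDerivAt (fun ν => (remSol1 ξ ν).re) (remSol2 ξ ν).re ν :=
    fun ν hν => HasDerivAt.re_of_complex (hasDerivAt_remSol1 ξ hν)
  obtain ⟨h00, h0⟩ := hasDerivWithinAt_Ico_of_continuousOn c0 c1 d0
  obtain ⟨-, h1⟩ := hasDerivWithinAt_Ico_of_continuousOn c1 c2 d1
  refine ⟨?_, by simp [remSol_zero], by simpa [remSol1_zero] using h00, fun ν hν => ?_⟩
  · have e1 : ContDiffOn ℝ 1 (fun ν => (remSol1 ξ ν).re) (Ico 0 nuCr) := by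
      rw [contDiffOn_one_iff_derivWithin uniqueDiffOn_Ico_nuCr]
      exact ⟨fun ν hν => (h1 ν hν).differentiableWithinAt,
        c2.congr fun ν hν => (h1 ν hν).derivWithin (uniqueDiffOn_Ico_nuCr ν hν)⟩
    rw [show (2 : ℕ∞ω) = 1 + 1 from rfl,
      contDiffOn_succ_iff_derivWithin uniqueDiffOn_Ico_nuCr]
    exact ⟨fun ν hν => (h0 ν hν).differentiableWithinAt, by simp,
      e1.congr fun ν hν => (h0 ν hν).derivWithin (uniqueDiffOn_Ico_nuCr ν hν)⟩
  · have e2 : iteratedDeriv 2 (fun ν => (remSol ξ ν).re) ν = (remSol2 ξ ν).re := by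
      rw [iteratedDeriv_succ, iteratedDeriv_one]
      refine ((d1 ν hν).congr_of_eventuallyEq ?_).deriv
      filter_upwards [Ioo_mem_nhds hν.1 hν.2] with x hx using (d0 x hx).deriv
    rw [e2, remSol2_eq _ hν, ell2_eq hν, deriv_charSpeed hν]
    have : (ξ : ℂ) * (charSpeed ν : ℂ) = ((ξ * charSpeed ν : ℝ) : ℂ) := by push_cast; rfl
    rw [this, csinc_ofReal, ← Complex.ofReal_pow, ← Complex.ofReal_pow, ← Complex.ofReal_mul,
      ← Complex.ofReal_mul, Complex.sub_re, Complex.re_ofReal_mul, Complex.ofReal_re]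
    ring

/-! ### Uniqueness for the singular Cauchy problem -/

lemma norm_le_mul_of_norm_deriv_le {y y₁ : ℝ → ℂ} {νs C : ℝ}
    (hy : ∀ ν ∈ Ioo 0 νs, HasDerivAt y (y₁ ν) ν) (h0 : Tendsto y (𝓝[>] 0) (𝓝 0)) (hC : 0 ≤ C)
    (hb : ∀ ν ∈ Ioo 0 νs, ‖y₁ ν‖ ≤ C) : ∀ ν ∈ Ioo 0 νs, ‖y ν‖ ≤ C * ν := by
  intro ν hν
  have hlim : Tendsto (fun μ => ‖y ν - y μ‖) (𝓝[>] 0) (𝓝 ‖y ν - 0‖) :=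
    (tendsto_const_nhds.sub h0).norm
  rw [sub_zero] at hlim
  refine le_of_tendsto hlim ?_
  filter_upwards [Ioo_mem_nhdsGT hν.1] with μ hμ
  have := Convex.norm_image_sub_le_of_norm_hasDerivWithin_le (C := C) (f := y) (f' := y₁)
    (s := Icc μ ν)
    (fun x hx => (hy x ⟨hμ.1.trans_le hx.1, hx.2.trans_lt hν.2⟩).hasDerivWithinAt)
    (fun x hx => hb x ⟨hμ.1.trans_le hx.1, hx.2.trans_lt hν.2⟩) (convex_Icc _ _)
    ⟨le_rfl, hμ.2.le⟩ ⟨hμ.2.le, le_rfl⟩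
  rw [Real.norm_of_nonneg (by linarith [hμ.2])] at this
  nlinarith [mul_nonneg hC hμ.1.le]

lemma IsRemainderTransform.regularity {ξ : ℝ} {y : ℝ → ℝ} (h : IsRemainderTransform ξ y) :
    (∀ ν ∈ Ioo 0 nuCr, HasDerivAt y (deriv y ν) ν) ∧
    (∀ ν ∈ Ioo 0 nuCr, HasDerivAt (deriv y) (iteratedDeriv 2 y ν) ν) ∧
    Tendsto y (𝓝[>] 0) (𝓝 0) ∧ Tendsto (deriv y) (𝓝[>] 0) (𝓝 0) := by
  have hopen : ContDiffOn ℝ (1 + 1) y (Ioo 0 nuCr) := h.contDiffOn.mono Ioo_subset_Ico_self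
  obtain ⟨h1, -, h2⟩ := (contDiffOn_succ_iff_deriv_of_isOpen isOpen_Ioo).1 hopen
  refine ⟨fun ν hν => ((h1 ν hν).differentiableAt (isOpen_Ioo.mem_nhds hν)).hasDerivAt,
    fun ν hν => ?_, ?_, ?_⟩
  · rw [iteratedDeriv_succ, iteratedDeriv_one]
    exact ((h2.differentiableOn (by simp) ν hν).differentiableAt
      (isOpen_Ioo.mem_nhds hν)).hasDerivAt
  · simpa [h.value_zero] using tendsto_nhdsGT_of_continuousOn h.contDiffOn.continuousOn
  · have hc := h.contDiffOn.continuousOn_derivWithin uniqueDiffOn_Ico_nuCr (by norm_num)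
    have h0 : derivWithin y (Ico 0 nuCr) 0 = 0 :=
      (h.deriv_zero.mono Ico_subset_Ici_self).derivWithin
        (uniqueDiffOn_Ico_nuCr 0 ⟨le_rfl, nuCr_pos⟩)
    have := tendsto_nhdsGT_of_continuousOn hc
    rw [h0] at this
    refine this.congr' ?_
    filter_upwards [Ioo_mem_nhdsGT nuCr_pos] with ν hν
    exact derivWithin_of_mem_nhds (mem_of_superset (isOpen_Ioo.mem_nhds hν) Ioo_subset_Ico_self)

/-- The difference of two solutions solves the homogeneous equation, so `energy_estimate` applies
with $g=0$ and its derivative vanishes. A Gronwall argument in $\nu$ would not do, since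
$k'^2\sim(3\nu)^{-4/3}$ is not integrable at $0$. -/
lemma IsRemainderTransform.eqOn {ξ : ℝ} {y x : ℝ → ℝ} (hy : IsRemainderTransform ξ y)
    (hx : IsRemainderTransform ξ x) : EqOn y x (Ico 0 nuCr) := by
  obtain ⟨a1, a2, a3, a4⟩ := hy.regularity
  obtain ⟨b1, b2, b3, b4⟩ := hx.regularity
  have d1 : ∀ ν ∈ Ioo 0 nuCr, HasDerivAt (fun ν => ((y ν - x ν : ℝ) : ℂ))
      ((deriv y ν - deriv x ν : ℝ) : ℂ) ν := fun ν hν => ((a1 ν hν).sub (b1 ν hν)).ofReal_comp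
  have d2 : ∀ ν ∈ Ioo 0 nuCr, HasDerivAt (fun ν => ((deriv y ν - deriv x ν : ℝ) : ℂ))
      (0 - ((sonic (rho ν ^ 2) / rho ν ^ 2 : ℝ) : ℂ) ^ 2 * (ξ : ℂ) ^ 2 * ((y ν - x ν : ℝ) : ℂ)) ν := by
    intro ν hν
    refine ((a2 ν hν).sub (b2 ν hν)).ofReal_comp.congr_deriv ?_
    have e1 := hy.equation ν hν
    have e2 := hx.equation ν hν
    rw [deriv_charSpeed hν] at e1 e2
    have : iteratedDeriv 2 y ν - iteratedDeriv 2 x ν =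
      0 - (sonic (rho ν ^ 2) / rho ν ^ 2) ^ 2 * ξ ^ 2 * (y ν - x ν) := by linarith
    rw [this]
    push_cast
    rfl
  have t1 : Tendsto (fun ν => ((y ν - x ν : ℝ) : ℂ)) (𝓝[>] 0) (𝓝 0) := by
    have := (Complex.continuous_ofReal.tendsto (0 - 0)).comp (a3.sub b3)
    simpa [Function.comp_def] using this
  have t2 : Tendsto (fun ν => ((deriv y ν - deriv x ν : ℝ) : ℂ)) (𝓝[>] 0) (𝓝 0) := by
    have := (Complex.continuous_ofReal.tendsto (0 - 0)).comp (a4.sub b4)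
    simpa [Function.comp_def] using this
  have key := energy_estimate (f := fun _ => 0) (g := fun _ => 0) (g' := fun _ => 0) le_rfl
    d1 d2 t1 t2 (fun ν _ => hasDerivAt_const ν 0) tendsto_const_nhds (by simp)
  intro ν hν
  rcases hν.1.eq_or_lt with h | h
  · rw [← h, hy.value_zero, hx.value_zero]
  · have := norm_le_mul_of_norm_deriv_le d1 t1 le_rfl
      (fun μ hμ => by simpa using (key μ hμ).1) ν ⟨h, hν.2⟩
    rw [zero_mul, norm_le_zero_iff] at this
    have h2 : y ν - x ν = 0 := by exact_mod_cast this
    linarith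

lemma isRemainderTransform_remainderTransform (ξ : ℝ) :
    IsRemainderTransform ξ (remainderTransform ξ) := by
  have hex : ∃ y, IsRemainderTransform ξ y := ⟨_, isRemainderTransform_remSol ξ⟩
  rw [remainderTransform, dif_pos hex]
  exact hex.choose_spec

lemma ofReal_remainderTransform (ξ : ℝ) {ν : ℝ} (hν : ν ∈ Ico 0 nuCr) :
    (remainderTransform ξ ν : ℂ) = remSol ξ ν := by
  have h := (isRemainderTransform_remainderTransform ξ).eqOn (isRemainderTransform_remSol ξ) hν
  rw [h]
  exact Complex.ext rfl (evenSeries_ofReal_im _ _ _).symm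

lemma remainderTransform_eq (ξ : ℝ) {ν : ℝ} (hν : ν ∈ Ico 0 nuCr) :
    remainderTransform ξ ν = (remSol ξ ν).re :=
  (isRemainderTransform_remainderTransform ξ).eqOn (isRemainderTransform_remSol ξ) hν

/-! ### Bounds for the remainder transform -/

lemma exists_bound_comp_rho_sq {F : ℝ → ℝ} (hF : ContinuousOn F (Iio (1 / 2))) {νs : ℝ}
    (hνs : νs < nuCr) : ∃ C, 0 < C ∧ ∀ ν ∈ Icc 0 νs, |F (rho ν ^ 2)| ≤ C := by
  obtain ⟨C, hC⟩ := isCompact_Icc.exists_bound_of_continuousOn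
    ((continuousOn_comp_rho_sq hF).mono
      (fun x hx => ⟨hx.1, hx.2.trans_lt hνs⟩ : Icc 0 νs ⊆ Ico 0 nuCr))
  exact ⟨max C 1, by positivity, fun ν hν => (hC ν hν).trans (le_max_left _ _)⟩

lemma charSpeed_pos {ν : ℝ} (hν : ν ∈ Ioo 0 nuCr) : 0 < charSpeed ν := by
  rw [charSpeed_eq (Ioo_subset_Ico_self hν)]
  exact mul_pos (rho_pos hν) (speedRatio_pos (rho_sq_lt (Ioo_subset_Ico_self hν)))

/-- Two applications of `energy_estimate`. For real frequencies $|\mathrm{sinc}|\le1$ gives bounds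
that survive as $\xi\to0$. For $z\ne0$, $|\sin w/w|\le e^{|\mathrm{Im}\,w|}/|w|$ gives a source of
order $1/(|z|\varrho)$, hence decay $|z|^{-1}$ for the derivative; division by $|z|k'$ gains one
more power for the solution itself. -/
lemma remSol_bounds {νs : ℝ} (hνs : νs ∈ Ioo 0 nuCr) : ∃ C, 0 < C ∧ ∀ ν ∈ Ioo 0 νs,
    (∀ z : ℂ, z ≠ 0 → ‖remSol1 z ν‖ ≤ C * Real.exp (|z.im| * charSpeed ν) / ‖z‖ ∧
      ‖remSol z ν‖ ≤ C * rho ν * Real.exp (|z.im| * charSpeed ν) / ‖z‖ ^ 2) ∧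
    ∀ ξ : ℝ, ‖remSol1 ξ ν‖ ≤ C ∧ ‖remSol ξ ν‖ ≤ C * rho ν := by
  obtain ⟨M, hM0, hM⟩ := exists_bound_comp_rho_sq (F := fun σ => 2 * source σ)
    (contDiffOn_const.mul contDiffOn_source).continuousOn hνs.2
  obtain ⟨C₁, hC₁0, hC₁⟩ := exists_bound_comp_rho_sq (F := fun σ => (speedRatio σ)⁻¹)
    (contDiffOn_speedRatio.continuousOn.inv₀ fun _ h => (speedRatio_pos h).ne') hνs.2
  obtain ⟨C₂, hC₂0, hC₂⟩ := exists_bound_comp_rho_sq (F := fun σ => (sonic σ)⁻¹)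
    (contDiffOn_sonic.continuousOn.inv₀ fun _ h => (sonic_pos h).ne') hνs.2
  have hin : ∀ ν ∈ Ioo 0 νs, ν ∈ Ioo 0 nuCr := fun ν hν => ⟨hν.1, hν.2.trans hνs.2⟩
  have hν1 : ∀ ν ∈ Ioo 0 nuCr, ν ≤ 1 := fun ν hν =>
    (nu_le_rho_cube (Ioo_subset_Ico_self hν)).trans
      (pow_le_one₀ (rho_pos hν).le (rho_le_one (Ioo_subset_Ico_self hν)))
  have hreal : ∀ ν ∈ Ioo 0 νs, ∀ ξ : ℝ, ‖remSol1 ξ ν‖ ≤ M := by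
    intro ν hν ξ
    have key := energy_estimate (z := (ξ : ℂ)) (g := fun ν => M * ν) (g' := fun _ => M) hνs.2.le
      (fun ν hν => hasDerivAt_remSol ξ hν) (fun ν hν => hasDerivAt_remSol1' ξ hν)
      (tendsto_remSol ξ) (tendsto_remSol1 ξ)
      (fun ν _ => by simpa using (hasDerivAt_id ν).const_mul M)
      (by
        have : Tendsto (fun ν : ℝ => M * ν) (𝓝 0) (𝓝 (M * 0)) :=
          (continuous_const.mul continuous_id).tendsto 0
        rw [mul_zero] at this
        exact this.mono_left nhdsWithin_le_nhds)
      (fun ν hν => by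
        have : (ξ : ℂ) * (charSpeed ν : ℂ) = ((ξ * charSpeed ν : ℝ) : ℂ) := by push_cast; rfl
        rw [this, csinc_ofReal, norm_mul, Complex.norm_real, Complex.norm_real, Complex.ofReal_im,
          abs_zero, zero_mul, Real.exp_zero, one_mul, Real.norm_eq_abs, Real.norm_eq_abs]
        calc |2 * source (rho ν ^ 2)| * |Real.sinc (ξ * charSpeed ν)| ≤ M * 1 := by
              gcongr
              · exact hM ν ⟨hν.1.le, hν.2.le⟩
              · exact Real.abs_sinc_le_one _
          _ = M := mul_one M)
    have := (key ν hν).1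
    rw [Complex.ofReal_im, abs_zero, zero_mul, Real.exp_zero, one_mul] at this
    exact this.trans (by nlinarith [hν1 ν (hin ν hν)])
  have hcomplex : ∀ z : ℂ, z ≠ 0 → ∀ ν ∈ Ioo 0 νs,
      ‖remSol1 z ν‖ ≤ Real.exp (|z.im| * charSpeed ν) * (M * C₁ / ‖z‖ * rho ν ^ 2) ∧
      ‖z‖ * (sonic (rho ν ^ 2) / rho ν ^ 2) * ‖remSol z ν‖ ≤
        Real.exp (|z.im| * charSpeed ν) * (M * C₁ / ‖z‖ * rho ν ^ 2) := by
    intro z hz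
    have hz0 : 0 < ‖z‖ := norm_pos_iff.2 hz
    -- $\varrho^2$ is a primitive of $2(1-\varrho^2)/\varrho$, which dominates $1/\varrho$ because
    -- $\varrho^2<1/2$.
    refine energy_estimate (z := z) (g := fun ν => M * C₁ / ‖z‖ * rho ν ^ 2)
      (g' := fun ν => M * C₁ / ‖z‖ * (2 * (1 - rho ν ^ 2) / rho ν)) hνs.2.le
      (fun ν hν => hasDerivAt_remSol z hν) (fun ν hν => hasDerivAt_remSol1' z hν)
      (tendsto_remSol z) (tendsto_remSol1 z) (fun ν hν => ?_) ?_ (fun ν hν => ?_)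
    · have hp := (rho_pos hν).ne'
      refine (((hasDerivAt_rho hν).pow 2).const_mul (M * C₁ / ‖z‖)).congr_deriv ?_
      field_simp
      norm_num
      ring
    · simpa using (tendsto_rho_zero.pow 2).const_mul (M * C₁ / ‖z‖)
    · have hν' := hin ν hν
      have hk := charSpeed_pos hν'
      have hp := rho_pos hν'
      have hσ := rho_sq_lt (Ioo_subset_Ico_self hν')
      have hkap := speedRatio_pos hσ
      have hw : z * (charSpeed ν : ℂ) ≠ 0 :=
        mul_ne_zero hz (by exact_mod_cast hk.ne')
      have h1 := norm_csinc_le hw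
      have him : |(z * (charSpeed ν : ℂ)).im| = |z.im| * charSpeed ν := by
        rw [Complex.im_mul_ofReal, abs_mul, abs_of_pos hk]
      have hnorm : ‖z * (charSpeed ν : ℂ)‖ = ‖z‖ * charSpeed ν := by
        rw [norm_mul, Complex.norm_real, Real.norm_of_nonneg hk.le]
      rw [him, hnorm] at h1
      have h2 : (charSpeed ν)⁻¹ ≤ C₁ * (2 * (1 - rho ν ^ 2) / rho ν) := by
        rw [charSpeed_eq (Ioo_subset_Ico_self hν'), mul_inv, mul_comm]
        have h3 := hC₁ ν ⟨hν.1.le, hν.2.le⟩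
        rw [abs_of_pos (inv_pos.2 hkap)] at h3
        refine mul_le_mul h3 ?_ (inv_pos.2 hp).le hC₁0.le
        rw [inv_eq_one_div]
        gcongr
        linarith
      rw [norm_mul, Complex.norm_real, Real.norm_eq_abs]
      calc |2 * source (rho ν ^ 2)| * ‖csinc (z * (charSpeed ν : ℂ))‖
          ≤ M * (Real.exp (|z.im| * charSpeed ν) / (‖z‖ * charSpeed ν)) := by
            gcongr
            exact hM ν ⟨hν.1.le, hν.2.le⟩
        _ = M * Real.exp (|z.im| * charSpeed ν) / ‖z‖ * (charSpeed ν)⁻¹ := by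
            field_simp
        _ ≤ M * Real.exp (|z.im| * charSpeed ν) / ‖z‖ *
            (C₁ * (2 * (1 - rho ν ^ 2) / rho ν)) := by gcongr
        _ = _ := by ring
  refine ⟨M + M * C₁ + M * C₁ * C₂, by positivity, fun ν hν => ⟨fun z hz => ?_, fun ξ => ?_⟩⟩
  · have hν' := hin ν hν
    have hz0 : 0 < ‖z‖ := norm_pos_iff.2 hz
    obtain ⟨h1, h2⟩ := hcomplex z hz ν hν
    have hp := rho_pos hν'
    have hr1 := rho_le_one (Ioo_subset_Ico_self hν')
    have hσ := rho_sq_lt (Ioo_subset_Ico_self hν')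
    have hs := sonic_pos hσ
    have hsi := hC₂ ν ⟨hν.1.le, hν.2.le⟩
    rw [abs_of_pos (inv_pos.2 hs)] at hsi
    have hX := Real.exp_pos (|z.im| * charSpeed ν)
    have hr2 : rho ν ^ 2 ≤ 1 := pow_le_one₀ hp.le hr1
    constructor
    · refine h1.trans ?_
      rw [show Real.exp (|z.im| * charSpeed ν) * (M * C₁ / ‖z‖ * rho ν ^ 2) =
        (M * C₁ * rho ν ^ 2) * Real.exp (|z.im| * charSpeed ν) / ‖z‖ by ring]
      gcongr
      have : 0 < M * C₁ * C₂ := by positivity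
      have : 0 < M * C₁ := by positivity
      nlinarith
    · have h3 : ‖remSol z ν‖ ≤ (M * C₁ * (sonic (rho ν ^ 2))⁻¹ * rho ν ^ 4) *
          Real.exp (|z.im| * charSpeed ν) / ‖z‖ ^ 2 := by
        have h4 := mul_le_mul_of_nonneg_left h2
          (show 0 ≤ rho ν ^ 2 * (sonic (rho ν ^ 2))⁻¹ / ‖z‖ by positivity)
        refine le_trans (le_of_eq ?_) (h4.trans (le_of_eq ?_))
        · field_simp
        · field_simp
      have hr4 : rho ν ^ 4 ≤ rho ν := pow_le_of_le_one hp.le hr1 (by norm_num)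
      have e1 : M * C₁ * (sonic (rho ν ^ 2))⁻¹ * rho ν ^ 4 ≤ M * C₁ * C₂ * rho ν := by gcongr
      have e0 : 0 < (M + M * C₁) * rho ν := by positivity
      have e2 : M * C₁ * (sonic (rho ν ^ 2))⁻¹ * rho ν ^ 4 ≤
          (M + M * C₁ + M * C₁ * C₂) * rho ν := by linarith
      exact h3.trans (div_le_div_of_nonneg_right (mul_le_mul_of_nonneg_right e2 hX.le)
        (sq_nonneg _))
  · have hle : M ≤ M + M * C₁ + M * C₁ * C₂ := by
      have : 0 < M * C₁ * C₂ := by positivity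
      have : 0 < M * C₁ := by positivity
      linarith
    refine ⟨(hreal ν hν ξ).trans hle, ?_⟩
    have := norm_le_mul_of_norm_deriv_le (fun μ hμ => hasDerivAt_remSol ξ (hin μ hμ))
      (tendsto_remSol ξ) hM0.le (fun μ hμ => hreal μ hμ ξ) ν hν
    have hν' := Ioo_subset_Ico_self (hin ν hν)
    have hνρ : ν ≤ rho ν := (nu_le_rho_cube hν').trans
      (pow_le_of_le_one (rho_nonneg hν') (rho_le_one hν') (by norm_num))
    exact this.trans (mul_le_mul hle hνρ hν.1.le (hM0.le.trans hle))

/-! ### Decay and support of the remainder -/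

lemma continuous_remSol_freq {ν : ℝ} (hν : ν ∈ Ico 0 nuCr) :
    Continuous (fun ξ : ℝ => remSol ξ ν) :=
  (differentiable_evenSeries isEntireMajorized_seriesCoeff hν).continuous.comp
    Complex.continuous_ofReal

lemma continuous_remSol1_freq {ν : ℝ} (hν : ν ∈ Ico 0 nuCr) :
    Continuous (fun ξ : ℝ => remSol1 ξ ν) :=
  (differentiable_evenSeries isEntireMajorized_seriesCoeff1 hν).continuous.comp
    Complex.continuous_ofReal

lemma continuous_remainderTransform {ν : ℝ} (hν : ν ∈ Ico 0 nuCr) :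
    Continuous (fun ξ => remainderTransform ξ ν) := by
  simp_rw [remainderTransform_eq _ hν]
  exact Complex.continuous_re.comp (continuous_remSol_freq hν)

/-- The bounds at low and high frequency are merged. The transform is integrable in $\xi$; its
$\nu$-derivative is only known to be $O(1/|\xi|)$, and the missing decay must come from the test
function. -/
lemma remSol_real_bounds {νs : ℝ} (hνs : νs ∈ Ioo 0 nuCr) : ∃ C, 0 < C ∧ ∀ ν ∈ Ioo 0 νs,
    ∀ ξ : ℝ, |remainderTransform ξ ν| ≤ C * rho ν * (1 + ξ ^ 2)⁻¹ ∧
      (|(remSol1 ξ ν).re| ≤ C ∧ |ξ| * |(remSol1 ξ ν).re| ≤ C) := by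
  obtain ⟨C, hC, hb⟩ := remSol_bounds hνs
  refine ⟨2 * C, by positivity, fun ν hν ξ => ?_⟩
  have hν' : ν ∈ Ioo 0 nuCr := ⟨hν.1, hν.2.trans hνs.2⟩
  have hp := rho_pos hν'
  obtain ⟨hc, hr⟩ := hb ν hν
  obtain ⟨h1, h2⟩ := hr ξ
  have e : ‖remSol ξ ν‖ = |remainderTransform ξ ν| := by
    rw [← ofReal_remainderTransform ξ (Ioo_subset_Ico_self hν'), Complex.norm_real,
      Real.norm_eq_abs]
  have e1 : |(remSol1 ξ ν).re| ≤ ‖remSol1 ξ ν‖ := Complex.abs_re_le_norm _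
  rw [e] at h2
  have h3 : ξ ^ 2 * |remainderTransform ξ ν| ≤ C * rho ν ∧ |ξ| * |(remSol1 ξ ν).re| ≤ C := by
    by_cases hξ : ξ = 0
    · subst hξ
      simp only [ne_eq, OfNat.ofNat_ne_zero, not_false_eq_true, zero_pow, zero_mul, abs_zero]
      exact ⟨by positivity, hC.le⟩
    · obtain ⟨h4, h5⟩ := hc ξ (by exact_mod_cast hξ)
      have hξ0 : 0 < |ξ| := abs_pos.2 hξ
      rw [e] at h5
      rw [Complex.ofReal_im, abs_zero, zero_mul, Real.exp_zero, mul_one, Complex.norm_real,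
        Real.norm_eq_abs, le_div_iff₀ (by positivity)] at h4 h5
      rw [sq_abs] at h5
      constructor
      · linarith
      · nlinarith
  refine ⟨?_, (e1.trans h1).trans (by linarith),
    h3.2.trans (by linarith)⟩
  rw [← div_eq_mul_inv, le_div_iff₀ (by positivity)]
  nlinarith [h3.1]

lemma integrable_remainderTransform {ν : ℝ} (hν : ν ∈ Ioo 0 nuCr) :
    Integrable (fun ξ => remainderTransform ξ ν) := by
  obtain ⟨νs, h1, h2⟩ := exists_between hν.2
  obtain ⟨C, hC, hb⟩ := remSol_real_bounds ⟨hν.1.trans h1, h2⟩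
  exact (integrable_inv_one_add_sq.const_mul (C * rho ν)).mono'
    (continuous_remainderTransform (Ioo_subset_Ico_self hν)).aestronglyMeasurable
    (Eventually.of_forall fun ξ => (hb ν ⟨hν.1, h1⟩ ξ).1)

lemma integrable_remSol_mul_exp {ν : ℝ} (hν : ν ∈ Ioo 0 nuCr) (s : ℝ) :
    Integrable (fun ξ : ℝ => remSol ξ ν * Complex.exp (Complex.I * ξ * s)) := by
  refine (integrable_remainderTransform hν).mono
    (((continuous_remSol_freq (Ioo_subset_Ico_self hν)).mul (by fun_prop)).aestronglyMeasurable)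
    (Eventually.of_forall fun ξ => ?_)
  rw [norm_mul, ← ofReal_remainderTransform ξ (Ioo_subset_Ico_self hν), Complex.norm_real,
    Complex.norm_exp]
  simp

/-- Paley–Wiener argument: for $s\ge k$ the factor $e^{izs}$ beats the growth $e^{k\,\mathrm{Im} z}$
in the upper half plane, so the integrand is $O(|z|^{-2})$ there and the contour can be pushed to
infinity. -/
lemma integral_remSol_mul_exp {ν s : ℝ} (hν : ν ∈ Ioo 0 nuCr) (hs : charSpeed ν ≤ s) :
    ∫ ξ : ℝ, remSol ξ ν * Complex.exp (Complex.I * ξ * s) = 0 := by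
  obtain ⟨νs, h1, h2⟩ := exists_between hν.2
  obtain ⟨C, hC, hb⟩ := remSol_bounds ⟨hν.1.trans h1, h2⟩
  have hc : ∀ z : ℂ, z ≠ 0 →
      ‖remSol z ν‖ ≤ C * Real.exp (|z.im| * charSpeed ν) / ‖z‖ ^ 2 := by
    intro z hz
    refine ((hb ν ⟨hν.1, h1⟩).1 z hz).2.trans ?_
    gcongr
    exact mul_le_of_le_one_right hC.le (rho_le_one (Ioo_subset_Ico_self hν))
  set F : ℂ → ℂ := fun z => remSol z ν * Complex.exp (Complex.I * z * s) with hF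
  have hdiff : Differentiable ℂ F :=
    (differentiable_evenSeries isEntireMajorized_seriesCoeff (Ioo_subset_Ico_self hν)).mul
      (by fun_prop)
  have hbound : ∀ R : ℝ, 0 < R → ∀ z : ℂ, 0 ≤ z.im → R ≤ ‖z‖ → ‖F z‖ ≤ C / R ^ 2 := by
    intro R hR z hz hzR
    have hz0 : 0 < ‖z‖ := hR.trans_le hzR
    have h3 := hc z (norm_pos_iff.1 hz0)
    have hre : (Complex.I * z * s).re = -(z.im * s) := by simp
    rw [hF]
    simp only
    rw [norm_mul, Complex.norm_exp, hre]
    calc ‖remSol z ν‖ * Real.exp (-(z.im * s))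
        ≤ C * Real.exp (|z.im| * charSpeed ν) / ‖z‖ ^ 2 * Real.exp (-(z.im * s)) := by gcongr
      _ = C * Real.exp (z.im * (charSpeed ν - s)) / ‖z‖ ^ 2 := by
          rw [abs_of_nonneg hz, show z.im * (charSpeed ν - s) =
            z.im * charSpeed ν + -(z.im * s) by ring, Real.exp_add]
          ring
      _ ≤ C * 1 / R ^ 2 := by
          gcongr
          rw [Real.exp_le_one_iff]
          nlinarith
      _ = C / R ^ 2 := by rw [mul_one]
  -- Cauchy's theorem on $[-R,R]\times[0,R]$: the three other sides have total length $4R$ and the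
  -- integrand is at most $C/R^2$ on them.
  have hrect : ∀ R : ℝ, 0 < R → ‖∫ ξ in (-R)..R, F ξ‖ ≤ 4 * C / R := by
    intro R hR
    have h := Complex.integral_boundary_rect_eq_zero_of_differentiableOn F (-R : ℂ)
      (R + R * Complex.I) hdiff.differentiableOn
    simp only [Complex.neg_re, Complex.neg_im, Complex.add_re, Complex.add_im, Complex.mul_re,
      Complex.mul_im, Complex.ofReal_re, Complex.ofReal_im, Complex.I_re, Complex.I_im, mul_zero,
      mul_one, neg_zero, sub_zero, add_zero, zero_add, zero_mul, Complex.ofReal_zero, smul_eq_mul,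
      Complex.ofReal_neg] at h
    have t1 : ‖∫ x in (-R)..R, F (x + R * Complex.I)‖ ≤ C / R ^ 2 * |R - -R| := by
      refine intervalIntegral.norm_integral_le_of_norm_le_const fun x _ => ?_
      have him : ((x : ℂ) + R * Complex.I).im = R := by simp
      refine hbound R hR _ (by rw [him]; exact hR.le) ?_
      have := Complex.abs_im_le_norm ((x : ℂ) + R * Complex.I)
      rw [him] at this
      exact (le_abs_self R).trans this
    have t2 : ∀ a : ℝ, |a| = R → ‖∫ y in (0 : ℝ)..R, F (a + y * Complex.I)‖ ≤ C / R ^ 2 * |R - 0| := by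
      intro a ha
      refine intervalIntegral.norm_integral_le_of_norm_le_const fun y hy => ?_
      rw [uIoc_of_le hR.le] at hy
      refine hbound R hR _ (by simpa using hy.1.le) ?_
      have := Complex.abs_re_le_norm ((a : ℂ) + y * Complex.I)
      simpa [ha] using this
    have t3 := t2 R (abs_of_pos hR)
    have t4 := t2 (-R) (by rw [abs_neg, abs_of_pos hR])
    rw [Complex.ofReal_neg] at t4
    have e : ∫ ξ in (-R)..R, F ξ = (∫ x in (-R)..R, F (x + R * Complex.I))
        - Complex.I * (∫ y in (0 : ℝ)..R, F (R + y * Complex.I))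
        + Complex.I * ∫ y in (0 : ℝ)..R, F (-R + y * Complex.I) := by
      linear_combination h
    rw [e]
    refine (norm_add_le _ _).trans ((add_le_add_left (norm_sub_le _ _) _).trans ?_)
    rw [norm_mul, norm_mul, Complex.norm_I, one_mul, one_mul]
    rw [sub_neg_eq_add, abs_of_pos (by linarith)] at t1
    rw [sub_zero, abs_of_pos hR] at t3 t4
    have : C / R ^ 2 * (R + R) + C / R ^ 2 * R + C / R ^ 2 * R = 4 * C / R := by
      field_simp
      ring
    linarith
  have hlim : Tendsto (fun R : ℝ => ∫ ξ in (-R)..R, F ξ) atTop (𝓝 (∫ ξ : ℝ, F ξ)) :=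
    intervalIntegral_tendsto_integral (integrable_remSol_mul_exp hν s) tendsto_neg_atTop_atBot
      tendsto_id
  have hlim0 : Tendsto (fun R : ℝ => ∫ ξ in (-R)..R, F ξ) atTop (𝓝 0) := by
    refine squeeze_zero_norm' ?_ (tendsto_const_nhds.div_atTop tendsto_id : Tendsto
      (fun R : ℝ => 4 * C / R) atTop (𝓝 0))
    filter_upwards [eventually_gt_atTop 0] with R hR using hrect R hR
  exact tendsto_nhds_unique hlim hlim0

lemma remainder_eq_zero {ν s : ℝ} (hν : ν ∈ Ioo 0 nuCr) (hs : charSpeed ν ≤ |s|) :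
    remainder ν s = 0 := by
  have h := integral_remSol_mul_exp hν hs
  have hint := integrable_remSol_mul_exp hν |s|
  have h2 := Complex.reCLM.integral_comp_comm hint
  rw [h, map_zero] at h2
  rw [remainder, mul_eq_zero]
  right
  rw [← h2]
  refine integral_congr_ae (Eventually.of_forall fun ξ => ?_)
  have e : Complex.I * ξ * (|s| : ℝ) = ((ξ * |s| : ℝ) : ℂ) * Complex.I := by push_cast; ring
  have hcos : Real.cos (ξ * |s|) = Real.cos (ξ * s) := by
    rcases abs_choice s with h | h <;> rw [h]
    rw [mul_neg, Real.cos_neg]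
  simp only [Complex.reCLM_apply]
  rw [e, ← ofReal_remainderTransform ξ (Ioo_subset_Ico_self hν), Complex.re_ofReal_mul,
    Complex.exp_ofReal_mul_I_re, hcos]

/-! ### Pairing of the remainder with test functions -/

/-- Cosine transform of the restriction of `ψ` to `[-K, K]`. -/
def cosTransform (K : ℝ) (ψ : ℝ → ℝ) (ξ : ℝ) : ℝ := ∫ s in (-K)..K, Real.cos (ξ * s) * ψ s

lemma continuous_cosTransform (K : ℝ) {ψ : ℝ → ℝ} (hψ : Continuous ψ) :
    Continuous (cosTransform K ψ) :=
  intervalIntegral.continuous_parametric_intervalIntegral_of_continuous' (by fun_prop) _ _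

lemma abs_cosTransform_le {K B : ℝ} (hK : 0 ≤ K) {ψ : ℝ → ℝ}
    (hB : ∀ s ∈ Icc (-K) K, |ψ s| ≤ B) (ξ : ℝ) : |cosTransform K ψ ξ| ≤ 2 * K * B := by
  have := intervalIntegral.norm_integral_le_of_norm_le_const (a := -K) (b := K)
    (f := fun s => Real.cos (ξ * s) * ψ s) (C := B) fun s hs => by
      rw [uIoc_of_le (by linarith)] at hs
      have h1 := hB s ⟨hs.1.le, hs.2⟩
      rw [norm_mul, Real.norm_eq_abs, Real.norm_eq_abs]
      calc |Real.cos (ξ * s)| * |ψ s| ≤ 1 * |ψ s| := by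
            gcongr; exact Real.abs_cos_le_one _
        _ ≤ B := by linarith
  rw [Real.norm_eq_abs, sub_neg_eq_add, abs_of_nonneg (by linarith : 0 ≤ K + K)] at this
  rw [cosTransform]
  linarith

/-- Integration by parts; the boundary terms contribute $2B$ and the remaining integral $2KB$. -/
lemma abs_mul_cosTransform_le {K B : ℝ} (hK : 0 ≤ K) {ψ : ℝ → ℝ} (hψ : ContDiff ℝ 1 ψ)
    (hB : ∀ s ∈ Icc (-K) K, |ψ s| ≤ B) (hB' : ∀ s ∈ Icc (-K) K, |deriv ψ s| ≤ B) (ξ : ℝ) :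
    |ξ| * |cosTransform K ψ ξ| ≤ (2 + 2 * K) * B := by
  have hd : ∀ s, HasDerivAt ψ (deriv ψ s) s := fun s =>
    (hψ.differentiable (by simp) s).hasDerivAt
  have hc : Continuous (deriv ψ) := hψ.continuous_deriv (by simp)
  have hsin : ∀ s, HasDerivAt (fun s => Real.sin (ξ * s)) (Real.cos (ξ * s) * ξ) s := by
    intro s
    have h1 : HasDerivAt (fun s : ℝ => ξ * s) ξ s := by
      simpa using (hasDerivAt_id s).const_mul ξ
    exact h1.sin
  have hparts := intervalIntegral.integral_mul_deriv_eq_deriv_mul (a := -K) (b := K)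
    (u := ψ) (u' := deriv ψ) (v := fun s => Real.sin (ξ * s)) (v' := fun s => Real.cos (ξ * s) * ξ)
    (fun s _ => hd s) (fun s _ => hsin s) (hc.intervalIntegrable _ _)
    (Continuous.intervalIntegrable (by fun_prop) _ _)
  have e : ξ * cosTransform K ψ ξ = ∫ s in (-K)..K, ψ s * (Real.cos (ξ * s) * ξ) := by
    rw [cosTransform, ← intervalIntegral.integral_const_mul]
    congr 1
    funext s
    ring
  have hrem : |∫ s in (-K)..K, deriv ψ s * Real.sin (ξ * s)| ≤ 2 * K * B := by
    have := intervalIntegral.norm_integral_le_of_norm_le_const (a := -K) (b := K)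
      (f := fun s => deriv ψ s * Real.sin (ξ * s)) (C := B) fun s hs => by
        rw [uIoc_of_le (by linarith)] at hs
        have h1 := hB' s ⟨hs.1.le, hs.2⟩
        rw [norm_mul, Real.norm_eq_abs, Real.norm_eq_abs]
        calc |deriv ψ s| * |Real.sin (ξ * s)| ≤ |deriv ψ s| * 1 := by
              gcongr; exact Real.abs_sin_le_one _
          _ ≤ B := by linarith
    rw [Real.norm_eq_abs, sub_neg_eq_add, abs_of_nonneg (by linarith : 0 ≤ K + K)] at this
    linarith
  have hbd : ∀ s ∈ Icc (-K) K, |ψ s * Real.sin (ξ * s)| ≤ B := by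
    intro s hs
    rw [abs_mul]
    calc |ψ s| * |Real.sin (ξ * s)| ≤ |ψ s| * 1 := by gcongr; exact Real.abs_sin_le_one _
      _ ≤ B := by linarith [hB s hs]
  have b1 := hbd K ⟨by linarith, le_rfl⟩
  have b2 := hbd (-K) ⟨le_rfl, by linarith⟩
  rw [← abs_mul, e, hparts]
  rw [abs_le] at *
  constructor <;> linarith [b1.1, b1.2, b2.1, b2.2, hrem.1, hrem.2]

/-- Fubini, after the support property has reduced the pairing to $[-K,K]$. With a window
independent of $\nu$, only the transform depends on $\nu$ and can be differentiated under the
integral. -/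
lemma integral_remainder_mul {ν K : ℝ} (hν : ν ∈ Ioo 0 nuCr) (hK : charSpeed ν ≤ K) {ψ : ℝ → ℝ}
    (hψ : Continuous ψ) :
    ∫ s, remainder ν s * ψ s =
      (2 * Real.pi)⁻¹ * ∫ ξ, remainderTransform ξ ν * cosTransform K ψ ξ := by
  have hk := charSpeed_pos hν
  have hK0 : -K ≤ K := by linarith
  have h1 : ∫ s, remainder ν s * ψ s = ∫ s in (-K)..K, remainder ν s * ψ s := by
    rw [intervalIntegral.integral_of_le hK0, ← setIntegral_eq_integral_of_forall_compl_eq_zero]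
    intro s hs
    rw [remainder_eq_zero hν, zero_mul]
    by_contra! h
    have := abs_lt.1 (h.trans_le hK)
    exact hs ⟨this.1, this.2.le⟩
  have hint : Integrable (fun p : ℝ × ℝ =>
      remainderTransform p.2 ν * Real.cos (p.2 * p.1) * ψ p.1)
      ((volume.restrict (Ioc (-K) K)).prod volume) := by
    have hψi : Integrable ψ (volume.restrict (Ioc (-K) K)) :=
      (hψ.intervalIntegrable (-K) K).1
    have h2 := hψi.mul_prod (integrable_remainderTransform hν)
    have h3 := h2.bdd_mul (c := 1) (f := fun p : ℝ × ℝ => Real.cos (p.2 * p.1))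
      (by fun_prop) (Eventually.of_forall fun p => Real.abs_cos_le_one _)
    refine h3.congr (Eventually.of_forall fun p => ?_)
    ring
  rw [h1, intervalIntegral.integral_of_le hK0]
  have h4 : ∀ s, remainder ν s * ψ s =
      (2 * Real.pi)⁻¹ * ∫ ξ, remainderTransform ξ ν * Real.cos (ξ * s) * ψ s := by
    intro s
    rw [remainder, integral_mul_const, mul_assoc]
  simp_rw [h4]
  rw [integral_const_mul, integral_integral_swap hint]
  congr 2
  funext ξ
  rw [cosTransform, intervalIntegral.integral_of_le hK0, ← integral_const_mul]
  congr 1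
  funext s
  ring

lemma abs_integral_inv_one_add_sq_le {f : ℝ → ℝ} {D : ℝ} (hf : ∀ ξ : ℝ, |f ξ| ≤ D * (1 + ξ ^ 2)⁻¹) :
    |(2 * Real.pi)⁻¹ * ∫ ξ, f ξ| ≤ D := by
  have h := norm_integral_le_of_norm_le (integrable_inv_one_add_sq.const_mul D)
    (Eventually.of_forall fun ξ => (Real.norm_eq_abs (f ξ)).trans_le (hf ξ))
  rw [integral_const_mul, integral_univ_inv_one_add_sq, Real.norm_eq_abs] at h
  have hpi := Real.pi_pos
  have hD : 0 ≤ D := by simpa using (abs_nonneg _).trans (hf 0)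
  rw [abs_mul, abs_of_pos (by positivity), ← div_eq_inv_mul, div_le_iff₀ (by positivity)]
  nlinarith [mul_nonneg hD hpi.le]

/-- The pairing of the remainder with `ψ` is differentiable in `ν`, with bounds. -/
theorem remainder_pairing {νs : ℝ} (hνs : νs ∈ Ioo 0 nuCr) : ∃ K C, 0 < K ∧ 0 < C ∧
    (∀ ν ∈ Ioo 0 νs, charSpeed ν ≤ K) ∧
    ∀ ψ : ℝ → ℝ, ContDiff ℝ 1 ψ → ∀ B, (∀ s ∈ Icc (-K) K, |ψ s| ≤ B) →
      (∀ s ∈ Icc (-K) K, |deriv ψ s| ≤ B) → ∀ ν ∈ Ioo 0 νs,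
      DifferentiableAt ℝ (fun μ => ∫ s, remainder μ s * ψ s) ν ∧
      |deriv (fun μ => ∫ s, remainder μ s * ψ s) ν| ≤ C * B ∧
      |∫ s, remainder ν s * ψ s| ≤ C * B * rho ν := by
  obtain ⟨C, hC, hb⟩ := remSol_real_bounds hνs
  obtain ⟨K, hK, hKb⟩ := exists_bound_comp_rho_sq contDiffOn_speedRatio.continuousOn hνs.2
  have hin : ∀ ν ∈ Ioo 0 νs, ν ∈ Ioo 0 nuCr := fun ν hν => ⟨hν.1, hν.2.trans hνs.2⟩
  have hkK : ∀ ν ∈ Ioo 0 νs, charSpeed ν ≤ K := by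
    intro ν hν
    have hν' := Ioo_subset_Ico_self (hin ν hν)
    rw [charSpeed_eq hν']
    have h1 := (le_abs_self _).trans (hKb ν ⟨hν.1.le, hν.2.le⟩)
    have h2 := speedRatio_pos (rho_sq_lt hν')
    nlinarith [rho_le_one hν', rho_nonneg hν']
  refine ⟨K, C * (2 + 4 * K), hK, by positivity, hkK, fun ψ hψ B hB hB' ν hν => ?_⟩
  have hB0 : 0 ≤ B := (abs_nonneg _).trans (hB 0 ⟨by linarith, hK.le⟩)
  have hcos := abs_cosTransform_le hK.le hB
  have hcos' := abs_mul_cosTransform_le hK.le hψ hB hB'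
  have hν' := hin ν hν
  have hcc := continuous_cosTransform K hψ.continuous
  -- $\hat h_\nu$ and the cosine transform each decay like $1/|\xi|$, and the product is integrable.
  -- The constant is $2K+(2+2K)$, from the bounds without and with the factor $\xi^2$.
  have hdom : ∀ μ ∈ Ioo 0 νs, ∀ ξ : ℝ, ‖(remSol1 ξ μ).re * cosTransform K ψ ξ‖ ≤
      C * (2 + 4 * K) * B * (1 + ξ ^ 2)⁻¹ := by
    intro μ hμ ξ
    obtain ⟨-, b1, b2⟩ := hb μ hμ ξ
    have p1 := mul_le_mul b1 (hcos ξ) (abs_nonneg _) hC.le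
    have p2 := mul_le_mul b2 (hcos' ξ) (by positivity) hC.le
    rw [← div_eq_mul_inv, le_div_iff₀ (by positivity), Real.norm_eq_abs, abs_mul]
    have : |(remSol1 ξ μ).re| * |cosTransform K ψ ξ| * (1 + ξ ^ 2) =
        |(remSol1 ξ μ).re| * |cosTransform K ψ ξ| +
        |ξ| * |(remSol1 ξ μ).re| * (|ξ| * |cosTransform K ψ ξ|) := by
      rw [← sq_abs ξ]
      ring
    rw [this]
    linarith
  have hmain := hasDerivAt_integral_of_dominated_loc_of_deriv_le (μ := volume) (x₀ := ν)
    (F := fun μ (ξ : ℝ) => (remSol ξ μ).re * cosTransform K ψ ξ)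
    (F' := fun μ (ξ : ℝ) => (remSol1 ξ μ).re * cosTransform K ψ ξ)
    (bound := fun ξ : ℝ => C * (2 + 4 * K) * B * (1 + ξ ^ 2)⁻¹)
    (s := Ioo 0 νs) (Ioo_mem_nhds hν.1 hν.2)
    (by
      filter_upwards [Ioo_mem_nhds hν.1 hν.2] with μ hμ
      exact ((Complex.continuous_re.comp (continuous_remSol_freq
        (Ioo_subset_Ico_self (hin μ hμ)))).mul hcc).aestronglyMeasurable)
    (by
      have := (integrable_remainderTransform hν').mul_bdd (c := 2 * K * B)
        (g := cosTransform K ψ) hcc.aestronglyMeasurable (Eventually.of_forall hcos)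
      refine this.congr (Eventually.of_forall fun ξ => ?_)
      simp only
      rw [remainderTransform_eq _ (Ioo_subset_Ico_self hν')])
    (((Complex.continuous_re.comp (continuous_remSol1_freq
        (Ioo_subset_Ico_self hν'))).mul hcc).aestronglyMeasurable)
    (Eventually.of_forall fun ξ μ hμ => hdom μ hμ ξ)
    (integrable_inv_one_add_sq.const_mul _)
    (Eventually.of_forall fun ξ μ hμ =>
      (HasDerivAt.re_of_complex (hasDerivAt_remSol ξ (hin μ hμ))).mul_const _)
  have hd := (hmain.2.const_mul (2 * Real.pi)⁻¹).congr_of_eventuallyEq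
    (f₁ := fun μ => ∫ s, remainder μ s * ψ s) (by
      filter_upwards [Ioo_mem_nhds hν.1 hν.2] with μ hμ
      rw [integral_remainder_mul (hin μ hμ) (hkK μ hμ) hψ.continuous]
      simp_rw [remainderTransform_eq _ (Ioo_subset_Ico_self (hin μ hμ))])
  refine ⟨hd.differentiableAt, ?_, ?_⟩
  · rw [hd.deriv]
    exact abs_integral_inv_one_add_sq_le (hdom ν hν)
  · rw [integral_remainder_mul hν' (hkK ν hν) hψ.continuous]
    refine abs_integral_inv_one_add_sq_le fun ξ => ?_
    rw [abs_mul]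
    calc |remainderTransform ξ ν| * |cosTransform K ψ ξ|
        ≤ (C * rho ν * (1 + ξ ^ 2)⁻¹) * (2 * K * B) := by
          gcongr
          · exact mul_nonneg (mul_nonneg hC.le (rho_pos hν').le) (by positivity)
          · exact (hb ν hν ξ).1
          · exact hcos ξ
      _ = C * (2 * K) * B * rho ν * (1 + ξ ^ 2)⁻¹ := by ring
      _ ≤ C * (2 + 4 * K) * B * rho ν * (1 + ξ ^ 2)⁻¹ := by
          gcongr
          · exact (rho_pos hν').le
          · linarith

/-! ### The singular part of the kernel -/

/-- The symmetrized `n`-th derivative of a test function. -/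
def symJet (n : ℕ) (ψ : ℝ → ℝ) (x : ℝ) : ℝ :=
  iteratedDeriv n ψ x + (-1) ^ n * iteratedDeriv n ψ (-x)

lemma hasDerivAt_iteratedDeriv {ψ : ℝ → ℝ} (hψ : ContDiff ℝ ∞ ψ) (n : ℕ) (x : ℝ) :
    HasDerivAt (iteratedDeriv n ψ) (iteratedDeriv (n + 1) ψ x) x := by
  rw [iteratedDeriv_succ]
  exact (hψ.differentiable_iteratedDeriv n (by exact_mod_cast ENat.natCast_lt_top n) x).hasDerivAt

/-- The sign $(-1)^n$ in the definition is the one produced by differentiating at $-x$, so the jets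
are closed under differentiation. -/
lemma hasDerivAt_symJet {ψ : ℝ → ℝ} (hψ : ContDiff ℝ ∞ ψ) (n : ℕ) (x : ℝ) :
    HasDerivAt (symJet n ψ) (symJet (n + 1) ψ x) x := by
  have h1 := hasDerivAt_iteratedDeriv hψ n x
  have h2 := (hasDerivAt_iteratedDeriv hψ n (-x)).comp x (hasDerivAt_neg x)
  refine (h1.add (h2.const_mul ((-1) ^ n))).congr_deriv ?_
  rw [symJet, pow_succ]
  ring

lemma hasDerivAt_G0 {ψ : ℝ → ℝ} (hψ : ContDiff ℝ ∞ ψ) (x : ℝ) :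
    HasDerivAt (fun x => G0 x ψ) (symJet 0 ψ x) x := by
  have hc := hψ.continuous
  have h1 : ∀ x, HasDerivAt (fun x => ∫ t in (0 : ℝ)..x, ψ t) (ψ x) x := fun x =>
    intervalIntegral.integral_hasDerivAt_right (hc.intervalIntegrable _ _)
      (hc.stronglyMeasurableAtFilter _ _) hc.continuousAt
  have h2 := (h1 (-x)).comp x (hasDerivAt_neg x)
  have e : (fun x => G0 x ψ) = fun x => (∫ t in (0 : ℝ)..x, ψ t) - ∫ t in (0 : ℝ)..(-x), ψ t := by
    funext x
    rw [G0, intervalIntegral.integral_interval_sub_left (hc.intervalIntegrable _ _)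
      (hc.intervalIntegrable _ _)]
  rw [e]
  refine ((h1 x).sub h2).congr_deriv ?_
  simp [symJet]

/-- The part of the kernel carried by `G₋₂`, `G₋₁`, `G₀`. -/
def singPart (ψ : ℝ → ℝ) (ν : ℝ) : ℝ :=
  coeff0 (rho ν ^ 2) / 4 * (symJet 0 ψ (charSpeed ν) - charSpeed ν * symJet 1 ψ (charSpeed ν))
    + coeff1 (rho ν ^ 2) / 2 * (charSpeed ν ^ 2 * symJet 0 ψ (charSpeed ν))
    + coeff2 (rho ν ^ 2) * (charSpeed ν ^ 3 * G0 (charSpeed ν) ψ)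

lemma kernelInterior_eq (ψ : ℝ → ℝ) {ν : ℝ} (hν : ν ∈ Ioo 0 nuCr) :
    kernelInterior ν ψ = singPart ψ ν + ∫ s, remainder ν s * ψ s := by
  have hk := (charSpeed_pos hν).ne'
  rw [kernelInterior, singPart, beta0_eq hν, beta1_eq hν, beta2_eq hν, Gneg2, Gneg1]
  simp only [symJet, iteratedDeriv_zero, iteratedDeriv_one, pow_zero, pow_one]
  congr 1
  field_simp
  ring

/-- `ϱ ∂_ν` of the singular part. -/
def rhoSingPartNu (ψ : ℝ → ℝ) (ν : ℝ) : ℝ :=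
  nuDeriv coeff0 (rho ν ^ 2) / 4 *
      (symJet 0 ψ (charSpeed ν) - charSpeed ν * symJet 1 ψ (charSpeed ν))
    - coeff0 (rho ν ^ 2) / 4 * (speedRatio (rho ν ^ 2) * sonic (rho ν ^ 2) *
      symJet 2 ψ (charSpeed ν))
    + nuDeriv coeff1 (rho ν ^ 2) / 2 * (charSpeed ν ^ 2 * symJet 0 ψ (charSpeed ν))
    + coeff1 (rho ν ^ 2) * speedRatio (rho ν ^ 2) * sonic (rho ν ^ 2) * symJet 0 ψ (charSpeed ν)
    + coeff1 (rho ν ^ 2) / 2 * speedRatio (rho ν ^ 2) * sonic (rho ν ^ 2) *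
      (charSpeed ν * symJet 1 ψ (charSpeed ν))
    + nuDeriv coeff2 (rho ν ^ 2) * (charSpeed ν ^ 3 * G0 (charSpeed ν) ψ)
    + 3 * coeff2 (rho ν ^ 2) * speedRatio (rho ν ^ 2) * sonic (rho ν ^ 2) *
      (charSpeed ν * G0 (charSpeed ν) ψ)
    + coeff2 (rho ν ^ 2) * speedRatio (rho ν ^ 2) * sonic (rho ν ^ 2) *
      (charSpeed ν ^ 2 * symJet 0 ψ (charSpeed ν))

/-- Writing $u_n$ for `symJet n ψ`, the terms in $u_1$ cancel in $\frac{d}{dx}(u_0-xu_1)=-xu_2$; the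
surviving factor $\varrho kk'$ is bounded, so $\varrho H_\nu$ stays bounded although $k'$ does not.
-/
lemma hasDerivAt_singPart {ψ : ℝ → ℝ} (hψ : ContDiff ℝ ∞ ψ) {ν : ℝ} (hν : ν ∈ Ioo 0 nuCr) :
    HasDerivAt (singPart ψ) (rhoSingPartNu ψ ν / rho ν) ν := by
  have hp := (rho_pos hν).ne'
  have hk := hasDerivAt_charSpeed hν
  have b0 := hasDerivAt_of_eq_comp (b := fun ν => coeff0 (rho ν ^ 2)) contDiffOn_coeff0
    (fun _ _ => rfl) hν
  have b1 := hasDerivAt_of_eq_comp (b := fun ν => coeff1 (rho ν ^ 2)) contDiffOn_coeff1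
    (fun _ _ => rfl) hν
  have b2 := hasDerivAt_of_eq_comp (b := fun ν => coeff2 (rho ν ^ 2)) contDiffOn_coeff2
    (fun _ _ => rfl) hν
  have s0 : HasDerivAt (fun ν => symJet 0 ψ (charSpeed ν)) _ ν :=
    (hasDerivAt_symJet hψ 0 (charSpeed ν)).comp ν hk
  have s1 : HasDerivAt (fun ν => symJet 1 ψ (charSpeed ν)) _ ν :=
    (hasDerivAt_symJet hψ 1 (charSpeed ν)).comp ν hk
  have g : HasDerivAt (fun ν => G0 (charSpeed ν) ψ) _ ν :=
    (hasDerivAt_G0 hψ (charSpeed ν)).comp ν hk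
  have h := (((b0.div_const 4).mul (s0.sub (hk.mul s1))).add
    ((b1.div_const 2).mul ((hk.pow 2).mul s0))).add (b2.mul ((hk.pow 3).mul g))
  refine h.congr_deriv ?_
  simp only [Pi.mul_apply, Pi.pow_apply, Pi.sub_apply]
  rw [rhoSingPartNu]
  have hks := charSpeed_eq (Ioo_subset_Ico_self hν)
  generalize symJet 0 ψ (charSpeed ν) = u0
  generalize symJet (1 + 1) ψ (charSpeed ν) = u2
  generalize symJet 1 ψ (charSpeed ν) = u1
  generalize G0 (charSpeed ν) ψ = u3
  rw [hks]
  field_simp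
  norm_num
  ring

/-! ### Uniform bounds in terms of the test function -/

/-- The bounds are tracked through finitely many derivatives of $\psi$ on a fixed interval, which
makes them uniform over the translates $\varphi(s-\cdot)$. -/
def TestBound (K : ℝ) (N : ℕ) (ψ : ℝ → ℝ) (B : ℝ) : Prop :=
  ContDiff ℝ ∞ ψ ∧ ∀ i ≤ N, ∀ s ∈ Icc (-K) K, |iteratedDeriv i ψ s| ≤ B

/-- `T ψ ν` is bounded by `ϱ^n` times derivatives of `ψ` up to order `N` on `[-K, K]`. -/
def OBound (νs K : ℝ) (N n : ℕ) (T : (ℝ → ℝ) → ℝ → ℝ) : Prop :=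
  ∃ C, 0 < C ∧ ∀ ψ B, TestBound K N ψ B → ∀ ν ∈ Ioo 0 νs, |T ψ ν| ≤ C * B * rho ν ^ n

lemma TestBound.nonneg {K : ℝ} (hK : 0 < K) {N : ℕ} {ψ : ℝ → ℝ} {B : ℝ} (h : TestBound K N ψ B) :
    0 ≤ B := (abs_nonneg _).trans (h.2 0 (Nat.zero_le N) 0 ⟨by linarith, hK.le⟩)

section OBound

variable {νs K : ℝ} {N n : ℕ} {T T' : (ℝ → ℝ) → ℝ → ℝ}

lemma OBound.add (h : OBound νs K N n T) (h' : OBound νs K N n T') :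
    OBound νs K N n (fun ψ ν => T ψ ν + T' ψ ν) := by
  obtain ⟨C, hC, hb⟩ := h
  obtain ⟨C', hC', hb'⟩ := h'
  refine ⟨C + C', by positivity, fun ψ B hψ ν hν => (abs_add_le _ _).trans ?_⟩
  have := hb ψ B hψ ν hν
  have := hb' ψ B hψ ν hν
  linarith

lemma OBound.neg (h : OBound νs K N n T) : OBound νs K N n (fun ψ ν => -T ψ ν) := by
  obtain ⟨C, hC, hb⟩ := h
  exact ⟨C, hC, fun ψ B hψ ν hν => by rw [abs_neg]; exact hb ψ B hψ ν hν⟩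

lemma OBound.sub (h : OBound νs K N n T) (h' : OBound νs K N n T') :
    OBound νs K N n (fun ψ ν => T ψ ν - T' ψ ν) := by
  simpa [sub_eq_add_neg] using h.add h'.neg

lemma OBound.congr (h : OBound νs K N n T)
    (he : ∀ ψ, ContDiff ℝ ∞ ψ → ∀ ν ∈ Ioo 0 νs, T' ψ ν = T ψ ν) : OBound νs K N n T' := by
  obtain ⟨C, hC, hb⟩ := h
  exact ⟨C, hC, fun ψ B hψ ν hν => by rw [he ψ hψ.1 ν hν]; exact hb ψ B hψ ν hν⟩

lemma OBound.coeff_mul (hνs : νs < nuCr) (h : OBound νs K N n T) {F : ℝ → ℝ}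
    (hF : ContinuousOn F (Iio (1 / 2))) :
    OBound νs K N n (fun ψ ν => F (rho ν ^ 2) * T ψ ν) := by
  obtain ⟨C, hC, hb⟩ := h
  obtain ⟨C', hC', hb'⟩ := exists_bound_comp_rho_sq hF hνs
  refine ⟨C' * C, by positivity, fun ψ B hψ ν hν => ?_⟩
  rw [abs_mul]
  calc |F (rho ν ^ 2)| * |T ψ ν| ≤ C' * (C * B * rho ν ^ n) :=
        mul_le_mul (hb' ν ⟨hν.1.le, hν.2.le⟩) (hb ψ B hψ ν hν) (abs_nonneg _) hC'.le
    _ = C' * C * B * rho ν ^ n := by ring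

lemma OBound.rho_mul (hνs : νs < nuCr) (h : OBound νs K N n T) :
    OBound νs K N (n + 1) (fun ψ ν => rho ν * T ψ ν) := by
  obtain ⟨C, hC, hb⟩ := h
  refine ⟨C, hC, fun ψ B hψ ν hν => ?_⟩
  have hp := rho_pos ⟨hν.1, hν.2.trans hνs⟩
  rw [abs_mul, abs_of_pos hp]
  calc rho ν * |T ψ ν| ≤ rho ν * (C * B * rho ν ^ n) :=
        mul_le_mul_of_nonneg_left (hb ψ B hψ ν hν) hp.le
    _ = C * B * rho ν ^ (n + 1) := by ring

lemma OBound.of_le (hνs : νs < nuCr) (hK : 0 < K) {m : ℕ} (hmn : m ≤ n) (h : OBound νs K N n T) :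
    OBound νs K N m T := by
  obtain ⟨C, hC, hb⟩ := h
  refine ⟨C, hC, fun ψ B hψ ν hν => (hb ψ B hψ ν hν).trans ?_⟩
  have hν' : ν ∈ Ioo 0 nuCr := ⟨hν.1, hν.2.trans hνs⟩
  exact mul_le_mul_of_nonneg_left (pow_le_pow_of_le_one (rho_pos hν').le
    (rho_le_one (Ioo_subset_Ico_self hν')) hmn) (mul_nonneg hC.le (hψ.nonneg hK))

lemma OBound.charSpeed_mul (hνs : νs < nuCr) (h : OBound νs K N n T) :
    OBound νs K N (n + 1) (fun ψ ν => charSpeed ν * T ψ ν) := by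
  refine ((h.coeff_mul hνs contDiffOn_speedRatio.continuousOn).rho_mul hνs).congr
    fun ψ _ ν hν => ?_
  rw [charSpeed_eq ⟨hν.1.le, hν.2.trans hνs⟩]
  ring

lemma oBound_symJet (hνs : νs < nuCr) (hkK : ∀ ν ∈ Ioo 0 νs, charSpeed ν ≤ K) (i : ℕ)
    (hi : i ≤ N) : OBound νs K N 0 (fun ψ ν => symJet i ψ (charSpeed ν)) := by
  refine ⟨2, two_pos, fun ψ B hψ ν hν => ?_⟩
  have hk := charSpeed_pos ⟨hν.1, hν.2.trans hνs⟩
  have h1 := hψ.2 i hi (charSpeed ν) ⟨by linarith [hkK ν hν], hkK ν hν⟩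
  have h2 := hψ.2 i hi (-charSpeed ν) ⟨by linarith [hkK ν hν], by linarith [hkK ν hν]⟩
  simp only [symJet]
  refine (abs_add_le _ _).trans ?_
  rw [abs_mul, abs_pow, abs_neg, abs_one, one_pow, one_mul, pow_zero, mul_one]
  linarith

lemma oBound_G0 (hνs : νs < nuCr) (hkK : ∀ ν ∈ Ioo 0 νs, charSpeed ν ≤ K) (hK : 0 < K) :
    OBound νs K N 0 (fun ψ ν => G0 (charSpeed ν) ψ) := by
  refine ⟨2 * K, by positivity, fun ψ B hψ ν hν => ?_⟩
  have hk := charSpeed_pos ⟨hν.1, hν.2.trans hνs⟩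
  have hkK' := hkK ν hν
  have := intervalIntegral.norm_integral_le_of_norm_le_const (a := -charSpeed ν) (b := charSpeed ν)
    (f := ψ) (C := B) fun s hs => by
      rw [uIoc_of_le (by linarith)] at hs
      simpa using hψ.2 0 (Nat.zero_le N) s ⟨by linarith [hs.1], by linarith [hs.2]⟩
  rw [Real.norm_eq_abs, sub_neg_eq_add, abs_of_nonneg (by linarith : 0 ≤ charSpeed ν + charSpeed ν)]
    at this
  simp only [pow_zero, mul_one, G0]
  have hB := hψ.nonneg hK
  nlinarith

end OBound

lemma iteratedDeriv_iteratedDeriv_eq (i j : ℕ) (ψ : ℝ → ℝ) :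
    iteratedDeriv i (iteratedDeriv j ψ) = iteratedDeriv (i + j) ψ := by
  simp only [iteratedDeriv_eq_iterate, Function.iterate_add_apply]

lemma contDiff_iteratedDeriv {ψ : ℝ → ℝ} (hψ : ContDiff ℝ ∞ ψ) (j : ℕ) :
    ContDiff ℝ ∞ (iteratedDeriv j ψ) := by
  rw [iteratedDeriv_eq_iterate]
  exact hψ.iterate_deriv j

lemma TestBound.iteratedDeriv {K B : ℝ} {N j : ℕ} {ψ : ℝ → ℝ} (h : TestBound K (N + j) ψ B) :
    TestBound K N (iteratedDeriv j ψ) B := by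
  refine ⟨contDiff_iteratedDeriv h.1 j, fun i hi s hs => ?_⟩
  rw [iteratedDeriv_iteratedDeriv_eq]
  exact h.2 (i + j) (by omega) s hs

lemma OBound.comp_iteratedDeriv {νs K : ℝ} {N n : ℕ} {T : (ℝ → ℝ) → ℝ → ℝ}
    (h : OBound νs K N n T) (j : ℕ) :
    OBound νs K (N + j) n (fun ψ ν => T (iteratedDeriv j ψ) ν) := by
  obtain ⟨C, hC, hb⟩ := h
  exact ⟨C, hC, fun ψ B hψ ν hν => hb _ B hψ.iteratedDeriv ν hν⟩

lemma symJet_iteratedDeriv_two (n : ℕ) (ψ : ℝ → ℝ) (x : ℝ) :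
    symJet n (iteratedDeriv 2 ψ) x = symJet (n + 2) ψ x := by
  rw [symJet, symJet, iteratedDeriv_iteratedDeriv_eq, pow_add]
  norm_num

/-! ### Estimates for the kernel -/

section Estimates

variable {νs K : ℝ}

lemma oBound_singPart (hνs : νs < nuCr) (hkK : ∀ ν ∈ Ioo 0 νs, charSpeed ν ≤ K) (hK : 0 < K) :
    OBound νs K 1 0 singPart := by
  have j0 := oBound_symJet (N := 1) hνs hkK 0 (by norm_num)
  have j1 := (oBound_symJet (N := 1) hνs hkK 1 (by norm_num)).charSpeed_mul hνs
  have g := ((((oBound_G0 (N := 1) hνs hkK hK).charSpeed_mul hνs).charSpeed_mul hνs).charSpeed_mul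
    hνs).coeff_mul hνs contDiffOn_coeff2.continuousOn
  have e := (((j0.charSpeed_mul hνs).charSpeed_mul hνs).coeff_mul hνs
    (contDiffOn_coeff1.continuousOn.div_const 2))
  have a := (j0.sub (j1.of_le hνs hK (Nat.zero_le _))).coeff_mul hνs
    (contDiffOn_coeff0.continuousOn.div_const 4)
  refine ((a.add (e.of_le hνs hK (Nat.zero_le _))).add (g.of_le hνs hK (Nat.zero_le _))).congr
    fun ψ _ ν _ => ?_
  rw [singPart]
  ring

/-- The coefficients that multiply `ψ` and `ψ''` at leading order cancel at `ν = 0`. -/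
lemma exists_cancellation :
    (∃ E, ContinuousOn E (Iio (1 / 2)) ∧ ∀ σ < 1 / 2,
      nuDeriv coeff0 σ / 4 + coeff1 σ * speedRatio σ * sonic σ = σ * E σ) ∧
    ∃ E, ContinuousOn E (Iio (1 / 2)) ∧ ∀ σ < 1 / 2, 1 - speedRatio σ * sonic σ = σ * E σ := by
  have had : ∀ F : ℝ → ℝ, ContDiffOn ℝ ∞ F (Iio (1 / 2)) → F 0 = 0 →
      ∃ E, ContinuousOn E (Iio (1 / 2)) ∧ ∀ σ < 1 / 2, F σ = σ * E σ := by
    intro F hF h0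
    refine ⟨fun σ => 2 * avg 1 (deriv F) σ, continuousOn_const.mul
      (contDiffOn_avg 1 (contDiffOn_deriv_of_contDiffOn hF)).continuousOn, fun σ hσ => ?_⟩
    have := eq_add_mul_avg_deriv hF hσ
    rwa [h0, zero_add] at this
  constructor
  · refine had (fun σ => nuDeriv coeff0 σ / 4 + coeff1 σ * speedRatio σ * sonic σ)
      (((contDiffOn_nuDeriv contDiffOn_coeff0).div_const 4).add
        ((contDiffOn_coeff1.mul contDiffOn_speedRatio).mul contDiffOn_sonic)) ?_
    simp only [coeff1_zero, speedRatio_zero, sonic_zero]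
    ring
  · refine had (fun σ => 1 - speedRatio σ * sonic σ)
      (contDiffOn_const.sub (contDiffOn_speedRatio.mul contDiffOn_sonic)) ?_
    simp [speedRatio_zero, sonic_zero]

/-- The terms in $u_0$ and $u_2$ without a factor $k$ have the coefficients of
`exists_cancellation`, hence are $O(\varrho^2)$. All others carry at least one factor
$k=O(\varrho)$. Third derivatives enter through $k\,u_1$ evaluated at $\psi''$. -/
lemma oBound_rhoSingPartNu_add (hνs : νs < nuCr) (hkK : ∀ ν ∈ Ioo 0 νs, charSpeed ν ≤ K)
    (hK : 0 < K) :
    OBound νs K 3 1 (fun ψ ν => rhoSingPartNu ψ ν + singPart (iteratedDeriv 2 ψ) ν) := by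
  obtain ⟨⟨E, hE, hEe⟩, E', hE', hEe'⟩ := exists_cancellation
  have c0 := contDiffOn_coeff0.continuousOn
  have c1 := contDiffOn_coeff1.continuousOn
  have c2 := contDiffOn_coeff2.continuousOn
  have d0 := (contDiffOn_nuDeriv contDiffOn_coeff0).continuousOn
  have d1 := (contDiffOn_nuDeriv contDiffOn_coeff1).continuousOn
  have d2 := (contDiffOn_nuDeriv contDiffOn_coeff2).continuousOn
  have cs := contDiffOn_speedRatio.continuousOn.mul contDiffOn_sonic.continuousOn
  have j0 := oBound_symJet (N := 3) hνs hkK 0 (by norm_num)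
  have j1 := (oBound_symJet (N := 3) hνs hkK 1 (by norm_num)).charSpeed_mul hνs
  have j2 := oBound_symJet (N := 3) hνs hkK 2 (by norm_num)
  have j3 := (oBound_symJet (N := 3) hνs hkK 3 (by norm_num)).charSpeed_mul hνs
  have g := (oBound_G0 (N := 3) hνs hkK hK).charSpeed_mul hνs
  have g3 := ((g.charSpeed_mul hνs).charSpeed_mul hνs).of_le hνs hK (show 1 ≤ 3 by norm_num)
  have gg := (((oBound_G0 (N := 1) hνs hkK hK).charSpeed_mul hνs).charSpeed_mul hνs).charSpeed_mul
    hνs |>.of_le hνs hK (show 1 ≤ 3 by norm_num) |>.comp_iteratedDeriv 2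
  have k0 := ((j0.charSpeed_mul hνs).charSpeed_mul hνs).of_le hνs hK (show 1 ≤ 2 by norm_num)
  have k2 := ((j2.charSpeed_mul hνs).charSpeed_mul hνs).of_le hνs hK (show 1 ≤ 2 by norm_num)
  have r0 := (((j0.coeff_mul hνs hE).rho_mul hνs).rho_mul hνs).of_le hνs hK
    (show 1 ≤ 2 by norm_num)
  have r2 := ((((j2.coeff_mul hνs hE').rho_mul hνs).rho_mul hνs).of_le hνs hK
    (show 1 ≤ 2 by norm_num)).coeff_mul hνs (c0.div_const 4)
  have t1 := j1.coeff_mul hνs (d0.div_const 4)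
  have t2 := k0.coeff_mul hνs (d1.div_const 2)
  have t3 := j1.coeff_mul hνs ((c1.div_const 2).mul cs)
  have t4 := g3.coeff_mul hνs d2
  have t5 := g.coeff_mul hνs ((continuousOn_const (c := 3)).mul (c2.mul cs))
  have t6 := k0.coeff_mul hνs (c2.mul cs)
  have t7 := j3.coeff_mul hνs (c0.div_const 4)
  have t8 := k2.coeff_mul hνs (c1.div_const 2)
  have t9 := gg.coeff_mul hνs c2
  refine (((((((((r0.add r2).sub t1).add t2).add t3).add t4).add t5).add t6).sub t7).add
    (t8.add t9)).congr fun ψ _ ν hν => ?_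
  have hσ := rho_sq_lt ⟨hν.1.le, hν.2.trans hνs⟩
  have e1 := hEe _ hσ
  have e2 := hEe' _ hσ
  rw [rhoSingPartNu, singPart, symJet_iteratedDeriv_two, symJet_iteratedDeriv_two]
  simp only [Pi.mul_apply]
  generalize symJet 0 ψ (charSpeed ν) = u0
  norm_num
  generalize symJet 1 ψ (charSpeed ν) = u1
  generalize symJet 2 ψ (charSpeed ν) = u2
  generalize symJet 3 ψ (charSpeed ν) = u3
  generalize G0 (charSpeed ν) ψ = u4
  generalize G0 (charSpeed ν) (iteratedDeriv 2 ψ) = u5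
  linear_combination u0 * e1 + coeff0 (rho ν ^ 2) / 4 * u2 * e2

end Estimates

/-! ### The kernel as a functional -/

lemma exists_remainder_oBound {νs : ℝ} (hνs : νs ∈ Ioo 0 nuCr) : ∃ K, 0 < K ∧
    (∀ ν ∈ Ioo 0 νs, charSpeed ν ≤ K) ∧
    OBound νs K 1 1 (fun ψ ν => ∫ s, remainder ν s * ψ s) ∧
    OBound νs K 1 1 (fun ψ ν => rho ν * deriv (fun μ => ∫ s, remainder μ s * ψ s) ν) := by
  obtain ⟨K, C, hK, hC, hkK, h⟩ := remainder_pairing hνs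
  have key : ∀ ψ B, TestBound K 1 ψ B → ∀ ν ∈ Ioo 0 νs,
      |deriv (fun μ => ∫ s, remainder μ s * ψ s) ν| ≤ C * B ∧
      |∫ s, remainder ν s * ψ s| ≤ C * B * rho ν := by
    intro ψ B hψ ν hν
    refine (h ψ (hψ.1.of_le (by exact_mod_cast le_top)) B (fun s hs => ?_) (fun s hs => ?_) ν hν).2
    · simpa using hψ.2 0 (by norm_num) s hs
    · simpa using hψ.2 1 le_rfl s hs
  refine ⟨K, hK, hkK, ⟨C, hC, fun ψ B hψ ν hν => ?_⟩, ?_⟩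
  · rw [pow_one]
    exact (key ψ B hψ ν hν).2
  · have h0 : OBound νs K 1 0 (fun ψ ν => deriv (fun μ => ∫ s, remainder μ s * ψ s) ν) :=
      ⟨C, hC, fun ψ B hψ ν hν => by rw [pow_zero, mul_one]; exact (key ψ B hψ ν hν).1⟩
    exact h0.rho_mul hνs.2

lemma differentiableAt_remainder_pairing {ψ : ℝ → ℝ} (hψ : ContDiff ℝ ∞ ψ) {ν : ℝ}
    (hν : ν ∈ Ioo 0 nuCr) : DifferentiableAt ℝ (fun μ => ∫ s, remainder μ s * ψ s) ν := by
  obtain ⟨νs, h1, h2⟩ := exists_between hν.2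
  obtain ⟨K, C, hK, hC, hkK, h⟩ := remainder_pairing ⟨hν.1.trans h1, h2⟩
  have hψ1 : ContDiff ℝ 1 ψ := hψ.of_le (by exact_mod_cast le_top)
  obtain ⟨B₁, hB₁⟩ := (isCompact_Icc (a := -K) (b := K)).exists_bound_of_continuousOn
    hψ.continuous.continuousOn
  obtain ⟨B₂, hB₂⟩ := (isCompact_Icc (a := -K) (b := K)).exists_bound_of_continuousOn
    (hψ1.continuous_deriv le_rfl).continuousOn
  exact (h ψ hψ1 (max B₁ B₂) (fun s hs => (hB₁ s hs).trans (le_max_left _ _))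
    (fun s hs => (hB₂ s hs).trans (le_max_right _ _)) ν ⟨hν.1, h1⟩).1

lemma hasDerivAt_kernelInterior {ψ : ℝ → ℝ} (hψ : ContDiff ℝ ∞ ψ) {ν : ℝ} (hν : ν ∈ Ioo 0 nuCr) :
    HasDerivAt (fun μ => kernelInterior μ ψ) (rhoSingPartNu ψ ν / rho ν +
      deriv (fun μ => ∫ s, remainder μ s * ψ s) ν) ν := by
  refine ((hasDerivAt_singPart hψ hν).add
    (differentiableAt_remainder_pairing hψ hν).hasDerivAt).congr_of_eventuallyEq ?_
  filter_upwards [Ioo_mem_nhds hν.1 hν.2] with μ hμ using kernelInterior_eq ψ hμ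

lemma rhoKernelNuInterior_eq {ψ : ℝ → ℝ} (hψ : ContDiff ℝ ∞ ψ) {ν : ℝ} (hν : ν ∈ Ioo 0 nuCr) :
    rhoKernelNuInterior ν ψ = rhoSingPartNu ψ ν +
      rho ν * deriv (fun μ => ∫ s, remainder μ s * ψ s) ν := by
  have hp := (rho_pos hν).ne'
  rw [rhoKernelNuInterior, (hasDerivAt_kernelInterior hψ hν).deriv]
  field_simp

theorem exists_kernel_oBound {νs : ℝ} (hνs : νs ∈ Ioo 0 nuCr) : ∃ K, 0 < K ∧
    OBound νs K 1 0 (fun ψ ν => kernelInterior ν ψ) ∧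
    OBound νs K 3 0 (fun ψ ν => rhoKernelNuInterior ν ψ) ∧
    OBound νs K 3 1 (fun ψ ν => rhoKernelNuInterior ν ψ +
      kernelInterior ν (iteratedDeriv 2 ψ)) := by
  obtain ⟨K, hK, hkK, hr, hr'⟩ := exists_remainder_oBound hνs
  have hin : ∀ ν ∈ Ioo 0 νs, ν ∈ Ioo 0 nuCr := fun ν hν => ⟨hν.1, hν.2.trans hνs.2⟩
  have a1 : OBound νs K 1 0 (fun ψ ν => kernelInterior ν ψ) :=
    ((oBound_singPart hνs.2 hkK hK).add (hr.of_le hνs.2 hK zero_le_one)).congr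
      fun ψ _ ν hν => kernelInterior_eq ψ (hin ν hν)
  have hr3 : OBound νs K 3 1
      (fun ψ ν => rho ν * deriv (fun μ => ∫ s, remainder μ s * ψ s) ν) := by
    obtain ⟨C, hC, hb⟩ := hr'
    exact ⟨C, hC, fun ψ B hψ => hb ψ B ⟨hψ.1, fun i hi => hψ.2 i (by omega)⟩⟩
  have a3 : OBound νs K 3 1 (fun ψ ν => rhoKernelNuInterior ν ψ +
      kernelInterior ν (iteratedDeriv 2 ψ)) := by
    refine (((oBound_rhoSingPartNu_add hνs.2 hkK hK).add hr3).add
      (hr.comp_iteratedDeriv 2)).congr fun ψ hψ ν hν => ?_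
    rw [rhoKernelNuInterior_eq hψ (hin ν hν), kernelInterior_eq _ (hin ν hν)]
    ring
  refine ⟨K, hK, a1, ?_, a3⟩
  -- $\varrho H_\nu$ is bounded as the difference of $\varrho H_\nu+H_{ss}$ and $H_{ss}$.
  refine ((a3.of_le hνs.2 hK zero_le_one).sub (a1.comp_iteratedDeriv 2)).congr fun ψ _ ν _ => ?_
  ring

lemma exists_testBound {ψ : ℝ → ℝ} (hψ : ContDiff ℝ ∞ ψ) (K : ℝ) (N : ℕ) :
    ∃ B, TestBound K N ψ B := by
  have h : ∀ i, ∃ B, ∀ s ∈ Icc (-K) K, |iteratedDeriv i ψ s| ≤ B := fun i =>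
    isCompact_Icc.exists_bound_of_continuousOn (contDiff_iteratedDeriv hψ i).continuous.continuousOn
  choose B hB using h
  refine ⟨∑ i ∈ Finset.range (N + 1), |B i|, hψ, fun i hi s hs => ?_⟩
  refine ((hB i s hs).trans (le_abs_self _)).trans ?_
  exact Finset.single_le_sum (f := fun i => |B i|) (fun _ _ => abs_nonneg _)
    (Finset.mem_range.2 (by omega))

/-! ### Traces of the kernel at $\nu=0$ -/

lemma OBound.tendsto_zero {νs K : ℝ} (hνs : νs ∈ Ioo 0 nuCr) {N : ℕ} {T : (ℝ → ℝ) → ℝ → ℝ}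
    (h : OBound νs K N 1 T) {ψ : ℝ → ℝ} (hψ : ContDiff ℝ ∞ ψ) :
    Tendsto (T ψ) (𝓝[>] 0) (𝓝 0) := by
  obtain ⟨C, -, hb⟩ := h
  obtain ⟨B, hB⟩ := exists_testBound hψ K N
  have hlim := tendsto_rho_zero.const_mul (C * B)
  rw [mul_zero] at hlim
  refine squeeze_zero_norm' ?_ hlim
  filter_upwards [Ioo_mem_nhdsGT hνs.1] with ν hν
  simpa using hb ψ B hB ν hν

lemma tendsto_charSpeed_zero : Tendsto charSpeed (𝓝[>] 0) (𝓝 0) := by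
  have h1 : Tendsto (fun ν => rho ν * speedRatio (rho ν ^ 2)) (𝓝[>] 0) (𝓝 0) := by
    have := tendsto_nhdsGT_of_continuousOn (y := fun ν => rho ν * speedRatio (rho ν ^ 2))
      (continuousOn_rho.mul
      (continuousOn_comp_rho_sq contDiffOn_speedRatio.continuousOn))
    simpa [rho_zero] using this
  refine h1.congr' ?_
  filter_upwards [Ioo_mem_nhdsGT nuCr_pos] with ν hν
  exact (charSpeed_eq (Ioo_subset_Ico_self hν)).symm

lemma tendsto_kernelInterior {ψ : ℝ → ℝ} (hψ : ContDiff ℝ ∞ ψ) :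
    Tendsto (fun ν => kernelInterior ν ψ) (𝓝[>] 0) (𝓝 (ψ 0)) := by
  obtain ⟨νs, h1, h2⟩ := exists_between nuCr_pos
  obtain ⟨K, hK, hkK, hr, -⟩ := exists_remainder_oBound ⟨h1, h2⟩
  have tr := hr.tendsto_zero ⟨h1, h2⟩ hψ
  have tc : ∀ {F : ℝ → ℝ}, ContDiffOn ℝ ∞ F (Iio (1 / 2)) →
      Tendsto (fun ν => F (rho ν ^ 2)) (𝓝[>] 0) (𝓝 (F 0)) := by
    intro F hF
    have := tendsto_nhdsGT_of_continuousOn (continuousOn_comp_rho_sq hF.continuousOn)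
    simpa [rho_zero] using this
  have tj : ∀ n, Tendsto (fun ν => symJet n ψ (charSpeed ν)) (𝓝[>] 0) (𝓝 (symJet n ψ 0)) :=
    fun n => (hasDerivAt_symJet hψ n 0).continuousAt.tendsto.comp tendsto_charSpeed_zero
  have tg : Tendsto (fun ν => G0 (charSpeed ν) ψ) (𝓝[>] 0) (𝓝 (G0 0 ψ)) :=
    (hasDerivAt_G0 hψ 0).continuousAt.tendsto.comp tendsto_charSpeed_zero
  have tk := tendsto_charSpeed_zero
  have ts := (((((tc contDiffOn_coeff0).div_const 4).mul ((tj 0).sub (tk.mul (tj 1)))).add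
    (((tc contDiffOn_coeff1).div_const 2).mul ((tk.pow 2).mul (tj 0)))).add
    ((tc contDiffOn_coeff2).mul ((tk.pow 3).mul tg))).add tr
  -- Only the first term survives: $\frac24\cdot2\psi(0)=\psi(0)$, the normalization $d_0=2$.
  have e : coeff0 0 / 4 * (symJet 0 ψ 0 - 0 * symJet 1 ψ 0) + coeff1 0 / 2 * (0 ^ 2 * symJet 0 ψ 0)
      + coeff2 0 * (0 ^ 3 * G0 0 ψ) + 0 = ψ 0 := by
    rw [coeff0_zero]
    simp [symJet]
    ring
  rw [e] at ts
  refine ts.congr' ?_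
  filter_upwards [Ioo_mem_nhdsGT nuCr_pos] with ν hν
  rw [kernelInterior_eq ψ hν, singPart]

/-- Since $\varrho H_\nu+H_{ss}=O(\varrho)$, the limit is minus that of $H$ paired with $\psi''$. -/
lemma tendsto_rhoKernelNuInterior {ψ : ℝ → ℝ} (hψ : ContDiff ℝ ∞ ψ) :
    Tendsto (fun ν => rhoKernelNuInterior ν ψ) (𝓝[>] 0) (𝓝 (-iteratedDeriv 2 ψ 0)) := by
  obtain ⟨νs, h1, h2⟩ := exists_between nuCr_pos
  obtain ⟨K, hK, -, -, h⟩ := exists_kernel_oBound ⟨h1, h2⟩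
  have := (h.tendsto_zero ⟨h1, h2⟩ hψ).sub (tendsto_kernelInterior (contDiff_iteratedDeriv hψ 2))
  simpa using this

lemma singKernel_of_ne {ν : ℝ} (hν : ν ≠ 0) (ψ : ℝ → ℝ) :
    singKernel ν ψ = kernelInterior ν ψ := if_neg hν

lemma rhoSingKernelNu_of_ne {ν : ℝ} (hν : ν ≠ 0) (ψ : ℝ → ℝ) :
    rhoSingKernelNu ν ψ = rhoKernelNuInterior ν ψ := if_neg hν

lemma singKernel_zero {ψ : ℝ → ℝ} (hψ : ContDiff ℝ ∞ ψ) : singKernel 0 ψ = ψ 0 :=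
  (if_pos rfl).trans (tendsto_kernelInterior hψ).limUnder_eq

lemma rhoSingKernelNu_zero {ψ : ℝ → ℝ} (hψ : ContDiff ℝ ∞ ψ) :
    rhoSingKernelNu 0 ψ = -iteratedDeriv 2 ψ 0 :=
  (if_pos rfl).trans (tendsto_rhoKernelNuInterior hψ).limUnder_eq

lemma differentiableAt_singKernel {ψ : ℝ → ℝ} (hψ : ContDiff ℝ ∞ ψ) {ν : ℝ}
    (hν : ν ∈ Ioo 0 nuCr) : DifferentiableAt ℝ (fun μ => singKernel μ ψ) ν ∧
      rhoSingKernelNu ν ψ = rho ν * deriv (fun μ => singKernel μ ψ) ν := by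
  have he : (fun μ => singKernel μ ψ) =ᶠ[𝓝 ν] fun μ => kernelInterior μ ψ := by
    filter_upwards [Ioi_mem_nhds hν.1] with μ hμ using singKernel_of_ne (ne_of_gt hμ) ψ
  refine ⟨(hasDerivAt_kernelInterior hψ hν).differentiableAt.congr_of_eventuallyEq he, ?_⟩
  rw [he.deriv_eq, rhoSingKernelNu_of_ne hν.1.ne', rhoKernelNuInterior]

/-! ### Convolution estimates -/

lemma iterate_distDeriv_apply (j : ℕ) (T : Functional) (ψ : ℝ → ℝ) :
    distDeriv^[j] T ψ = (-1) ^ j * T (iteratedDeriv j ψ) := by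
  induction j generalizing T with
  | zero => simp
  | succ j ih =>
    rw [Function.iterate_succ_apply, ih, distDeriv, ← iteratedDeriv_succ, pow_succ]
    ring

lemma abs_conv_iterate_distDeriv (j : ℕ) (T : Functional) (φ : ℝ → ℝ) (s : ℝ) :
    |conv (distDeriv^[j] T) φ s| = |T (iteratedDeriv j fun t => φ (s - t))| := by
  rw [conv, iterate_distDeriv_apply, abs_mul, abs_pow, abs_neg, abs_one, one_pow, one_mul]

/-- A constant in the kernel estimates that depends only on bounds for the test function. -/
theorem kernelEstimates_of_testBound {νs : ℝ} (hνs : νs ∈ Ioo 0 nuCr) : ∃ K C, 0 < K ∧ 0 < C ∧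
    ∀ φ : ℝ → ℝ, ∀ B s, (∀ j ≤ 2, TestBound K 3 (iteratedDeriv j fun t => φ (s - t)) B) →
      ∀ ν ∈ Ico 0 νs, KernelEstimates φ (C * B) ν s := by
  obtain ⟨K, hK, ⟨C₁, hC₁, h1⟩, ⟨C₂, hC₂, h2⟩, C₃, hC₃, h3⟩ := exists_kernel_oBound hνs
  -- The summand $2$ serves $\nu=0$, where the second estimate reads $|\psi''(0)|+|\psi'(0)|\le2B$.
  refine ⟨K, 2 + C₁ + C₂ + C₃, hK, by positivity, fun φ B s hφ ν hν j hj => ?_⟩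
  have hψ := hφ j hj
  rw [abs_conv_iterate_distDeriv, abs_conv_iterate_distDeriv, abs_conv_iterate_distDeriv]
  generalize (iteratedDeriv j fun t => φ (s - t)) = ψ at hψ
  have hB := hψ.nonneg hK
  have e2 : distDeriv (distDeriv (singKernel ν)) ψ = singKernel ν (iteratedDeriv 2 ψ) := by
    have := iterate_distDeriv_apply 2 (singKernel ν) ψ
    simpa using this
  have e1 : |distDeriv (singKernel ν) ψ| = |singKernel ν (iteratedDeriv 1 ψ)| := by
    rw [distDeriv, abs_neg, iteratedDeriv_one]
  rw [e2, e1]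
  have n1 : 0 ≤ C₁ * B := by positivity
  have n2 : 0 ≤ C₂ * B := by positivity
  have n3 : 0 ≤ C₃ * B := by positivity
  rcases hν.1.eq_or_lt with h0 | h0
  -- At $\nu=0$ the right side $C\varrho$ is $0$, so the first estimate requires the traces to
  -- cancel exactly: $-\psi''(0)+\psi''(0)=0$.
  · subst h0
    rw [rhoSingKernelNu_zero hψ.1, singKernel_zero (contDiff_iteratedDeriv hψ.1 2),
      singKernel_zero (contDiff_iteratedDeriv hψ.1 1), rho_zero, neg_add_cancel, abs_zero, mul_zero,
      abs_neg]
    have b1 := hψ.2 1 (by norm_num) 0 ⟨by linarith, hK.le⟩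
    have b2 := hψ.2 2 (by norm_num) 0 ⟨by linarith, hK.le⟩
    exact ⟨le_rfl, by linarith⟩
  · have hν' : ν ∈ Ioo 0 νs := ⟨h0, hν.2⟩
    have hp := rho_pos ⟨h0, hν.2.trans hνs.2⟩
    rw [rhoSingKernelNu_of_ne h0.ne', singKernel_of_ne h0.ne', singKernel_of_ne h0.ne']
    have b1 := h1 (iteratedDeriv 1 ψ) B (TestBound.iteratedDeriv
      ⟨hψ.1, fun i hi => hψ.2 i (by omega)⟩) ν hν'
    have b2 := h2 ψ B hψ ν hν'
    have b3 := h3 ψ B hψ ν hν'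
    rw [pow_zero, mul_one] at b1 b2
    rw [pow_one] at b3
    have m1 : 0 ≤ (2 + C₁ + C₂) * B * rho ν := by positivity
    exact ⟨by linarith, by linarith⟩

lemma abs_iteratedDeriv_comp_const_sub (n : ℕ) (φ : ℝ → ℝ) (s t : ℝ) :
    |iteratedDeriv n (fun t => φ (s - t)) t| = |iteratedDeriv n φ (s - t)| := by
  rw [iteratedDeriv_comp_const_sub]
  simp [abs_mul]

lemma testBound_comp_const_sub {φ : ℝ → ℝ} (hφ : ContDiff ℝ ∞ φ) {K B s : ℝ} {N j : ℕ}
    (h : ∀ i ≤ N + j, ∀ t ∈ Icc (-K) K, |iteratedDeriv i φ (s - t)| ≤ B) :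
    TestBound K N (iteratedDeriv j fun t => φ (s - t)) B := by
  refine TestBound.iteratedDeriv ⟨hφ.comp (by fun_prop), fun i hi t ht => ?_⟩
  rw [abs_iteratedDeriv_comp_const_sub]
  exact h i hi t ht

/-- The kernel estimates on a set of `s` where the relevant derivatives of `φ` are bounded. -/
lemma exists_kernelEstimates {νs : ℝ} (hνs : νs ∈ Ioo 0 nuCr) : ∃ K, 0 < K ∧
    ∀ φ : ℝ → ℝ, ContDiff ℝ ∞ φ → ∀ A : Set ℝ,
      (∃ B, ∀ i ≤ 5, ∀ s ∈ A, ∀ t ∈ Icc (-K) K, |iteratedDeriv i φ (s - t)| ≤ B) →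
      ∃ C, 0 < C ∧ ∀ ν ∈ Icc 0 νs, ∀ s ∈ A, KernelEstimates φ C ν s := by
  -- The previous bounds hold on half-open intervals; a slightly larger endpoint includes $\nu_s$.
  -- Derivatives up to order $5$ are needed: $3$ for the kernel bounds and $2$ for $\partial_s^j$.
  obtain ⟨ν', h1, h2⟩ := exists_between hνs.2
  obtain ⟨K, C, hK, hC, h⟩ := kernelEstimates_of_testBound ⟨hνs.1.trans h1, h2⟩
  refine ⟨K, hK, fun φ hφ A ⟨B, hB⟩ => ⟨C * max B 1, by positivity, fun ν hν s hs => ?_⟩⟩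
  refine h φ _ s (fun j hj => testBound_comp_const_sub hφ fun i hi t ht => ?_) ν
    ⟨hν.1, hν.2.trans_lt h1⟩
  exact (hB i (by omega) s hs t ht).trans (le_max_left _ _)

/-- For $|s|\le S$ and $|t|\le K$ the argument $s-t$ stays in $[-(S+K),S+K]$, where smoothness alone
bounds the derivatives of $\varphi$. -/
theorem kernelEstimates_local {νs : ℝ} (hνs : νs ∈ Ioo 0 nuCr) {φ : ℝ → ℝ} (hφ : ContDiff ℝ ∞ φ)
    (S : ℝ) : ∃ C : ℝ, 0 < C ∧ ∀ ν ∈ Icc 0 νs, ∀ s ∈ Icc (-S) S, KernelEstimates φ C ν s := by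
  obtain ⟨K, hK, h⟩ := exists_kernelEstimates hνs
  obtain ⟨B, hB⟩ := exists_testBound hφ (S + K) 5
  exact h φ hφ _ ⟨B, fun i hi s hs t ht =>
    hB.2 i hi (s - t) ⟨by linarith [hs.1, ht.2], by linarith [hs.2, ht.1]⟩⟩

theorem kernelEstimates_global {νs : ℝ} (hνs : νs ∈ Ioo 0 nuCr) {φ : ℝ → ℝ} (hφ : ContDiff ℝ ∞ φ)
    (hb : ∀ n : ℕ, ∃ B : ℝ, ∀ t : ℝ, |iteratedDeriv n φ t| ≤ B) :
    ∃ C : ℝ, 0 < C ∧ ∀ ν ∈ Icc 0 νs, ∀ s : ℝ, KernelEstimates φ C ν s := by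
  obtain ⟨K, hK, h⟩ := exists_kernelEstimates hνs
  choose B hB using hb
  obtain ⟨C, hC, hest⟩ := h φ hφ univ ⟨∑ i ∈ Finset.range 6, |B i|, fun i hi s _ t _ =>
    ((hB i (s - t)).trans (le_abs_self _)).trans (Finset.single_le_sum (f := fun i => |B i|)
      (fun _ _ => abs_nonneg _) (Finset.mem_range.2 (by omega)))⟩
  exact ⟨C, hC, fun ν hν s => hest ν hν s (mem_univ s)⟩

lemma tendsto_singKernel {ψ : ℝ → ℝ} (hψ : ContDiff ℝ ∞ ψ) :
    Tendsto (fun ν => singKernel ν ψ) (𝓝[>] 0) (𝓝 (ψ 0)) := by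
  refine (tendsto_kernelInterior hψ).congr' ?_
  filter_upwards [self_mem_nhdsWithin] with ν hν using (singKernel_of_ne (ne_of_gt hν) ψ).symm

lemma tendsto_rhoSingKernelNu {ψ : ℝ → ℝ} (hψ : ContDiff ℝ ∞ ψ) :
    Tendsto (fun ν => rhoSingKernelNu ν ψ) (𝓝[>] 0) (𝓝 (-iteratedDeriv 2 ψ 0)) := by
  refine (tendsto_rhoKernelNuInterior hψ).congr' ?_
  filter_upwards [self_mem_nhdsWithin] with ν hν using (rhoSingKernelNu_of_ne (ne_of_gt hν) ψ).symm

end Cavitation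

end

theorem mainTheorem7 :
    -- the singular kernel is well defined and supported in the light cone
    (∀ ξ : ℝ, IsRemainderTransform ξ (remainderTransform ξ) ∧
      ∀ y, IsRemainderTransform ξ y → EqOn y (remainderTransform ξ) (Ico 0 nuCr)) ∧
    (∀ ν ∈ Ioo 0 nuCr,
      Integrable (fun ξ => remainderTransform ξ ν) ∧
      ∀ s : ℝ, charSpeed ν < |s| → remainder ν s = 0) ∧
    -- it is differentiable in `ν`
    (∀ ψ : ℝ → ℝ, ContDiff ℝ ∞ ψ → ∀ ν ∈ Ioo 0 nuCr,
      DifferentiableAt ℝ (fun μ => singKernel μ ψ) ν ∧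
      rhoSingKernelNu ν ψ = rho ν * deriv (fun μ => singKernel μ ψ) ν) ∧
    -- the cancellation estimates
    (∀ νs ∈ Ioo 0 nuCr, ∀ φ : ℝ → ℝ, ContDiff ℝ ∞ φ →
      (∀ S : ℝ, ∃ C : ℝ, 0 < C ∧ ∀ ν ∈ Icc 0 νs, ∀ s ∈ Icc (-S) S,
        KernelEstimates φ C ν s) ∧
      ((∀ n : ℕ, ∃ B : ℝ, ∀ t : ℝ, |iteratedDeriv n φ t| ≤ B) →
        ∃ C : ℝ, 0 < C ∧ ∀ ν ∈ Icc 0 νs, ∀ s : ℝ, KernelEstimates φ C ν s)) ∧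
    -- the initial conditions `H = δ₀` and `ϱ H_ν = -δ₀''` at `ν = 0`
    (∀ ψ : ℝ → ℝ, ContDiff ℝ ∞ ψ →
      Tendsto (fun ν => singKernel ν ψ) (𝓝[>] 0) (𝓝 (ψ 0)) ∧
      Tendsto (fun ν => rhoSingKernelNu ν ψ) (𝓝[>] 0) (𝓝 (-iteratedDeriv 2 ψ 0)) ∧
      singKernel 0 ψ = ψ 0 ∧ rhoSingKernelNu 0 ψ = -iteratedDeriv 2 ψ 0) := by
  refine ⟨fun ξ => ⟨isRemainderTransform_remainderTransform ξ, fun y hy =>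
      hy.eqOn (isRemainderTransform_remainderTransform ξ)⟩,
    fun ν hν => ⟨integrable_remainderTransform hν, fun s hs => remainder_eq_zero hν hs.le⟩,
    fun ψ hψ ν hν => differentiableAt_singKernel hψ hν,
    fun νs hνs φ hφ => ⟨kernelEstimates_local hνs hφ, kernelEstimates_global hνs hφ⟩,
    fun ψ hψ => ⟨tendsto_singKernel hψ, tendsto_rhoSingKernelNu hψ, singKernel_zero hψ,
      rhoSingKernelNu_zero hψ⟩⟩
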